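/- Let $S^1=\mathbb R/\mathbb Z$ with Lebesgue measure of total mass one. Let $f:S^1\to S^1$ and $h:S^1\times S^1\to\mathbb R$ be of class $C^5$. Assume that $|f'(x)|>\omega$ for all $x\in S^1$, for some $\omega>1$, and that $$N\Big(\frac{\max|f''|}{\omega^3}+\frac1{\omega^2}\Big)<1,$$ where $N$ is the number of preimages under $f$ of a point of $S^1$. Let $P$ be the transfer operator of $f$, $P\varphi(x)=\sum_{f(y)=x}\varphi(y)/|f'(y)|$. For $t\in\mathbb R$ and a function $\psi$ on $S^1$ put $$A_\psi(x)=\int_{S^1}h(x,y)\psi(y)\,dy,\qquad \Phi_{t,\psi}(x)=x+tA_\psi(x),\qquad Q_{t,\psi}\varphi=\frac{\varphi}{\Phi_{t,\psi}'}\circ\Phi_{t,\psi}^{-1},\qquad \mathcal L_t\psi=PQ_{t,\psi}\psi .$$ Then there is $\varepsilon_0>0$ such that, for all $|t|\le\varepsilon_0$, the map $\Phi_{t,\psi}$ is a $C^5$ diffeomorphism of $S^1$ with $\Phi'_{t,\psi}>0$ for every continuous probability density $\psi$ on $S^1$, the operator $\mathcal L_t$ has a unique fixed point $\rho(t)$ among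 the positive Lipschitz probability densities on $S^1$, and the following hold. (i) $\rho(t)\in C^3(S^1,\mathbb R)$ for all $|t|\le\varepsilon_0$. (ii) There is $\varepsilon_2\in(0,\varepsilon_0]$ such that $t\mapsto\rho(t)$ belongs to $C^1([-\varepsilon_2,\varepsilon_2],C^1(S^1,\mathbb R))$. (iii) Put $P_t=PQ_{t,\rho(t)}$ and $$\Theta_t(g)=\Big(\Big(\frac{\rho(t)}{\Phi_{t,\rho(t)}'}\,A_g\Big)\circ\Phi_{t,\rho(t)}^{-1}\Big)',\qquad g\in C^1(S^1,\mathbb R),$$ and let $C^1_0$ be the Banach space of all $g\in C^1(S^1,\mathbb R)$ with $\int_{S^1} g=0$. There is $\varepsilon_3\in(0,\varepsilon_2]$ such that for every $|\hat t|<\varepsilon_3$ the operator $1-P_{\hat t}+\hat tP\Theta_{\hat t}$ is a bounded operator on $C^1_0$ with a bounded inverse, $P\Theta_{\hat t}(\rho(\hat t))\in C^1_0$, and $$\partial_t\rho(t)\big|_{t=\hat t}=-\big(1-P_{\hat t}+\hat tP\Theta_{\hat t}\big)^{-1}P\Theta_{\hat t}(\rho(\hat t)),$$ the derivative being taken in $C^1(S^1,\mathbb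 R)$. In particular, $1-P$ is a bounded operator on $C^1_0$ with a bounded inverse, $P\big((\rho(0)A_{\rho(0)})'\big)\in C^1_0$, and $$\partial_t\rho(t)\big|_{t=0}=-(1-P)^{-1}P\big((\rho(0)A_{\rho(0)})'\big).$$ -/

import Mathlib

open MeasureTheory Set

noncomputable section

namespace SelfConsistent

/-- The circle `ℝ / ℤ`; its Haar measure `volume` has total mass one. -/
abbrev S1 : Type := UnitAddCircle

/-! ### Calculus on the circle -/

/-- A real function on the circle is of class `C^n` if its periodic lift to `ℝ` is. -/
def FunContDiff (n : WithTop ℕ∞) (g : S1 → ℝ) : Prop :=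
  ContDiff ℝ n (fun x : ℝ => g (x : S1))

/-- A real function on the torus is of class `C^n` if its doubly periodic lift to `ℝ²` is. -/
def TorusContDiff (n : WithTop ℕ∞) (h : S1 → S1 → ℝ) : Prop :=
  ContDiff ℝ n (fun p : ℝ × ℝ => h (p.1 : S1) (p.2 : S1))

/-- A map of the circle to itself is of class `C^n` if it has a `C^n` lift to `ℝ`. -/
def MapContDiff (n : WithTop ℕ∞) (T : S1 → S1) : Prop :=
  ∃ F : ℝ → ℝ, ContDiff ℝ n F ∧ ∀ x : ℝ, T (x : S1) = (F x : S1)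

/-- `C^n` diffeomorphisms of the circle. -/
def IsDiffeo (n : WithTop ℕ∞) (T : S1 → S1) : Prop :=
  ∃ S : S1 → S1, Function.LeftInverse S T ∧ Function.RightInverse S T ∧
    MapContDiff n T ∧ MapContDiff n S

/-- The derivative `g'` of a real function on the circle. -/
def funDeriv (g : S1 → ℝ) (x : S1) : ℝ :=
  deriv (fun s : ℝ => g (x + (s : S1))) 0

/-- The representative in `[-1/2, 1/2)` of a point of the circle. -/
def rep (z : S1) : ℝ :=
  (AddCircle.equivIco (1 : ℝ) (-(1 / 2)) z : ℝ)

/-- The derivative `T'` of a map of the circle to itself: the increments `T (x + s) - T x`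
are small for small `s` (if `T` is continuous) and are read off as real numbers. -/
def mapDeriv (T : S1 → S1) (x : S1) : ℝ :=
  deriv (fun s : ℝ => rep (T (x + (s : S1)) - T x)) 0

theorem funDeriv_coe (g : S1 → ℝ) (x : ℝ) :
    funDeriv g (x : S1) = deriv (fun y : ℝ => g (y : S1)) x := by
  have h := deriv_comp_const_add (fun y : ℝ => g (y : S1)) x 0
  simpa [funDeriv] using h

theorem rep_coe {r : ℝ} (hr : |r| < 1 / 2) : rep (r : S1) = r := by
  have h1 := abs_lt.1 hr
  unfold rep
  rw [AddCircle.equivIco_coe_of_mem (p := (1 : ℝ)) (a := -(1 / 2)) (y := r)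
    ⟨by linarith, by linarith⟩]

/-- The derivative of a circle map is the derivative of any of its lifts. -/
theorem mapDeriv_coe {T : S1 → S1} {F : ℝ → ℝ} (hF : ∀ x : ℝ, T (x : S1) = (F x : S1))
    {x : ℝ} (hd : DifferentiableAt ℝ F x) : mapDeriv T (x : S1) = deriv F x := by
  have hc : ContinuousAt (fun s : ℝ => F (x + s) - F x) 0 := by
    have h0 : ContinuousAt F (x + 0) := by simpa using hd.continuousAt
    exact (ContinuousAt.comp (f := fun s : ℝ => x + s) h0 (by fun_prop)).sub continuousAt_const
  have hev : ∀ᶠ s in nhds (0 : ℝ), |F (x + s) - F x| < 1 / 2 := by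
    have := hc.abs
    exact this.eventually_lt_const (by simp)
  have heq : (fun s : ℝ => rep (T ((x : S1) + (s : S1)) - T (x : S1)))
      =ᶠ[nhds 0] fun s : ℝ => F (x + s) - F x := by
    filter_upwards [hev] with s hs
    rw [← AddCircle.coe_add, hF, hF, ← AddCircle.coe_sub, rep_coe hs]
  unfold mapDeriv
  rw [heq.deriv_eq, deriv_sub_const]
  simpa using deriv_comp_const_add F x 0

/-! ### The uncoupled map -/

/-- The number of preimages under `f` of a point of the circle; all points have equally many
when `f` is a covering map. -/
def coveringNumber (f : S1 → S1) : ℕ :=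
  (f ⁻¹' {0}).ncard

/-- The transfer operator `P` of `f`:
`(P φ)(x) = ∑ φ(y) / |f'(y)|`, the sum being over the preimages `y` of `x`. -/
def transfer (f : S1 → S1) (φ : S1 → ℝ) (x : S1) : ℝ :=
  ∑ᶠ y : f ⁻¹' {x}, φ y / |mapDeriv f y|

/-! ### The coupling -/

/-- `A_ψ(x) = ∫ h(x, y) ψ(y) dy`. -/
def meanField (h : S1 → S1 → ℝ) (ψ : S1 → ℝ) (x : S1) : ℝ :=
  ∫ y, h x y * ψ y

/-- `Φ_{t,ψ}(x) = x + t A_ψ(x)`. -/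
def couplingMap (h : S1 → S1 → ℝ) (t : ℝ) (ψ : S1 → ℝ) (x : S1) : S1 :=
  x + ((t * meanField h ψ x : ℝ) : S1)

/-- `Φ'_{t,ψ}(x) = 1 + t A'_ψ(x)`. -/
def couplingDeriv (h : S1 → S1 → ℝ) (t : ℝ) (ψ : S1 → ℝ) (x : S1) : ℝ :=
  1 + t * funDeriv (meanField h ψ) x

/-- `Φ_{t,ψ}⁻¹`. -/
def couplingInv (h : S1 → S1 → ℝ) (t : ℝ) (ψ : S1 → ℝ) : S1 → S1 :=
  Function.invFun (couplingMap h t ψ)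

/-- `Q_{t,ψ} φ = (φ / Φ'_{t,ψ}) ∘ Φ_{t,ψ}⁻¹`, the transfer operator of `Φ_{t,ψ}`. -/
def couplingTransfer (h : S1 → S1 → ℝ) (t : ℝ) (ψ φ : S1 → ℝ) (x : S1) : ℝ :=
  φ (couplingInv h t ψ x) / couplingDeriv h t ψ (couplingInv h t ψ x)

/-- `𝓛_{t,ψ} = P Q_{t,ψ}`. -/
def coupledTransfer (f : S1 → S1) (h : S1 → S1 → ℝ) (t : ℝ) (ψ φ : S1 → ℝ) : S1 → ℝ :=
  transfer f (couplingTransfer h t ψ φ)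

/-- The self-consistent transfer operator `𝓛_t ψ = P Q_{t,ψ} ψ`. -/
def selfConsistentTransfer (f : S1 → S1) (h : S1 → S1 → ℝ) (t : ℝ) (ψ : S1 → ℝ) : S1 → ℝ :=
  coupledTransfer f h t ψ ψ

/-- `φ` is a positive Lipschitz probability density fixed by `𝓛_t`. -/
def IsFixedDensity (f : S1 → S1) (h : S1 → S1 → ℝ) (t : ℝ) (φ : S1 → ℝ) : Prop :=
  (∃ K, LipschitzWith K φ) ∧ (∀ x, 0 < φ x) ∧ ∫ x, φ x = 1 ∧
    selfConsistentTransfer f h t φ = φ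

/-- `Θ_t(g) = ((ρ / Φ'_{t,ρ} · A_g) ∘ Φ_{t,ρ}⁻¹)'`. -/
def theta (h : S1 → S1 → ℝ) (t : ℝ) (ρ g : S1 → ℝ) : S1 → ℝ :=
  funDeriv (fun x => ρ (couplingInv h t ρ x) / couplingDeriv h t ρ (couplingInv h t ρ x)
    * meanField h g (couplingInv h t ρ x))

/-! ### The space `C¹(S¹, ℝ)` -/

/-- `C¹(S¹, ℝ)` as the space of pairs `(g, g')` of continuous functions, with the norm
`max (‖g‖_∞, ‖g'‖_∞)`. -/
def c1Submodule : Submodule ℝ (C(S1, ℝ) × C(S1, ℝ)) where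
  carrier := {p | ∀ x : ℝ, HasDerivAt (fun s : ℝ => p.1 (s : S1)) (p.2 (x : S1)) x}
  add_mem' := fun ha hb x => (ha x).add (hb x)
  zero_mem' := fun x => hasDerivAt_const x (0 : ℝ)
  smul_mem' := fun c _ ha x => (ha x).const_mul c

/-- The normed space `C¹(S¹, ℝ)`. -/
abbrev C1 : Type := c1Submodule

/-- The function underlying an element of `C¹(S¹, ℝ)`. -/
def C1.fn (g : C1) : S1 → ℝ := fun x => g.1.1 x

/-- The subspace `C¹₀(S¹, ℝ)` of the functions of zero mean. -/
def c1ZeroMean : Submodule ℝ C1 where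
  carrier := {g | ∫ x, C1.fn g x = 0}
  add_mem' := by
    intro a b ha hb
    have hi : ∀ g : C1, Integrable (C1.fn g) := fun g =>
      g.1.1.continuous.integrable_of_hasCompactSupport (HasCompactSupport.of_compactSpace _)
    have h := integral_add (hi a) (hi b)
    simp only [mem_ofPred_eq] at ha hb ⊢
    rw [ha, hb, add_zero] at h
    exact h
  zero_mem' := by simp [C1.fn]
  smul_mem' := by
    intro c a ha
    have h := integral_const_mul (μ := (volume : Measure S1)) c (C1.fn a)
    simp only [mem_ofPred_eq] at ha ⊢
    rw [ha, mul_zero] at h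
    exact h

end SelfConsistent

end

/-! All analysis is done on lifts: functions on the circle become 1-periodic functions on ℝ, and
`CkBound` plays the role of the C^k norm.

The engine is the identity (Tφ)' = T((aφ)'), valid for the transfer operator T of a map with
reciprocal derivative a. It is part of `IsTransfer` and applies both to P and to the transfer
operator Q_u of a near-identity diffeomorphism x + u(x). A periodic function of zero mean is bounded
by the supremum of its derivative, so on such functions P multiplies sup|φ'| by at most (N/ω)(1/ω +
max|f''|/ω²), and the hypothesis says precisely that this is below 1. Hence L_u = P Q_u contracts C¹
functions of zero mean, uniformly over small u (`L_contraction`). Higher derivatives obey a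
Lasota–Yorke inequality whose leading coefficient is again below 1
(`exists_abs_iteratedDeriv_L_le`). Therefore 1 - L_u is invertible on C³ functions of zero mean,
with bounds in C^k for k ≤ 3, and L_u has a C³ invariant density ρ_u, unique among Lipschitz ones.

The operator Q_u is Lipschitz in u at the cost of one derivative. Since (1 - L_w)(ρ_w - ρ_u) = P(Q_w
- Q_u)ρ_u, the density ρ_u is Lipschitz in u as an element of C². With u = tA_ψ and t small, ψ ↦ ρ_u
is then a contraction for the sup norm on densities, and its fixed point is ρ(t). Positivity of ρ(t)
spreads from one small interval to the whole circle because f∘Φ is expanding.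

For the response formula, Q_{u+v}φ = Q_uφ - Q_u((a_u v φ)') + O(v²) in C¹ when φ is C³
(`exists_perturbRemainder_ckBound_one`). Inserting the fixed point equations at times s and t, and
writing δ = ρ(s) - ρ(t), gives (1 - P_t + tPΘ_t)δ = -(s - t)PΘ_t(ρ(t)) + O(|s - t|²), uniformly in s
and t. For small t the operator on the left is still 1 minus a contraction of C¹₀, so it can be
inverted. A uniform quadratic remainder yields the derivative and also its Lipschitz continuity, by
exchanging s and t, so continuity of the right-hand side of the formula never has to be studied
separately. -/

namespace SelfConsistent

/-! ### Periodic functions of class `C^k` with bounded derivatives -/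

/-- `φ` is a `1`-periodic function of class `C^k` whose derivatives of order at most `k` are
bounded by `M`. -/
structure CkBound (k : ℕ) (φ : ℝ → ℝ) (M : ℝ) : Prop where
  contDiff : ContDiff ℝ k φ
  periodic : Function.Periodic φ 1
  bound : ∀ i ≤ k, ∀ x, |iteratedDeriv i φ x| ≤ M

theorem periodic_deriv {φ : ℝ → ℝ} (h : Function.Periodic φ 1) :
    Function.Periodic (deriv φ) 1 := by
  intro x
  rw [← deriv_comp_add_const φ 1 x]
  congr 1
  exact funext h

theorem periodic_iteratedDeriv {φ : ℝ → ℝ} (h : Function.Periodic φ 1) (k : ℕ) :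
    Function.Periodic (iteratedDeriv k φ) 1 := by
  induction k with
  | zero => simpa using h
  | succ k ih => rw [iteratedDeriv_succ]; exact periodic_deriv ih

/-- A continuous periodic function attains its maximal absolute value. -/
theorem exists_forall_abs_le {φ : ℝ → ℝ} (hc : Continuous φ) (hp : Function.Periodic φ 1) :
    ∃ x₀, ∀ x, |φ x| ≤ |φ x₀| := by
  obtain ⟨x₀, -, hx₀⟩ := isCompact_Icc.exists_isMaxOn (s := Icc (0 : ℝ) 1)
    ⟨0, by simp⟩ hc.abs.continuousOn
  refine ⟨x₀, fun x => ?_⟩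
  obtain ⟨y, hy, hxy⟩ := hp.exists_mem_Ico₀ one_pos x
  rw [hxy]
  exact hx₀ ⟨hy.1, hy.2.le⟩

namespace CkBound

variable {k : ℕ} {φ ψ : ℝ → ℝ} {M M' : ℝ}

theorem abs_le (h : CkBound k φ M) (x : ℝ) : |φ x| ≤ M := by
  simpa using h.bound 0 (Nat.zero_le _) x

theorem nonneg (h : CkBound k φ M) : 0 ≤ M := (abs_nonneg _).trans (h.abs_le 0)

theorem continuous (h : CkBound k φ M) : Continuous φ := h.contDiff.continuous

theorem mono (h : CkBound k φ M) (hM : M ≤ M') : CkBound k φ M' :=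
  ⟨h.contDiff, h.periodic, fun i hi x => (h.bound i hi x).trans hM⟩

theorem of_le {j : ℕ} (h : CkBound k φ M) (hj : j ≤ k) : CkBound j φ M :=
  ⟨h.contDiff.of_le (by exact_mod_cast hj), h.periodic, fun i hi x => h.bound i (hi.trans hj) x⟩

theorem zero_iff : CkBound 0 φ M ↔ Continuous φ ∧ Function.Periodic φ 1 ∧ ∀ x, |φ x| ≤ M := by
  constructor
  · exact fun h => ⟨h.continuous, h.periodic, h.abs_le⟩
  · rintro ⟨h1, h2, h3⟩
    refine ⟨contDiff_zero.2 h1, h2, fun i hi x => ?_⟩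
    obtain rfl : i = 0 := by omega
    simpa using h3 x

/-- The recursive form through which C^k estimates are proved by induction on k, never touching
higher derivatives directly. -/
theorem succ_iff : CkBound (k + 1) φ M ↔ Differentiable ℝ φ ∧ Function.Periodic φ 1 ∧
    (∀ x, |φ x| ≤ M) ∧ CkBound k (deriv φ) M := by
  have key : ContDiff ℝ ((k + 1 : ℕ) : WithTop ℕ∞) φ ↔
      Differentiable ℝ φ ∧ ContDiff ℝ k (deriv φ) := by
    push_cast
    rw [contDiff_succ_iff_deriv]
    simp
  constructor
  · intro h
    refine ⟨(key.1 h.contDiff).1, h.periodic, h.abs_le, (key.1 h.contDiff).2,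
      periodic_deriv h.periodic, fun i hi x => ?_⟩
    rw [← iteratedDeriv_succ']
    exact h.bound (i + 1) (by omega) x
  · rintro ⟨h1, h2, h3, h4⟩
    refine ⟨key.2 ⟨h1, h4.contDiff⟩, h2, fun i hi x => ?_⟩
    cases i with
    | zero => simpa using h3 x
    | succ i => rw [iteratedDeriv_succ']; exact h4.bound i (by omega) x

theorem differentiable (h : CkBound (k + 1) φ M) : Differentiable ℝ φ := (succ_iff.1 h).1

theorem deriv (h : CkBound (k + 1) φ M) : CkBound k (deriv φ) M := (succ_iff.1 h).2.2.2

theorem abs_deriv_le (h : CkBound (k + 1) φ M) (x : ℝ) : |_root_.deriv φ x| ≤ M :=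
  h.deriv.abs_le x

theorem contDiff_one (h : CkBound (k + 1) φ M) : ContDiff ℝ 1 φ := by
  have := (h.of_le (j := 1) (by omega)).contDiff
  exact_mod_cast this

theorem const (k : ℕ) (r : ℝ) : CkBound k (fun _ => r) |r| := by
  refine ⟨contDiff_const, fun x => rfl, fun i hi x => ?_⟩
  rw [iteratedDeriv_const]
  split_ifs <;> simp

theorem add (h : CkBound k φ M) (h' : CkBound k ψ M') :
    CkBound k (fun x => φ x + ψ x) (M + M') := by
  refine ⟨h.contDiff.add h'.contDiff, h.periodic.add h'.periodic, fun i hi x => ?_⟩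
  have e : (fun x => φ x + ψ x) = φ + ψ := rfl
  rw [e, iteratedDeriv_add (h.contDiff.contDiffAt.of_le (by exact_mod_cast hi))
    (h'.contDiff.contDiffAt.of_le (by exact_mod_cast hi))]
  exact (abs_add_le _ _).trans (add_le_add (h.bound i hi x) (h'.bound i hi x))

theorem const_mul (h : CkBound k φ M) (r : ℝ) : CkBound k (fun x => r * φ x) (|r| * M) := by
  refine ⟨contDiff_const.mul h.contDiff, fun x => by simp only [h.periodic x], fun i hi x => ?_⟩
  rw [iteratedDeriv_const_mul_field, abs_mul]
  exact mul_le_mul_of_nonneg_left (h.bound i hi x) (abs_nonneg _)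

theorem neg (h : CkBound k φ M) : CkBound k (fun x => -φ x) M := by
  simpa using h.const_mul (-1)

theorem sub (h : CkBound k φ M) (h' : CkBound k ψ M') :
    CkBound k (fun x => φ x - ψ x) (M + M') := by
  simpa [sub_eq_add_neg] using h.add h'.neg

/-- Each application of the product rule doubles the number of terms, whence the crude constant 2^k;
only its independence of the functions matters. -/
theorem mul (h : CkBound k φ M) (h' : CkBound k ψ M') :
    CkBound k (fun x => φ x * ψ x) (2 ^ k * (M * M')) := by
  induction k generalizing φ ψ with
  | zero =>
    refine zero_iff.2 ⟨h.continuous.mul h'.continuous, h.periodic.mul h'.periodic, fun x => ?_⟩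
    rw [abs_mul, pow_zero, one_mul]
    exact mul_le_mul (h.abs_le x) (h'.abs_le x) (abs_nonneg _) h.nonneg
  | succ k ih =>
    have hd : _root_.deriv (fun x => φ x * ψ x) =
        fun x => _root_.deriv φ x * ψ x + φ x * _root_.deriv ψ x := by
      funext x
      exact deriv_fun_mul (h.differentiable x) (h'.differentiable x)
    have hn := mul_nonneg h.nonneg h'.nonneg
    refine succ_iff.2 ⟨h.differentiable.mul h'.differentiable, h.periodic.mul h'.periodic,
      fun x => ?_, ?_⟩
    · rw [abs_mul]
      refine (mul_le_mul (h.abs_le x) (h'.abs_le x) (abs_nonneg _) h.nonneg).trans ?_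
      exact le_mul_of_one_le_left hn (one_le_pow₀ (by norm_num))
    · rw [hd]
      refine ((ih h.deriv (h'.of_le k.le_succ)).add (ih (h.of_le k.le_succ) h'.deriv)).mono ?_
      rw [pow_succ]
      linarith

end CkBound

theorem exists_ckBound {k : ℕ} {φ : ℝ → ℝ} (hc : ContDiff ℝ k φ)
    (hp : Function.Periodic φ 1) : ∃ M, CkBound k φ M := by
  induction k generalizing φ with
  | zero =>
    obtain ⟨x₀, hx₀⟩ := exists_forall_abs_le hc.continuous hp
    exact ⟨_, CkBound.zero_iff.2 ⟨hc.continuous, hp, hx₀⟩⟩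
  | succ k ih =>
    obtain ⟨x₀, hx₀⟩ := exists_forall_abs_le hc.continuous hp
    have hc' : ContDiff ℝ (k + 1) φ := by exact_mod_cast hc
    obtain ⟨hd, -, h2⟩ := contDiff_succ_iff_deriv.1 hc'
    obtain ⟨M, hM⟩ := ih h2 (periodic_deriv hp)
    exact ⟨max |φ x₀| M, CkBound.succ_iff.2 ⟨hd, hp, fun x => (hx₀ x).trans (le_max_left _ _),
      hM.mono (le_max_right _ _)⟩⟩

/-- The leading term of the Leibniz formula. -/
theorem exists_abs_iteratedDeriv_mul_le (k : ℕ) (A : ℝ) : ∃ C, 0 ≤ C ∧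
    ∀ (a : ℝ → ℝ) (α : ℝ), CkBound k a A → (∀ x, |a x| ≤ α) →
    ∀ (φ : ℝ → ℝ) (M B : ℝ), ContDiff ℝ k φ → Function.Periodic φ 1 → 0 ≤ M →
      (∀ i < k, ∀ x, |iteratedDeriv i φ x| ≤ M) → (∀ x, |iteratedDeriv k φ x| ≤ B) →
      ∀ x, |iteratedDeriv k (fun x => a x * φ x) x| ≤ α * B + C * M := by
  induction k with
  | zero =>
    refine ⟨0, le_rfl, fun a α ha hα φ M B _ _ _ _ hB x => ?_⟩
    simp only [iteratedDeriv_zero] at hB ⊢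
    rw [abs_mul, zero_mul, add_zero]
    exact mul_le_mul (hα x) (hB x) (abs_nonneg _) ((abs_nonneg _).trans (hα x))
  | succ k ih =>
    obtain ⟨C, hC, h⟩ := ih
    refine ⟨2 ^ k * |A| + C, by positivity, fun a α ha hα φ M B hφ hp hM hl hB x => ?_⟩
    have hφ' : ContDiff ℝ (k + 1) φ := by exact_mod_cast hφ
    obtain ⟨hd, -, hφd⟩ := contDiff_succ_iff_deriv.1 hφ'
    have hφk : CkBound k φ M := ⟨hφ.of_le (by exact_mod_cast k.le_succ), hp,
      fun i hi => hl i (by omega)⟩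
    have e : deriv (fun x => a x * φ x) = fun x => deriv a x * φ x + a x * deriv φ x := by
      funext x
      exact deriv_fun_mul (ha.differentiable x) (hd x)
    -- In (aφ)' only the term aφ' carries the top derivative of φ; the term a'φ is absorbed into the
    -- multiple of M.
    have h1 := (ha.deriv.mul hφk)
    have h2 := h a α (ha.of_le k.le_succ) hα (deriv φ) M B hφd (periodic_deriv hp) hM
      (fun i hi => by rw [← iteratedDeriv_succ']; exact hl (i + 1) (by omega))
      (by rw [← iteratedDeriv_succ']; exact hB) x
    have e2 : (fun x => deriv a x * φ x + a x * deriv φ x) =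
      (fun x => deriv a x * φ x) + fun x => a x * deriv φ x := rfl
    rw [iteratedDeriv_succ', e, e2, iteratedDeriv_add h1.contDiff.contDiffAt
      (((ha.of_le k.le_succ).contDiff.mul hφd).contDiffAt)]
    refine (abs_add_le _ _).trans ?_
    have h3 := h1.bound k le_rfl x
    have h4 : A * M ≤ |A| * M := mul_le_mul_of_nonneg_right (le_abs_self A) hM
    have h5 : (0 : ℝ) ≤ 2 ^ k := by positivity
    nlinarith

/-- A periodic function of zero mean is bounded by its Lipschitz constant. -/
theorem abs_le_of_integral_eq_zero {φ : ℝ → ℝ} {K : ℝ} (hc : Continuous φ)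
    (hp : Function.Periodic φ 1) (hK : ∀ x y, |φ x - φ y| ≤ K * |x - y|)
    (h0 : ∫ x in (0 : ℝ)..1, φ x = 0) (x : ℝ) : |φ x| ≤ K := by
  have hK0 : 0 ≤ K := by simpa using (abs_nonneg _).trans (hK 1 0)
  -- By zero mean, φ(x) is the integral of φ(x) - φ(y) over y in [x, x + 1], where |x - y| ≤ 1.
  have h1 : ∫ y in x..x + 1, φ y = 0 := by
    rw [hp.intervalIntegral_add_eq x 0]; simpa using h0
  have h2 : ∫ y in x..x + 1, (φ x - φ y) = φ x := by
    rw [intervalIntegral.integral_sub (by simp) (hc.intervalIntegrable _ _), h1]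
    simp
  have h3 := intervalIntegral.norm_integral_le_of_norm_le_const (a := x) (b := x + 1)
    (f := fun y => φ x - φ y) (C := K) (fun y hy => by
      rw [uIoc_of_le (by linarith)] at hy
      refine (hK x y).trans (mul_le_of_le_one_right hK0 ?_)
      rw [abs_le]; constructor <;> linarith [hy.1, hy.2])
  rw [h2] at h3
  simpa using h3

theorem abs_sub_le_of_abs_deriv_le {φ : ℝ → ℝ} {K : ℝ} (hd : Differentiable ℝ φ)
    (hK : ∀ x, |deriv φ x| ≤ K) (x y : ℝ) : |φ x - φ y| ≤ K * |x - y| :=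
  Convex.norm_image_sub_le_of_norm_deriv_le (s := univ) (fun z _ => hd z) (fun z _ => hK z)
    convex_univ (mem_univ y) (mem_univ x)

theorem integral_deriv_eq_zero {φ : ℝ → ℝ} (hφ : ContDiff ℝ 1 φ)
    (hp : Function.Periodic φ 1) : ∫ x in (0 : ℝ)..1, deriv φ x = 0 := by
  rw [intervalIntegral.integral_deriv_eq_sub (fun x _ => hφ.differentiable one_ne_zero x)
    ((hφ.continuous_deriv le_rfl).intervalIntegrable _ _)]
  have := hp 0
  simp only [zero_add] at this
  rw [this, sub_self]

end SelfConsistent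

namespace SelfConsistent

/-! ### Transfer operators on periodic functions -/

/-- The properties of the transfer operator `T` of a circle map `F`, with `a = 1 / F'`, that are
used below. -/
structure IsTransfer (T : (ℝ → ℝ) → ℝ → ℝ) (a : ℝ → ℝ) (c : ℝ) : Prop where
  add : ∀ φ ψ : ℝ → ℝ, T (fun x => φ x + ψ x) = fun x => T φ x + T ψ x
  const_mul : ∀ (r : ℝ) (φ : ℝ → ℝ), T (fun x => r * φ x) = fun x => r * T φ x
  map_nonneg : ∀ φ : ℝ → ℝ, (∀ x, 0 ≤ φ x) → ∀ x, 0 ≤ T φ x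
  bound : ∀ (φ : ℝ → ℝ) (M : ℝ), (∀ x, |φ x| ≤ M) → ∀ x, |T φ x| ≤ c * M
  periodic : ∀ φ : ℝ → ℝ, Function.Periodic φ 1 → Function.Periodic (T φ) 1
  continuous : ∀ φ : ℝ → ℝ, Continuous φ → Continuous (T φ)
  -- Up to a constant sign, Tφ is the sum of (aφ)∘g over the inverse branches g, and g' = a∘g.
  -- Differentiation therefore returns the same operator, applied to (aφ)'.
  hasDerivAt : ∀ φ : ℝ → ℝ, ContDiff ℝ 1 φ → ∀ x,
    HasDerivAt (T φ) (T (deriv fun y => a y * φ y) x) x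
  integral : ∀ φ : ℝ → ℝ, Continuous φ → Function.Periodic φ 1 →
    ∫ x in (0 : ℝ)..1, T φ x = ∫ x in (0 : ℝ)..1, φ x

namespace IsTransfer

variable {T : (ℝ → ℝ) → ℝ → ℝ} {a : ℝ → ℝ} {c : ℝ}

theorem coeff_nonneg (h : IsTransfer T a c) : 0 ≤ c := by
  simpa using (abs_nonneg _).trans (h.bound (fun _ => 1) 1 (by simp) 0)

theorem neg (h : IsTransfer T a c) (φ : ℝ → ℝ) : T (fun x => -φ x) = fun x => -T φ x := by
  simpa using h.const_mul (-1) φ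

theorem sub (h : IsTransfer T a c) (φ ψ : ℝ → ℝ) :
    T (fun x => φ x - ψ x) = fun x => T φ x - T ψ x := by
  have := h.add φ (fun x => -ψ x)
  rw [h.neg] at this
  simpa only [sub_eq_add_neg] using this

theorem deriv_eq (h : IsTransfer T a c) {φ : ℝ → ℝ} (hφ : ContDiff ℝ 1 φ) :
    deriv (T φ) = T (deriv fun y => a y * φ y) :=
  funext fun x => (h.hasDerivAt φ hφ x).deriv

theorem differentiable (h : IsTransfer T a c) {φ : ℝ → ℝ} (hφ : ContDiff ℝ 1 φ) :
    Differentiable ℝ (T φ) := fun x => (h.hasDerivAt φ hφ x).differentiableAt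

end IsTransfer

/-- Transfer operators are bounded on `C^k`. -/
theorem exists_transfer_ckBound (k : ℕ) (A c₀ : ℝ) : ∃ C, 0 ≤ C ∧
    ∀ (T : (ℝ → ℝ) → ℝ → ℝ) (a : ℝ → ℝ) (c : ℝ), IsTransfer T a c → c ≤ c₀ → CkBound k a A →
    ∀ (φ : ℝ → ℝ) (M : ℝ), CkBound k φ M → CkBound k (T φ) (C * M) := by
  induction k with
  | zero =>
    refine ⟨|c₀|, abs_nonneg _, fun T a c hT hc ha φ M hφ => CkBound.zero_iff.2
      ⟨hT.continuous φ hφ.continuous, hT.periodic φ hφ.periodic, fun x =>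
      (hT.bound φ M hφ.abs_le x).trans ?_⟩⟩
    exact mul_le_mul_of_nonneg_right (hc.trans (le_abs_self _)) hφ.nonneg
  | succ k ih =>
    obtain ⟨C, hC, h⟩ := ih
    refine ⟨|c₀| + C * (2 ^ (k + 1) * |A|), by positivity, fun T a c hT hc ha φ M hφ =>
      CkBound.succ_iff.2 ⟨hT.differentiable hφ.contDiff_one, hT.periodic φ hφ.periodic,
      fun x => ?_, ?_⟩⟩
    · refine (hT.bound φ M hφ.abs_le x).trans
        (mul_le_mul_of_nonneg_right ((hc.trans (le_abs_self _)).trans ?_) hφ.nonneg)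
      have : 0 ≤ C * (2 ^ (k + 1) * |A|) := by positivity
      linarith
    · rw [hT.deriv_eq hφ.contDiff_one]
      refine (h T a c hT hc (ha.of_le k.le_succ) _ _ (ha.mul hφ).deriv).mono ?_
      have h1 : A * M ≤ |A| * M := mul_le_mul_of_nonneg_right (le_abs_self A) hφ.nonneg
      have h2 : 0 ≤ |c₀| * M := mul_nonneg (abs_nonneg _) hφ.nonneg
      have h3 : C * (2 ^ (k + 1) * (A * M)) ≤ C * (2 ^ (k + 1) * (|A| * M)) := by gcongr
      nlinarith

/-- The leading term of the derivatives of `T φ`. -/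
theorem exists_abs_iteratedDeriv_transfer_le (k : ℕ) (A c₀ α₀ : ℝ) : ∃ C, 0 ≤ C ∧
    ∀ (T : (ℝ → ℝ) → ℝ → ℝ) (a : ℝ → ℝ) (c α : ℝ), IsTransfer T a c → c ≤ c₀ →
    CkBound k a A → (∀ x, |a x| ≤ α) → α ≤ α₀ →
    ∀ (φ : ℝ → ℝ) (M B : ℝ), ContDiff ℝ k φ → Function.Periodic φ 1 → 0 ≤ M →
      (∀ i < k, ∀ x, |iteratedDeriv i φ x| ≤ M) → (∀ x, |iteratedDeriv k φ x| ≤ B) →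
      ∀ x, |iteratedDeriv k (T φ) x| ≤ c * α ^ k * B + C * M := by
  induction k with
  | zero =>
    refine ⟨0, le_rfl, fun T a c α hT _ ha hα _ φ M B _ _ _ _ hB x => ?_⟩
    simp only [iteratedDeriv_zero, pow_zero] at hB ⊢
    simpa using hT.bound φ B hB x
  | succ k ih =>
    obtain ⟨C, hC, h⟩ := ih
    obtain ⟨C', hC', h'⟩ := exists_abs_iteratedDeriv_mul_le (k + 1) A
    refine ⟨|c₀| * |α₀| ^ k * C' + C * (2 ^ k * |A|), by positivity,
      fun T a c α hT hc ha hα hα₀ φ M B hφ hp hM hl hB x => ?_⟩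
    have hφ1 : ContDiff ℝ 1 φ := hφ.of_le (by exact_mod_cast Nat.le_add_left 1 k)
    have hφk : CkBound k φ M := ⟨hφ.of_le (by exact_mod_cast k.le_succ), hp,
      fun i hi => hl i (by omega)⟩
    have hα0 : 0 ≤ α := (abs_nonneg _).trans (hα 0)
    have hprod : ContDiff ℝ ((k : WithTop ℕ∞) + 1) fun y => a y * φ y := by
      exact_mod_cast ha.contDiff.mul hφ
    have hprodp : Function.Periodic (fun y => a y * φ y) 1 := ha.periodic.mul hp
    have hlow := (ha.of_le k.le_succ).mul hφk
    have hAM : A * M ≤ |A| * M := mul_le_mul_of_nonneg_right (le_abs_self A) hM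
    -- One differentiation replaces φ by (aφ)', whose k-th derivative has leading coefficient at
    -- most α. This supplies the additional factor α.
    rw [iteratedDeriv_succ', hT.deriv_eq hφ1]
    refine (h T a c α hT hc (ha.of_le k.le_succ) hα hα₀ (deriv fun y => a y * φ y)
      (2 ^ k * (|A| * M)) (α * B + C' * M) (contDiff_succ_iff_deriv.1 hprod).2.2
      (periodic_deriv hprodp) (by positivity) (fun i hi y => ?_) (fun y => ?_) x).trans ?_
    · rw [← iteratedDeriv_succ']
      refine (hlow.bound (i + 1) hi y).trans ?_
      gcongr
    · rw [← iteratedDeriv_succ']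
      exact h' a α ha hα φ M B hφ hp hM hl hB y
    · have h1 : c * α ^ k ≤ |c₀| * |α₀| ^ k := by
        refine mul_le_mul (hc.trans (le_abs_self _)) ?_ (by positivity) (abs_nonneg _)
        exact pow_le_pow_left₀ hα0 (hα₀.trans (le_abs_self _)) k
      have h2 : c * α ^ k * (C' * M) ≤ |c₀| * |α₀| ^ k * (C' * M) :=
        mul_le_mul_of_nonneg_right h1 (by positivity)
      rw [pow_succ]
      nlinarith

/-! ### The transfer operator of a perturbation of the identity -/

/-- The inverse of `x ↦ x + u x`. -/
noncomputable def perturbInv (u : ℝ → ℝ) : ℝ → ℝ := Function.invFun fun x => x + u x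

/-- The transfer operator of `x ↦ x + u x`. -/
noncomputable def perturbTransfer (u φ : ℝ → ℝ) (x : ℝ) : ℝ :=
  φ (perturbInv u x) / (1 + deriv u (perturbInv u x))

/-- A periodic `C^4` function that is small enough for `x ↦ x + u x` to be a diffeomorphism. -/
structure IsSmall (η : ℝ) (u : ℝ → ℝ) : Prop where
  ckBound : CkBound 4 u η
  le_half : η ≤ 1 / 2

/-- The derivative of the inverse of `x ↦ x + u x`, as a function of the preimage. -/
noncomputable def perturbWeight (u : ℝ → ℝ) (x : ℝ) : ℝ := 1 / (1 + deriv u x)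

theorem perturbTransfer_apply (u φ : ℝ → ℝ) (x : ℝ) :
    perturbTransfer u φ x = perturbWeight u (perturbInv u x) * φ (perturbInv u x) := by
  unfold perturbTransfer perturbWeight
  ring

namespace IsSmall

variable {η : ℝ} {u : ℝ → ℝ}

theorem nonneg (h : IsSmall η u) : 0 ≤ η := h.ckBound.nonneg

theorem abs_deriv_le (h : IsSmall η u) (x : ℝ) : |deriv u x| ≤ η := h.ckBound.abs_deriv_le x

theorem half_le (h : IsSmall η u) (x : ℝ) : 1 / 2 ≤ 1 + deriv u x := by
  have := abs_le.1 (h.abs_deriv_le x)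
  linarith [h.le_half]

theorem pos (h : IsSmall η u) (x : ℝ) : 0 < 1 + deriv u x := by linarith [h.half_le x]

theorem hasDerivAt (h : IsSmall η u) (x : ℝ) :
    HasDerivAt (fun x => x + u x) (1 + deriv u x) x :=
  (hasDerivAt_id x).add (h.ckBound.differentiable x).hasDerivAt

theorem strictMono (h : IsSmall η u) : StrictMono fun x => x + u x :=
  strictMono_of_deriv_pos fun x => by rw [(h.hasDerivAt x).deriv]; exact h.pos x

theorem surjective (h : IsSmall η u) : Function.Surjective fun x => x + u x := by
  have hb := fun x => abs_le.1 (h.ckBound.abs_le x)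
  refine Continuous.surjective (continuous_id.add h.ckBound.continuous) ?_ ?_
  · exact Filter.tendsto_atTop_mono (fun x => (by linarith [(hb x).1] : x + -η ≤ x + u x))
      (Filter.tendsto_atTop_add_const_right _ (-η) Filter.tendsto_id)
  · exact Filter.tendsto_atBot_mono (fun x => (by linarith [(hb x).2] : x + u x ≤ x + η))
      (Filter.tendsto_atBot_add_const_right _ η Filter.tendsto_id)

theorem right_inv (h : IsSmall η u) (x : ℝ) : perturbInv u x + u (perturbInv u x) = x :=
  Function.rightInverse_invFun h.surjective x

theorem left_inv (h : IsSmall η u) (x : ℝ) : perturbInv u (x + u x) = x :=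
  Function.leftInverse_invFun h.strictMono.injective x

/-- `x ↦ x + u x` as a homeomorphism. -/
noncomputable def homeomorph (h : IsSmall η u) : ℝ ≃ₜ ℝ :=
  (h.strictMono.orderIsoOfSurjective _ h.surjective).toHomeomorph

theorem homeomorph_apply (h : IsSmall η u) (x : ℝ) : h.homeomorph x = x + u x := rfl

theorem homeomorph_symm_apply (h : IsSmall η u) (x : ℝ) :
    h.homeomorph.symm x = perturbInv u x := by
  rw [Homeomorph.symm_apply_eq, homeomorph_apply, h.right_inv]

theorem contDiff_inv (h : IsSmall η u) {n : WithTop ℕ∞} (hu : ContDiff ℝ n u) :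
    ContDiff ℝ n (perturbInv u) := by
  have h1 : ContDiff ℝ n h.homeomorph.symm :=
    h.homeomorph.contDiff_symm_deriv (fun x => (h.pos x).ne') h.hasDerivAt (contDiff_id.add hu)
  rwa [funext h.homeomorph_symm_apply] at h1

theorem continuous_inv (h : IsSmall η u) : Continuous (perturbInv u) :=
  (h.contDiff_inv h.ckBound.contDiff).continuous

theorem inv_add_one (h : IsSmall η u) (x : ℝ) : perturbInv u (x + 1) = perturbInv u x + 1 := by
  apply h.strictMono.injective
  simp only
  rw [h.right_inv, h.ckBound.periodic, add_right_comm, h.right_inv]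

theorem hasDerivAt_inv (h : IsSmall η u) (x : ℝ) :
    HasDerivAt (perturbInv u) (perturbWeight u (perturbInv u x)) x := by
  have := HasDerivAt.of_local_left_inverse (f := fun x => x + u x) (g := perturbInv u) (a := x)
    h.continuous_inv.continuousAt (h.hasDerivAt _) (h.pos _).ne'
    (Filter.Eventually.of_forall h.right_inv)
  rwa [perturbWeight, one_div]

theorem weight_pos (h : IsSmall η u) (x : ℝ) : 0 < perturbWeight u x :=
  one_div_pos.2 (h.pos x)

theorem weight_le (h : IsSmall η u) (x : ℝ) : perturbWeight u x ≤ (1 - η)⁻¹ := by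
  have := abs_le.1 (h.abs_deriv_le x)
  rw [perturbWeight, one_div]
  exact inv_anti₀ (by linarith [h.le_half]) (by linarith)

theorem inv_one_sub_le (h : IsSmall η u) : (1 - η)⁻¹ ≤ 2 := by
  have : (2⁻¹ : ℝ)⁻¹ = 2 := inv_inv _
  rw [← this]
  exact inv_anti₀ (by norm_num) (by linarith [h.le_half])

theorem abs_weight_le (h : IsSmall η u) (x : ℝ) : |perturbWeight u x| ≤ (1 - η)⁻¹ := by
  rw [abs_of_pos (h.weight_pos x)]
  exact h.weight_le x

theorem hasDerivAt_weight (h : IsSmall η u) (x : ℝ) : HasDerivAt (perturbWeight u)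
    (-(deriv (deriv u) x * (perturbWeight u x * perturbWeight u x))) x := by
  have h1 := ((h.ckBound.deriv.differentiable x).hasDerivAt.const_add 1).inv (h.pos x).ne'
  have e : perturbWeight u = (fun y => 1 + deriv u y)⁻¹ := by
    funext y; simp [perturbWeight]
  rw [← e] at h1
  refine h1.congr_deriv ?_
  rw [perturbWeight]
  field_simp

theorem abs_deriv_weight_le (h : IsSmall η u) (x : ℝ) :
    |deriv (perturbWeight u) x| ≤ η * ((1 - η)⁻¹ * (1 - η)⁻¹) := by
  rw [(h.hasDerivAt_weight x).deriv, abs_neg, abs_mul, abs_mul]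
  have := h.abs_weight_le x
  have h2 := h.ckBound.deriv.abs_deriv_le x
  have h3 : 0 ≤ (1 - η)⁻¹ := (abs_nonneg _).trans this
  have h4 := h.nonneg
  gcongr

theorem continuous_weight (h : IsSmall η u) : Continuous (perturbWeight u) :=
  continuous_iff_continuousAt.2 fun x => (h.hasDerivAt_weight x).continuousAt

end IsSmall

/-- The weight a satisfies a' = -u'' a², so its C^{k+1} bound follows from its C^k bound. The weight
involves u', hence C^4 control of u yields C^3 control, with one constant for all small u. -/
theorem exists_weight_ckBound : ∃ C, 0 ≤ C ∧ ∀ (η : ℝ) (u : ℝ → ℝ), IsSmall η u →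
    CkBound 3 (perturbWeight u) C := by
  have main : ∀ k : ℕ, k ≤ 3 → ∃ C, 0 ≤ C ∧ ∀ (η : ℝ) (u : ℝ → ℝ), IsSmall η u →
      CkBound k (perturbWeight u) C := by
    intro k
    have hper : ∀ {η : ℝ} {u : ℝ → ℝ}, IsSmall η u → Function.Periodic (perturbWeight u) 1 :=
      fun hu x => by simp only [perturbWeight, periodic_deriv hu.ckBound.periodic x]
    induction k with
    | zero =>
      refine fun _ => ⟨2, by norm_num, fun η u hu => CkBound.zero_iff.2 ⟨?_, hper hu, fun x =>
        (hu.abs_weight_le x).trans hu.inv_one_sub_le⟩⟩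
      exact hu.continuous_weight
    | succ k ih =>
      intro hk
      obtain ⟨C, hC, h⟩ := ih (by omega)
      refine ⟨2 + 2 ^ k * (1 / 2 * (2 ^ k * (C * C))), by positivity, fun η u hu =>
        CkBound.succ_iff.2 ⟨fun x => (hu.hasDerivAt_weight x).differentiableAt, hper hu,
          fun x => ?_, ?_⟩⟩
      · refine ((hu.abs_weight_le x).trans hu.inv_one_sub_le).trans ?_
        have : 0 ≤ 2 ^ k * (1 / 2 * (2 ^ k * (C * C))) := by positivity
        linarith
      · rw [funext fun x => (hu.hasDerivAt_weight x).deriv]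
        have h1 : CkBound k (deriv (deriv u)) (1 / 2) :=
          ((hu.ckBound.deriv.deriv).of_le (by omega)).mono hu.le_half
        exact (h1.mul ((h η u hu).mul (h η u hu))).neg.mono (by linarith)
  exact main 3 le_rfl

theorem IsSmall.isTransfer {η : ℝ} {u : ℝ → ℝ} (h : IsSmall η u) :
    IsTransfer (perturbTransfer u) (perturbWeight u) (1 - η)⁻¹ where
  add φ ψ := by funext x; simp only [perturbTransfer_apply]; ring
  const_mul r φ := by funext x; simp only [perturbTransfer_apply]; ring
  map_nonneg φ hφ x := by
    rw [perturbTransfer_apply]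
    exact mul_nonneg (h.weight_pos _).le (hφ _)
  bound φ M hφ x := by
    rw [perturbTransfer_apply, abs_mul]
    exact mul_le_mul (h.abs_weight_le _) (hφ _) (abs_nonneg _)
      ((abs_nonneg _).trans (h.abs_weight_le 0))
  periodic φ hφ x := by
    simp only [perturbTransfer_apply, h.inv_add_one, hφ _]
    congr 1
    simp only [perturbWeight, periodic_deriv h.ckBound.periodic _]
  continuous φ hφ := by
    have h2 := (h.continuous_weight.comp h.continuous_inv).mul (hφ.comp h.continuous_inv)
    exact h2.congr fun x => (perturbTransfer_apply u φ x).symm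
  hasDerivAt φ hφ x := by
    have h1 : DifferentiableAt ℝ (fun y => perturbWeight u y * φ y) (perturbInv u x) :=
      (h.hasDerivAt_weight _).differentiableAt.mul (hφ.differentiable one_ne_zero _)
    have h2 := h1.hasDerivAt.comp x (h.hasDerivAt_inv x)
    rw [perturbTransfer_apply, mul_comm]
    exact h2.congr_of_eventuallyEq
      (Filter.Eventually.of_forall fun y => perturbTransfer_apply u φ y)
  integral φ hφ hp := by
    have h2 := intervalIntegral.integral_comp_mul_deriv (a := 0) (b := 1) (f := perturbInv u)
      (f' := fun x => perturbWeight u (perturbInv u x)) (g := φ)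
      (fun x _ => h.hasDerivAt_inv x) (h.continuous_weight.comp h.continuous_inv).continuousOn hφ
    have h3 := h.inv_add_one 0
    rw [zero_add] at h3
    rw [h3, hp.intervalIntegral_add_eq _ 0, zero_add] at h2
    rw [← h2]
    refine intervalIntegral.integral_congr fun x _ => ?_
    simp only [perturbTransfer_apply, Function.comp_apply, mul_comm]

end SelfConsistent

namespace SelfConsistent

/-! ### Dependence of the transfer operator on the perturbation -/

/-- `u` and `w` are small, and `w = u + v` with `v` of size at most `ζ` in `C^4`. -/
structure IsSmallPair (η ζ : ℝ) (u w v : ℝ → ℝ) : Prop where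
  left : IsSmall η u
  right : IsSmall η w
  diff : CkBound 4 v ζ
  eq_add : ∀ x, w x = u x + v x

namespace IsSmallPair

variable {η ζ : ℝ} {u w v : ℝ → ℝ}

theorem deriv_eq (h : IsSmallPair η ζ u w v) (x : ℝ) : deriv w x = deriv u x + deriv v x := by
  rw [funext h.eq_add]
  exact deriv_fun_add (h.left.ckBound.differentiable x) (h.diff.differentiable x)

theorem weight_sub (h : IsSmallPair η ζ u w v) (x : ℝ) :
    perturbWeight w x - perturbWeight u x =
      -(deriv v x * (perturbWeight u x * perturbWeight w x)) := by
  have h1 := (h.left.pos x).ne'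
  have h2 := (h.right.pos x).ne'
  simp only [perturbWeight]
  field_simp
  rw [h.deriv_eq x]
  ring

theorem inv_sub_eq (h : IsSmallPair η ζ u w v) (x : ℝ) :
    perturbInv w x - perturbInv u x =
      -v (perturbInv w x) - (u (perturbInv w x) - u (perturbInv u x)) := by
  have h1 := h.left.right_inv x
  have h2 := h.right.right_inv x
  rw [h.eq_add] at h2
  linarith

/-- By `inv_sub_eq`, the distance d of the two preimages satisfies d ≤ ζ + ηd with η ≤ 1/2. -/
theorem abs_inv_sub_le (h : IsSmallPair η ζ u w v) (x : ℝ) :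
    |perturbInv w x - perturbInv u x| ≤ 2 * ζ := by
  have h1 := abs_sub_le_of_abs_deriv_le h.left.ckBound.differentiable h.left.abs_deriv_le
    (perturbInv w x) (perturbInv u x)
  have h2 := h.diff.abs_le (perturbInv w x)
  have h3 : |perturbInv w x - perturbInv u x| ≤
      |v (perturbInv w x)| + |u (perturbInv w x) - u (perturbInv u x)| := by
    rw [h.inv_sub_eq x]
    exact (abs_sub _ _).trans (by rw [abs_neg])
  have h4 : η * |perturbInv w x - perturbInv u x| ≤ 1 / 2 * |perturbInv w x - perturbInv u x| :=
    mul_le_mul_of_nonneg_right h.left.le_half (abs_nonneg _)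
  linarith

end IsSmallPair

theorem exists_weight_sub_ckBound : ∃ C, 0 ≤ C ∧ ∀ (η ζ : ℝ) (u w v : ℝ → ℝ),
    IsSmallPair η ζ u w v →
    CkBound 3 (fun x => perturbWeight w x - perturbWeight u x) (C * ζ) := by
  obtain ⟨A, hA, hw⟩ := exists_weight_ckBound
  refine ⟨2 ^ 3 * (2 ^ 3 * (A * A)), by positivity, fun η ζ u w v h => ?_⟩
  rw [funext h.weight_sub]
  exact ((h.diff.deriv.mul ((hw η u h.left).mul (hw η w h.right))).neg).mono (by linarith)

/-- The transfer operator depends on the perturbation in a Lipschitz way, with the loss of one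
derivative. -/
theorem exists_perturbTransfer_sub_ckBound (k : ℕ) (hk : k ≤ 2) : ∃ C, 0 ≤ C ∧
    ∀ (η ζ : ℝ) (u w v : ℝ → ℝ), IsSmallPair η ζ u w v →
    ∀ (φ : ℝ → ℝ) (M : ℝ), CkBound (k + 1) φ M →
      CkBound k (fun x => perturbTransfer w φ x - perturbTransfer u φ x) (C * (ζ * M)) := by
  obtain ⟨A, hA, hw⟩ := exists_weight_ckBound
  obtain ⟨D, hD, hws⟩ := exists_weight_sub_ckBound
  induction k with
  | zero =>
    refine ⟨D + 4 * A, by positivity, fun η ζ u w v h φ M hφ => CkBound.zero_iff.2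
      ⟨(h.right.isTransfer.continuous φ hφ.continuous).sub
        (h.left.isTransfer.continuous φ hφ.continuous),
      (h.right.isTransfer.periodic φ hφ.periodic).sub
        (h.left.isTransfer.periodic φ hφ.periodic), fun x => ?_⟩⟩
    simp only [perturbTransfer_apply]
    have h1 := ((hw η u h.left).of_le (j := 1) (by norm_num)).mul hφ
    have h2 := abs_sub_le_of_abs_deriv_le h1.differentiable h1.abs_deriv_le
      (perturbInv w x) (perturbInv u x)
    have h3 := (hws η ζ u w v h).abs_le (perturbInv w x)
    have h4 := hφ.abs_le (perturbInv w x)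
    have h5 := h.abs_inv_sub_le x
    have hM := hφ.nonneg
    have e : perturbWeight w (perturbInv w x) * φ (perturbInv w x) -
        perturbWeight u (perturbInv u x) * φ (perturbInv u x) =
        (perturbWeight w (perturbInv w x) - perturbWeight u (perturbInv w x))
          * φ (perturbInv w x) + (perturbWeight u (perturbInv w x) * φ (perturbInv w x) -
        perturbWeight u (perturbInv u x) * φ (perturbInv u x)) := by ring
    rw [e]
    refine (abs_add_le _ _).trans ?_
    rw [abs_mul]
    have h6 := mul_le_mul h3 h4 (abs_nonneg _) ((abs_nonneg _).trans h3)
    have h7 := mul_le_mul_of_nonneg_left h5 (by positivity : 0 ≤ 2 ^ 1 * (A * M))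
    linarith
  | succ k ih =>
    obtain ⟨C, hC, hk'⟩ := ih (by omega)
    obtain ⟨B, hB, hT⟩ := exists_transfer_ckBound k A 2
    refine ⟨C + (C * (2 ^ (k + 2) * A) + B * (2 ^ (k + 1) * D)), by positivity,
      fun η ζ u w v h φ M hφ => ?_⟩
    have hM := hφ.nonneg
    have hζ := h.diff.nonneg
    have hφ1 := hφ.contDiff_one
    have hmφ := ((hw η u h.left).of_le (j := k + 1 + 1) (by omega)).mul hφ
    have hdφ := ((hws η ζ u w v h).of_le (j := k + 1) (by omega)).mul (hφ.of_le (k + 1).le_succ)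
    -- Writing a_u, a_w for the weights, the derivative is (Q_w - Q_u)((a_u φ)') + Q_w(((a_w -
    -- a_u)φ)'). The first term falls under the induction hypothesis, and the second is small
    -- because a_w - a_u is.
    have hd : deriv (fun x => perturbTransfer w φ x - perturbTransfer u φ x) = fun x =>
        (perturbTransfer w (deriv fun y => perturbWeight u y * φ y) x -
          perturbTransfer u (deriv fun y => perturbWeight u y * φ y) x) +
        perturbTransfer w (deriv fun y => (perturbWeight w y - perturbWeight u y) * φ y) x := by
      funext x
      refine HasDerivAt.deriv (((h.right.isTransfer.hasDerivAt φ hφ1 x).sub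
        (h.left.isTransfer.hasDerivAt φ hφ1 x)).congr_deriv ?_)
      have e : (deriv fun y => perturbWeight w y * φ y) = fun x =>
          deriv (fun y => perturbWeight u y * φ y) x +
          deriv (fun y => (perturbWeight w y - perturbWeight u y) * φ y) x := by
        funext x
        rw [← deriv_fun_add (hmφ.differentiable x) (hdφ.differentiable x)]
        congr 1
        funext y
        ring
      rw [e, h.right.isTransfer.add]
      ring
    have hu2 : (1 - η)⁻¹ ≤ 2 := h.left.inv_one_sub_le
    have hb1 := hk' η ζ u w v h _ _ hmφ.deriv
    have hb2 := hT _ _ _ h.right.isTransfer hu2 ((hw η w h.right).of_le (by omega)) _ _ hdφ.deriv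
    refine CkBound.succ_iff.2 ⟨(h.right.isTransfer.differentiable hφ1).sub
      (h.left.isTransfer.differentiable hφ1), (h.right.isTransfer.periodic φ hφ.periodic).sub
        (h.left.isTransfer.periodic φ hφ.periodic), fun x => ?_, ?_⟩
    · refine ((hk' η ζ u w v h φ M (hφ.of_le (k + 1).le_succ)).abs_le x).trans ?_
      refine mul_le_mul_of_nonneg_right ?_ (mul_nonneg hζ hM)
      have : 0 ≤ C * (2 ^ (k + 2) * A) + B * (2 ^ (k + 1) * D) := by positivity
      linarith
    · rw [hd]
      refine (hb1.add hb2).mono ?_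
      have : 0 ≤ C * (ζ * M) := by positivity
      linarith

/-- The mean value inequality for s ↦ φ(s) - φ'(y)s on the segment from y to z; the sharper constant
M/2 is not needed. -/
theorem abs_taylor_le {φ : ℝ → ℝ} {M : ℝ} (h : CkBound 2 φ M) (y z : ℝ) :
    |φ z - φ y - deriv φ y * (z - y)| ≤ M * (z - y) ^ 2 := by
  have h1 := Convex.norm_image_sub_le_of_norm_hasDerivWithin_le
    (f := fun s => φ s - deriv φ y * s) (f' := fun s => deriv φ s - deriv φ y)
    (s := uIcc y z) (C := M * |z - y|) (x := y) (y := z)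
    (fun s _ => ((h.differentiable s).hasDerivAt.sub
      (((hasDerivAt_id s).const_mul (deriv φ y)).congr_deriv (mul_one _))).hasDerivWithinAt)
    (fun s hs => (abs_sub_le_of_abs_deriv_le h.deriv.differentiable h.deriv.abs_deriv_le s y).trans
      (mul_le_mul_of_nonneg_left (abs_sub_left_of_mem_uIcc hs) h.nonneg))
    (convex_uIcc y z) left_mem_uIcc right_mem_uIcc
  rw [Real.norm_eq_abs, Real.norm_eq_abs, mul_assoc, abs_mul_abs_self, ← sq] at h1
  refine le_trans (le_of_eq ?_) h1
  congr 1
  ring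

/-- The second order remainder of the transfer operator of `x ↦ x + u x` under the change of `u`
to `w = u + v`. -/
noncomputable def perturbRemainder (u w v φ : ℝ → ℝ) (x : ℝ) : ℝ :=
  perturbTransfer w φ x - perturbTransfer u φ x +
    perturbTransfer u (deriv fun y => perturbWeight u y * (v y * φ y)) x

namespace IsSmallPair

variable {η ζ : ℝ} {u w v : ℝ → ℝ}

/-- To first order the preimage moves by -a_u v. Expanding u at y in z - y = -v(z) - (u(z) - u(y))
leaves only v(y) - v(z) and a Taylor remainder of u, both of size ζ². -/
theorem abs_inv_sub_add_le (h : IsSmallPair η ζ u w v) (x : ℝ) :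
    |perturbInv w x - perturbInv u x + perturbWeight u (perturbInv u x) * v (perturbInv u x)| ≤
      8 * ζ ^ 2 := by
  set y := perturbInv u x with hy
  set z := perturbInv w x with hz
  have h1 := abs_taylor_le (h.left.ckBound.of_le (j := 2) (by norm_num)) y z
  have h2 := abs_sub_le_of_abs_deriv_le h.diff.differentiable h.diff.abs_deriv_le y z
  have h3 : |z - y| ≤ 2 * ζ := h.abs_inv_sub_le x
  have hζ := h.diff.nonneg
  have h4 : (z - y) ^ 2 ≤ (2 * ζ) ^ 2 := sq_le_sq' (abs_le.1 h3).1 (abs_le.1 h3).2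
  have h5 : z - y = -v z - (u z - u y) := h.inv_sub_eq x
  have hw : perturbWeight u y * (1 + deriv u y) = 1 := by
    rw [perturbWeight, one_div, inv_mul_cancel₀ (h.left.pos y).ne']
  have e : z - y + perturbWeight u y * v y =
      perturbWeight u y * ((v y - v z) - (u z - u y - deriv u y * (z - y))) := by
    linear_combination (-(z - y)) * hw + (perturbWeight u y) * h5
  rw [e, abs_mul]
  have h6 : |(v y - v z) - (u z - u y - deriv u y * (z - y))| ≤ ζ * (2 * ζ) +
      1 / 2 * (2 * ζ) ^ 2 := by
    refine (abs_sub _ _).trans (add_le_add (h2.trans ?_) (h1.trans ?_))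
    · rw [abs_sub_comm]
      exact mul_le_mul_of_nonneg_left h3 hζ
    · exact mul_le_mul h.left.le_half h4 (sq_nonneg _) (by norm_num)
  have h7 := (h.left.abs_weight_le y).trans h.left.inv_one_sub_le
  have h8 := mul_le_mul h7 h6 (abs_nonneg _) (by norm_num)
  nlinarith

end IsSmallPair

theorem exists_perturbRemainder_ckBound_zero : ∃ C, 0 ≤ C ∧
    ∀ (η ζ : ℝ) (u w v : ℝ → ℝ), IsSmallPair η ζ u w v →
    ∀ (φ : ℝ → ℝ) (M : ℝ), CkBound 2 φ M →
      CkBound 0 (perturbRemainder u w v φ) (C * (ζ ^ 2 * M)) := by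
  obtain ⟨A, hA, hw⟩ := exists_weight_ckBound
  obtain ⟨D, hD, hws⟩ := exists_weight_sub_ckBound
  refine ⟨(2 ^ 2 * A) * (4 + 8 + 8 * A + D), by positivity, fun η ζ u w v h φ M hφ => ?_⟩
  have hm := hw η u h.left
  have hζ := h.diff.nonneg
  have hM := hφ.nonneg
  have hdeg := (hm.of_le (j := 2) (by norm_num)).mul ((h.diff.of_le (j := 2) (by norm_num)).mul hφ)
  refine CkBound.zero_iff.2 ⟨((h.right.isTransfer.continuous φ hφ.continuous).sub
      (h.left.isTransfer.continuous φ hφ.continuous)).add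
      (h.left.isTransfer.continuous _ hdeg.deriv.continuous),
    ((h.right.isTransfer.periodic φ hφ.periodic).sub
      (h.left.isTransfer.periodic φ hφ.periodic)).add
      (h.left.isTransfer.periodic _ hdeg.deriv.periodic), fun x => ?_⟩
  have hE := h.abs_inv_sub_add_le x
  have hzy := h.abs_inv_sub_le x
  set y := perturbInv u x with hy
  set z := perturbInv w x with hz
  have ha := (hm.of_le (j := 2) (by norm_num)).mul hφ
  set a : ℝ → ℝ := fun s => perturbWeight u s * φ s with ha'
  set K : ℝ := 2 ^ 2 * (A * M) with hK
  have hK0 : 0 ≤ K := by positivity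
  have hb := (hm.of_le (j := 1) (by norm_num)).mul
    ((h.diff.deriv.of_le (j := 1) (by norm_num)).mul (ha.of_le (j := 1) (by norm_num)))
  have h1 := abs_taylor_le ha y z
  have h2 := abs_sub_le_of_abs_deriv_le hb.differentiable hb.abs_deriv_le y z
  have h3 : (z - y) ^ 2 ≤ (2 * ζ) ^ 2 := sq_le_sq' (abs_le.1 hzy).1 (abs_le.1 hzy).2
  have hder : deriv (fun s => perturbWeight u s * (v s * φ s)) y =
      deriv v y * a y + v y * deriv a y := by
    rw [← deriv_fun_mul (h.diff.differentiable y) (ha.differentiable y)]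
    congr 1
    funext s
    simp only [ha']
    ring
  -- Four sources of error, each quadratic in ζ: the Taylor remainder of a = a_u φ, the second-order
  -- part of the displacement z - y, the evaluation of the v' term at z instead of y, and the
  -- product of a_w - a_u with v'.
  have e : perturbRemainder u w v φ x = (a z - a y - deriv a y * (z - y)) +
      deriv a y * (z - y + perturbWeight u y * v y) +
      (perturbWeight u y * (deriv v y * a y) - perturbWeight u z * (deriv v z * a z)) -
      (perturbWeight w z - perturbWeight u z) * (deriv v z * a z) := by
    have e1 := h.weight_sub z
    have e2 : perturbWeight w z * φ z = a z - deriv v z * perturbWeight w z * a z := by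
      simp only [ha']
      linear_combination φ z * e1
    simp only [perturbRemainder, perturbTransfer_apply, ← hy, ← hz, hder, e2]
    simp only [ha']
    ring
  have b1 : |a z - a y - deriv a y * (z - y)| ≤ K * (2 * ζ) ^ 2 :=
    h1.trans (mul_le_mul_of_nonneg_left h3 hK0)
  have b2 : |deriv a y * (z - y + perturbWeight u y * v y)| ≤ K * (8 * ζ ^ 2) := by
    rw [abs_mul]
    exact mul_le_mul (ha.abs_deriv_le y) hE (abs_nonneg _) hK0
  have b3 : |perturbWeight u y * (deriv v y * a y) - perturbWeight u z * (deriv v z * a z)| ≤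
      2 ^ 1 * (A * (2 ^ 1 * (ζ * K))) * (2 * ζ) := by
    refine h2.trans (mul_le_mul_of_nonneg_left ?_ (by positivity))
    rwa [abs_sub_comm]
  have b4 : |(perturbWeight w z - perturbWeight u z) * (deriv v z * a z)| ≤
      D * ζ * (ζ * K) := by
    rw [abs_mul, abs_mul]
    have := (hws η ζ u w v h).abs_le z
    have := h.diff.abs_deriv_le z
    have := ha.abs_le z
    gcongr
  rw [e]
  refine (abs_sub _ _).trans ((add_le_add ((abs_add_le _ _).trans
    (add_le_add ((abs_add_le _ _).trans (add_le_add b1 b2)) b3)) b4).trans (le_of_eq ?_))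
  rw [hK]
  ring

/-- Let R be the remainder operator and g = (a_u φ)'. Then (Rφ)' = Rg - (Q_w - Q_u)p' - Q_u q' with
p = a_u a_w v'φ and q = a_u(a_w - a_u)v'φ. The first term is controlled by the C^0 estimate, the
second is a small operator on a small function, and in the third q is a product of two small
factors. -/
theorem exists_perturbRemainder_ckBound_one : ∃ C, 0 ≤ C ∧
    ∀ (η ζ : ℝ) (u w v : ℝ → ℝ), IsSmallPair η ζ u w v →
    ∀ (φ : ℝ → ℝ) (M : ℝ), CkBound 3 φ M →
      CkBound 1 (perturbRemainder u w v φ) (C * (ζ ^ 2 * M)) := by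
  obtain ⟨A, hA, hw⟩ := exists_weight_ckBound
  obtain ⟨D, hD, hws⟩ := exists_weight_sub_ckBound
  obtain ⟨C₀, hC₀, hzero⟩ := exists_perturbRemainder_ckBound_zero
  obtain ⟨C₁, hC₁, hsub⟩ := exists_perturbTransfer_sub_ckBound 0 (by norm_num)
  obtain ⟨B, hB, hT⟩ := exists_transfer_ckBound 0 A 2
  refine ⟨C₀ + (C₀ * (2 ^ 3 * A) + C₁ * (2 ^ 2 * (2 ^ 3 * (A * A) * 2 ^ 2)) +
    B * (2 ^ 1 * (2 ^ 3 * (A * D) * 2 ^ 1))), by positivity, fun η ζ u w v h φ M hφ => ?_⟩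
  have hm := hw η u h.left
  have hm' := hw η w h.right
  have hζ := h.diff.nonneg
  have hM := hφ.nonneg
  have h0 := hzero η ζ u w v h φ M (hφ.of_le (by norm_num))
  have hφ1 := hφ.contDiff_one
  have hmφ := hm.mul hφ
  have hp := ((hm.mul hm').of_le (j := 2) (by norm_num)).mul
    ((h.diff.deriv.of_le (j := 2) (by norm_num)).mul (hφ.of_le (j := 2) (by norm_num)))
  have hq := ((hm.mul (hws η ζ u w v h)).of_le (j := 1) (by norm_num)).mul
    ((h.diff.deriv.of_le (j := 1) (by norm_num)).mul (hφ.of_le (j := 1) (by norm_num)))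
  have hvφ := hm.mul ((h.diff.of_le (j := 3) (by norm_num)).mul hφ)
  have hmvg := (hm.of_le (j := 2) (by norm_num)).mul
    ((h.diff.of_le (j := 2) (by norm_num)).mul hmφ.deriv)
  have hr := ((hm.mul hm).of_le (j := 2) (by norm_num)).mul
    ((h.diff.deriv.of_le (j := 2) (by norm_num)).mul (hφ.of_le (j := 2) (by norm_num)))
  set g := deriv fun s => perturbWeight u s * φ s with hg
  set p := fun s => perturbWeight u s * perturbWeight w s * (deriv v s * φ s) with hpdef
  set q := fun s => perturbWeight u s * (perturbWeight w s - perturbWeight u s) *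
    (deriv v s * φ s) with hqdef
  set r := fun s => perturbWeight u s * perturbWeight u s * (deriv v s * φ s) with hrdef
  have e1 : (deriv fun s => perturbWeight w s * φ s) = fun s => g s - deriv p s := by
    funext s
    rw [hg, ← deriv_fun_sub (hmφ.differentiable s) (hp.differentiable s)]
    congr 1
    funext s
    simp only [hpdef]
    linear_combination φ s * h.weight_sub s
  have e2 : (deriv fun s => perturbWeight u s *
      deriv (fun y => perturbWeight u y * (v y * φ y)) s) =
      fun s => deriv (fun y => perturbWeight u y * (v y * g y)) s + deriv r s := by
    funext s
    rw [← deriv_fun_add (hmvg.differentiable s) (hr.differentiable s)]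
    congr 1
    funext s
    have : deriv (fun y => perturbWeight u y * (v y * φ y)) s =
        deriv v s * (perturbWeight u s * φ s) + v s * g s := by
      rw [hg, ← deriv_fun_mul (h.diff.differentiable s) (hmφ.differentiable s)]
      congr 1
      funext s
      ring
    rw [this]
    simp only [hrdef]
    ring
  have e3 : deriv p = fun s => deriv q s + deriv r s := by
    funext s
    rw [← deriv_fun_add (hq.differentiable s) (hr.differentiable s)]
    congr 1
    funext s
    simp only [hpdef, hqdef, hrdef]
    ring
  have hd : ∀ x, HasDerivAt (perturbRemainder u w v φ) (perturbRemainder u w v g x -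
      (perturbTransfer w (deriv p) x - perturbTransfer u (deriv p) x) -
      perturbTransfer u (deriv q) x) x := by
    intro x
    refine (((h.right.isTransfer.hasDerivAt φ hφ1 x).sub
      (h.left.isTransfer.hasDerivAt φ hφ1 x)).add
      (h.left.isTransfer.hasDerivAt _ hvφ.deriv.contDiff_one x)).congr_deriv ?_
    rw [e1, e2, ← hg, h.right.isTransfer.sub, h.left.isTransfer.add]
    have e4 := congrFun (h.left.isTransfer.add (deriv q) (deriv r)) x
    rw [← e3] at e4
    simp only [perturbRemainder]
    rw [e4]
    ring
  refine CkBound.succ_iff.2 ⟨fun x => (hd x).differentiableAt, h0.periodic, fun x =>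
    (h0.abs_le x).trans ?_, ?_⟩
  · refine mul_le_mul_of_nonneg_right ?_ (by positivity)
    have : 0 ≤ C₀ * (2 ^ 3 * A) + C₁ * (2 ^ 2 * (2 ^ 3 * (A * A) * 2 ^ 2)) +
      B * (2 ^ 1 * (2 ^ 3 * (A * D) * 2 ^ 1)) := by positivity
    linarith
  · rw [funext fun x => (hd x).deriv]
    have b1 := hzero η ζ u w v h g _ hmφ.deriv
    have b2 := hsub η ζ u w v h _ _ hp.deriv
    have b3 := hT _ _ _ h.left.isTransfer h.left.inv_one_sub_le (hm.of_le (by norm_num)) _ _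
      hq.deriv
    refine ((b1.sub b2).sub b3).mono ?_
    have : 0 ≤ C₀ * (ζ ^ 2 * M) := by positivity
    linarith

end SelfConsistent

namespace SelfConsistent

/-! ### The transfer operator of an expanding map followed by a perturbation of the identity -/

/-- A transfer operator that contracts the `C^1` functions of zero mean. -/
structure ExpandingTransfer where
  /-- the operator -/
  P : (ℝ → ℝ) → ℝ → ℝ
  /-- the reciprocal of the derivative of the map -/
  a : ℝ → ℝ
  /-- the operator norm of `P` on bounded functions -/
  c : ℝ
  /-- a bound for `a` -/
  α : ℝ
  /-- a bound for the derivative of `a` -/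
  β : ℝ
  isTransfer : IsTransfer P a c
  contDiff_a : ContDiff ℝ 3 a
  periodic_a : Function.Periodic a 1
  abs_a_le : ∀ x, |a x| ≤ α
  abs_deriv_a_le : ∀ x, |deriv a x| ≤ β
  α_le_one : α ≤ 1
  contracting : c * (α + β) < 1

namespace ExpandingTransfer

variable (S : ExpandingTransfer)

theorem exists_ckBound_a : ∃ A, 0 ≤ A ∧ CkBound 3 S.a A := by
  obtain ⟨A, hA⟩ := exists_ckBound (k := 3) (by exact_mod_cast S.contDiff_a) S.periodic_a
  exact ⟨A, hA.nonneg, hA⟩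

theorem α_nonneg : 0 ≤ S.α := (abs_nonneg _).trans (S.abs_a_le 0)

theorem β_nonneg : 0 ≤ S.β := (abs_nonneg _).trans (S.abs_deriv_a_le 0)

theorem c_nonneg : 0 ≤ S.c := S.isTransfer.coeff_nonneg

/-- The contraction rate of `P`. -/
def κ : ℝ := S.c * (S.α + S.β)

theorem κ_nonneg : 0 ≤ S.κ := mul_nonneg S.c_nonneg (add_nonneg S.α_nonneg S.β_nonneg)

/-- The transfer operator of `x ↦ x + u x`, followed by `P`. -/
noncomputable def L (u φ : ℝ → ℝ) : ℝ → ℝ := S.P (perturbTransfer u φ)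

/-- The perturbations of size `η` preserve a contraction rate `θ`. -/
structure IsAdmissible (η θ : ℝ) : Prop where
  pos : 0 < η
  le_half : η ≤ 1 / 2
  lt_one : θ < 1
  -- Controls the leading coefficient for derivatives of order up to 3: one factor (1 - η)⁻¹ from
  -- the norm of the perturbed transfer operator and at most three from its weight.
  rate : S.κ * (1 - η)⁻¹ ^ 4 ≤ θ
  -- The analogue for Q_u of c(α + β): its norm times the bounds for its weight and for the
  -- derivative of the weight.
  rate_one : S.κ * ((1 - η)⁻¹ * ((1 - η)⁻¹ + η * ((1 - η)⁻¹ * (1 - η)⁻¹))) ≤ θ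

/-- Both rates are continuous in η and equal κ < 1 at η = 0, so the midpoint θ of κ and 1 works for
small η. The last clause keeps the perturbed map expanding, as needed for positivity of densities.
-/
theorem exists_isAdmissible {ω : ℝ} (hω : 1 < ω) : ∃ η θ, S.IsAdmissible η θ ∧
    1 < ω * (1 - η) := by
  have hκ : S.κ < 1 := S.contracting
  have hi : ContinuousAt (fun η : ℝ => (1 - η)⁻¹) 0 :=
    (continuousAt_const.sub continuousAt_id).inv₀ (by simp)
  have h1 : ContinuousAt (fun η : ℝ => S.κ * (1 - η)⁻¹ ^ 4) 0 := continuousAt_const.mul (hi.pow 4)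
  have h2 : ContinuousAt (fun η : ℝ =>
      S.κ * ((1 - η)⁻¹ * ((1 - η)⁻¹ + η * ((1 - η)⁻¹ * (1 - η)⁻¹)))) 0 :=
    continuousAt_const.mul (hi.mul (hi.add (continuousAt_id.mul (hi.mul hi))))
  have h3 : ContinuousAt (fun η : ℝ => ω * (1 - η)) 0 := by fun_prop
  have e1 := h1.eventually_lt_const (u := (1 + S.κ) / 2) (by simp; linarith)
  have e2 := h2.eventually_lt_const (u := (1 + S.κ) / 2) (by simp; linarith)
  have e3 := h3.eventually_const_lt (u := (1 : ℝ)) (by simpa using hω)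
  have e4 : ∀ᶠ η : ℝ in nhds 0, η < 1 / 2 := eventually_lt_nhds (by norm_num)
  obtain ⟨ε, hε, h⟩ := Metric.eventually_nhds_iff.1 (e1.and (e2.and (e3.and e4)))
  have hd : dist (ε / 2) 0 < ε := by
    rw [Real.dist_eq, sub_zero, abs_of_pos (by linarith)]; linarith
  obtain ⟨a1, a2, a3, a4⟩ := h hd
  exact ⟨ε / 2, (1 + S.κ) / 2, ⟨by linarith, a4.le, by linarith, a1.le, a2.le⟩, a3⟩

theorem IsAdmissible.nonneg {S : ExpandingTransfer} {η θ : ℝ} (h : S.IsAdmissible η θ) :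
    0 ≤ θ := by
  have := S.κ_nonneg
  exact le_trans (mul_nonneg this (by positivity)) h.rate

variable {S} {η θ : ℝ} {u : ℝ → ℝ}

theorem L_add (hu : IsSmall η u) (φ ψ : ℝ → ℝ) :
    S.L u (fun x => φ x + ψ x) = fun x => S.L u φ x + S.L u ψ x := by
  unfold L
  rw [hu.isTransfer.add, S.isTransfer.add]

theorem L_sub (hu : IsSmall η u) (φ ψ : ℝ → ℝ) :
    S.L u (fun x => φ x - ψ x) = fun x => S.L u φ x - S.L u ψ x := by
  unfold L
  rw [hu.isTransfer.sub, S.isTransfer.sub]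

theorem L_const_mul (hu : IsSmall η u) (r : ℝ) (φ : ℝ → ℝ) :
    S.L u (fun x => r * φ x) = fun x => r * S.L u φ x := by
  unfold L
  rw [hu.isTransfer.const_mul, S.isTransfer.const_mul]

theorem L_nonneg (hu : IsSmall η u) {φ : ℝ → ℝ} (hφ : ∀ x, 0 ≤ φ x) (x : ℝ) : 0 ≤ S.L u φ x :=
  S.isTransfer.map_nonneg _ (hu.isTransfer.map_nonneg _ hφ) x

theorem L_integral (hu : IsSmall η u) {φ : ℝ → ℝ} (hc : Continuous φ)
    (hp : Function.Periodic φ 1) :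
    ∫ x in (0 : ℝ)..1, S.L u φ x = ∫ x in (0 : ℝ)..1, φ x := by
  unfold L
  rw [S.isTransfer.integral _ (hu.isTransfer.continuous _ hc) (hu.isTransfer.periodic _ hp),
    hu.isTransfer.integral _ hc hp]

theorem L_bound (hu : IsSmall η u) {φ : ℝ → ℝ} {M : ℝ} (hφ : ∀ x, |φ x| ≤ M) (x : ℝ) :
    |S.L u φ x| ≤ S.c * (2 * M) := by
  refine S.isTransfer.bound _ _ (fun y => (hu.isTransfer.bound φ M hφ y).trans ?_) x
  exact mul_le_mul_of_nonneg_right hu.inv_one_sub_le ((abs_nonneg _).trans (hφ 0))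

variable (S) in
theorem exists_P_ckBound (k : ℕ) (hk : k ≤ 3) : ∃ C, 0 ≤ C ∧ ∀ (φ : ℝ → ℝ) (M : ℝ),
    CkBound k φ M → CkBound k (S.P φ) (C * M) := by
  obtain ⟨A, hA, ha⟩ := S.exists_ckBound_a
  obtain ⟨C, hC, h⟩ := exists_transfer_ckBound k A S.c
  exact ⟨C, hC, fun φ M hφ => h _ _ _ S.isTransfer le_rfl (ha.of_le hk) φ M hφ⟩

theorem exists_perturbTransfer_ckBound (k : ℕ) (hk : k ≤ 3) : ∃ C, 0 ≤ C ∧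
    ∀ (η : ℝ) (u : ℝ → ℝ), IsSmall η u → ∀ (φ : ℝ → ℝ) (M : ℝ), CkBound k φ M →
      CkBound k (perturbTransfer u φ) (C * M) := by
  obtain ⟨A, hA, hw⟩ := exists_weight_ckBound
  obtain ⟨C, hC, h⟩ := exists_transfer_ckBound k A 2
  exact ⟨C, hC, fun η u hu φ M hφ => h _ _ _ hu.isTransfer hu.inv_one_sub_le
    ((hw η u hu).of_le hk) φ M hφ⟩

variable (S) in
theorem exists_L_ckBound (k : ℕ) (hk : k ≤ 3) : ∃ C, 0 ≤ C ∧
    ∀ (η : ℝ) (u : ℝ → ℝ), IsSmall η u → ∀ (φ : ℝ → ℝ) (M : ℝ), CkBound k φ M →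
      CkBound k (S.L u φ) (C * M) := by
  obtain ⟨C, hC, h⟩ := S.exists_P_ckBound k hk
  obtain ⟨C', hC', h'⟩ := exists_perturbTransfer_ckBound k hk
  exact ⟨C * C', mul_nonneg hC hC', fun η u hu φ M hφ => by
    rw [mul_assoc]; exact h _ _ (h' η u hu φ M hφ)⟩

/-- The transfer operators contract the `C^1` functions of zero mean. -/
theorem L_contraction (hS : S.IsAdmissible η θ) (hu : IsSmall η u) {φ : ℝ → ℝ} {K : ℝ}
    (h0 : ∫ x in (0 : ℝ)..1, φ x = 0) (hφ : ContDiff ℝ 1 φ) (hp : Function.Periodic φ 1)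
    (hK : ∀ x, |deriv φ x| ≤ K) (x : ℝ) : |deriv (S.L u φ) x| ≤ θ * K := by
  -- The estimate for a single transfer operator, applied below to Q_u and then to P. Zero mean
  -- gives sup|φ| ≤ K, so |(aφ)'| ≤ (α + β)K; since Q_u preserves the mean, the two applications
  -- compose.
  have step : ∀ (T : (ℝ → ℝ) → ℝ → ℝ) (a : ℝ → ℝ) (c α β : ℝ), IsTransfer T a c →
      ContDiff ℝ 1 a → (∀ x, |a x| ≤ α) → (∀ x, |deriv a x| ≤ β) →
      ∀ (φ : ℝ → ℝ) (K : ℝ), ContDiff ℝ 1 φ → Function.Periodic φ 1 →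
      (∫ x in (0 : ℝ)..1, φ x = 0) → (∀ x, |deriv φ x| ≤ K) →
      ∀ x, |deriv (T φ) x| ≤ c * ((α + β) * K) := by
    intro T a c α β hT ha hα hβ φ K hφ hp h0 hK x
    have hd : Differentiable ℝ φ := hφ.differentiable one_ne_zero
    have hφK := abs_le_of_integral_eq_zero hφ.continuous hp
      (abs_sub_le_of_abs_deriv_le hd hK) h0
    rw [hT.deriv_eq hφ]
    refine hT.bound _ _ (fun y => ?_) x
    rw [deriv_fun_mul (ha.differentiable one_ne_zero y) (hd y)]
    refine (abs_add_le _ _).trans ?_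
    rw [abs_mul, abs_mul]
    have h1 := mul_le_mul (hβ y) (hφK y) (abs_nonneg _) ((abs_nonneg _).trans (hβ y))
    have h2 := mul_le_mul (hα y) (hK y) (abs_nonneg _) ((abs_nonneg _).trans (hα y))
    linarith
  obtain ⟨C, -, hQ⟩ := exists_perturbTransfer_ckBound 1 (by norm_num)
  obtain ⟨M, hM⟩ := exists_ckBound (k := 1) (by exact_mod_cast hφ) hp
  obtain ⟨A, -, hw⟩ := exists_weight_ckBound
  have hQφ := hQ η u hu φ M hM
  have h1 := step _ _ _ _ _ hu.isTransfer (hw η u hu).contDiff_one hu.abs_weight_le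
    hu.abs_deriv_weight_le φ K hφ hp h0 hK
  have h2 := step _ _ _ _ _ S.isTransfer (S.contDiff_a.of_le (by norm_num)) S.abs_a_le
    S.abs_deriv_a_le _ _ hQφ.contDiff_one hQφ.periodic
    (by rw [hu.isTransfer.integral _ hφ.continuous hp, h0]) h1 x
  refine h2.trans ?_
  have hK0 : 0 ≤ K := (abs_nonneg _).trans (hK 0)
  have := mul_le_mul_of_nonneg_right hS.rate_one hK0
  unfold κ at this
  linarith

/-- The leading term of the derivatives of `L φ`. -/
theorem exists_abs_iteratedDeriv_L_le (hS : S.IsAdmissible η θ) (k : ℕ) (hk : k + 1 ≤ 3) :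
    ∃ C, 0 ≤ C ∧ ∀ u : ℝ → ℝ, IsSmall η u → ∀ (φ : ℝ → ℝ) (M B : ℝ),
      ContDiff ℝ (k + 1 : ℕ) φ → CkBound k φ M → (∀ x, |iteratedDeriv (k + 1) φ x| ≤ B) →
      ∀ x, |iteratedDeriv (k + 1) (S.L u φ) x| ≤ θ * B + C * M := by
  obtain ⟨A, hA, ha⟩ := S.exists_ckBound_a
  obtain ⟨A', hA', hw⟩ := exists_weight_ckBound
  obtain ⟨C₁, hC₁, h₁⟩ := exists_abs_iteratedDeriv_transfer_le (k + 1) A S.c 1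
  obtain ⟨C₂, hC₂, h₂⟩ := exists_abs_iteratedDeriv_transfer_le (k + 1) A' 2 2
  obtain ⟨C₃, hC₃, h₃⟩ := exists_perturbTransfer_ckBound k (by omega)
  obtain ⟨C₄, hC₄, h₄⟩ := exists_perturbTransfer_ckBound (k + 1) hk
  refine ⟨S.c * S.α ^ (k + 1) * C₂ + C₁ * C₃,
    add_nonneg (mul_nonneg (mul_nonneg S.c_nonneg (pow_nonneg S.α_nonneg _)) hC₂)
      (mul_nonneg hC₁ hC₃), fun u hu φ M B hφ hφM hB x => ?_⟩
  obtain ⟨M', hM'⟩ := exists_ckBound hφ hφM.periodic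
  have hM := hφM.nonneg
  have hQφ := h₃ η u hu φ M hφM
  have hQφ' := h₄ η u hu φ M' hM'
  have b1 := h₂ _ _ _ _ hu.isTransfer hu.inv_one_sub_le ((hw η u hu).of_le hk) hu.abs_weight_le
    hu.inv_one_sub_le φ M B hφ hφM.periodic hM (fun i hi => hφM.bound i (by omega)) hB
  have b2 := h₁ _ _ _ _ S.isTransfer le_rfl (ha.of_le hk) S.abs_a_le S.α_le_one
    (perturbTransfer u φ) (C₃ * M) _ hQφ'.contDiff hQφ'.periodic (mul_nonneg hC₃ hM)
    (fun i hi => hQφ.bound i (by omega)) b1 x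
  refine b2.trans ?_
  have hB0 : 0 ≤ B := (abs_nonneg _).trans (hB 0)
  have hone : 1 ≤ (1 - η)⁻¹ := by
    rw [one_le_inv₀ (by linarith [hS.le_half])]; linarith [hS.pos]
  have hκ : S.c * S.α ^ (k + 1) ≤ S.κ := by
    refine mul_le_mul_of_nonneg_left ?_ S.c_nonneg
    have := pow_le_of_le_one S.α_nonneg S.α_le_one (Nat.add_one_ne_zero k)
    linarith [S.β_nonneg]
  -- Since k + 1 ≤ 3, at most four factors (1 - η)⁻¹ occur; this fixes the exponent in
  -- `IsAdmissible.rate`.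
  have h5 : S.c * S.α ^ (k + 1) * ((1 - η)⁻¹ * (1 - η)⁻¹ ^ (k + 1)) ≤ θ := by
    refine le_trans ?_ hS.rate
    refine mul_le_mul hκ ?_ (by positivity) S.κ_nonneg
    rw [← pow_succ']
    exact pow_le_pow_right₀ hone (by omega)
  have h6 := mul_le_mul_of_nonneg_right h5 hB0
  linarith

end ExpandingTransfer

end SelfConsistent

/-! ### Bounded inverse of 1 - L and decay of iterates on zero mean -/

namespace SelfConsistent

namespace ExpandingTransfer

variable {S : ExpandingTransfer} {η θ : ℝ}

theorem ckBound_of_iteratedDeriv {k : ℕ} {φ : ℝ → ℝ} {M B : ℝ} (hφ : ContDiff ℝ (k + 1 : ℕ) φ)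
    (h : CkBound k φ M) (hB : ∀ x, |iteratedDeriv (k + 1) φ x| ≤ B) (hM : M ≤ B) :
    CkBound (k + 1) φ B :=
  ⟨hφ, h.periodic, fun i hi x => by
    rcases Nat.lt_or_ge i (k + 1) with h1 | h1
    · exact (h.bound i (by omega) x).trans hM
    · obtain rfl : i = k + 1 := by omega
      exact hB x⟩

/-- The inverse of `1 - L` on functions of zero mean is bounded in `C^k`. -/
theorem exists_ckBound_of_sub_L (hS : S.IsAdmissible η θ) (k : ℕ) (hk : k + 1 ≤ 3) :
    ∃ C, 0 ≤ C ∧ ∀ u : ℝ → ℝ, IsSmall η u → ∀ (φ : ℝ → ℝ) (M : ℝ),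
      ContDiff ℝ (k + 1 : ℕ) φ → Function.Periodic φ 1 → (∫ x in (0 : ℝ)..1, φ x = 0) →
      CkBound (k + 1) (fun x => φ x - S.L u φ x) M → CkBound (k + 1) φ (C * M) := by
  have hθ : 0 < 1 - θ := by linarith [hS.lt_one]
  induction k with
  | zero =>
    refine ⟨(1 - θ)⁻¹, by positivity, fun u hu φ M hφ hp h0 hM => ?_⟩
    have hφ1 : ContDiff ℝ 1 φ := by exact_mod_cast hφ
    -- At a maximum point of |φ'|, contraction gives (1 - θ)|φ'(x₀)| ≤ |(φ - Lφ)'(x₀)|. No Neumann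
    -- series is needed for the a priori bound.
    obtain ⟨x₀, hx₀⟩ := exists_forall_abs_le (hφ1.continuous_deriv le_rfl) (periodic_deriv hp)
    obtain ⟨C, -, hL⟩ := S.exists_L_ckBound 1 (by norm_num)
    obtain ⟨M', hM'⟩ := exists_ckBound hφ hp
    have h1 := L_contraction hS hu h0 hφ1 hp hx₀ x₀
    have h2 := hM.abs_deriv_le x₀
    rw [deriv_fun_sub (hφ1.differentiable one_ne_zero x₀) ((hL η u hu φ M' hM').differentiable x₀)]
      at h2
    have h3 : |deriv φ x₀| ≤ (1 - θ)⁻¹ * M := by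
      rw [le_inv_mul_iff₀ hθ]
      have := abs_sub_abs_le_abs_sub (deriv φ x₀) (deriv (S.L u φ) x₀)
      linarith
    have h4 : ∀ x, |deriv φ x| ≤ (1 - θ)⁻¹ * M := fun x => (hx₀ x).trans h3
    refine CkBound.succ_iff.2 ⟨hφ1.differentiable one_ne_zero, hp, ?_, CkBound.zero_iff.2
      ⟨hφ1.continuous_deriv le_rfl, periodic_deriv hp, h4⟩⟩
    exact abs_le_of_integral_eq_zero hφ1.continuous hp
      (abs_sub_le_of_abs_deriv_le (hφ1.differentiable one_ne_zero) h4) h0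
  | succ k ih =>
    obtain ⟨C, hC, h⟩ := ih (by omega)
    obtain ⟨D, hD, hL⟩ := exists_abs_iteratedDeriv_L_le hS (k + 1) hk
    obtain ⟨E, -, hLb⟩ := S.exists_L_ckBound (k + 2) hk
    refine ⟨(1 - θ)⁻¹ * (1 + D * C) + C, by positivity, fun u hu φ M hφ hp h0 hM => ?_⟩
    have h1 := h u hu φ M (hφ.of_le (by exact_mod_cast (k + 1).le_succ)) hp h0
      (hM.of_le (k + 1).le_succ)
    obtain ⟨M', hM'⟩ := exists_ckBound hφ hp
    have hM0 := hM.nonneg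
    -- The same maximum-point argument for the top derivative; the lower order term of the
    -- Lasota–Yorke inequality is bounded by the induction hypothesis.
    obtain ⟨x₀, hx₀⟩ := exists_forall_abs_le (hφ.continuous_iteratedDeriv' (k + 2))
      (periodic_iteratedDeriv hp (k + 2))
    have h2 := hL u hu φ (C * M) _ hφ h1 hx₀ x₀
    have h3 := hM.bound (k + 2) le_rfl x₀
    have e : (fun x => φ x - S.L u φ x) = φ - S.L u φ := rfl
    rw [e, iteratedDeriv_sub hφ.contDiffAt (hLb η u hu φ M' hM').contDiff.contDiffAt] at h3
    have h4 : |iteratedDeriv (k + 2) φ x₀| ≤ (1 - θ)⁻¹ * (1 + D * C) * M := by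
      rw [mul_assoc, le_inv_mul_iff₀ hθ]
      have := abs_sub_abs_le_abs_sub (iteratedDeriv (k + 2) φ x₀)
        (iteratedDeriv (k + 2) (S.L u φ) x₀)
      linarith
    have h5 : 0 ≤ (1 - θ)⁻¹ * (1 + D * C) * M := by positivity
    have h6 : 0 ≤ C * M := by positivity
    refine ckBound_of_iteratedDeriv hφ h1 (fun x => ((hx₀ x).trans h4).trans ?_) ?_ <;> linarith

/-- The iterates of the transfer operator on a `C^3` function of zero mean decay. -/
theorem exists_iterate_L_ckBound (hS : S.IsAdmissible η θ) {u : ℝ → ℝ} (hu : IsSmall η u)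
    {g : ℝ → ℝ} (hg : ContDiff ℝ 3 g) (hp : Function.Periodic g 1)
    (h0 : ∫ x in (0 : ℝ)..1, g x = 0) : ∃ C r : ℝ, 0 ≤ r ∧ r < 1 ∧
      ∀ n, CkBound 3 ((S.L u)^[n] g) (C * r ^ n) := by
  obtain ⟨M, hM⟩ := exists_ckBound (k := 3) (by exact_mod_cast hg) hp
  obtain ⟨D, -, hL⟩ := S.exists_L_ckBound 3 le_rfl
  have hall : ∀ n, (∃ M', CkBound 3 ((S.L u)^[n] g) M') ∧
      ∫ x in (0 : ℝ)..1, (S.L u)^[n] g x = 0 := by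
    intro n
    induction n with
    | zero => exact ⟨⟨M, hM⟩, h0⟩
    | succ n ih =>
      obtain ⟨⟨M', hM'⟩, h⟩ := ih
      rw [Function.iterate_succ_apply']
      exact ⟨⟨_, hL η u hu _ _ hM'⟩, by rw [L_integral hu hM'.continuous hM'.periodic, h]⟩
  have key : ∀ k : ℕ, k + 1 ≤ 3 → ∃ C r : ℝ, 0 ≤ C ∧ 0 ≤ r ∧ r < 1 ∧
      ∀ n, CkBound (k + 1) ((S.L u)^[n] g) (C * r ^ n) := by
    intro k
    induction k with
    | zero =>
      refine fun _ => ⟨M, θ, hM.nonneg, hS.nonneg, hS.lt_one, fun n => ?_⟩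
      obtain ⟨⟨M', hM'⟩, hn⟩ := hall n
      have hd : ∀ x, |deriv ((S.L u)^[n] g) x| ≤ M * θ ^ n := by
        clear hn hM' M'
        induction n with
        | zero => simpa using hM.abs_deriv_le
        | succ n ih =>
          obtain ⟨⟨M', hM'⟩, hn⟩ := hall n
          intro x
          rw [Function.iterate_succ_apply']
          refine (L_contraction hS hu hn hM'.contDiff_one hM'.periodic ih x).trans (le_of_eq ?_)
          rw [pow_succ]; ring
      exact CkBound.succ_iff.2 ⟨hM'.differentiable, hM'.periodic,
        abs_le_of_integral_eq_zero hM'.continuous hM'.periodic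
          (abs_sub_le_of_abs_deriv_le hM'.differentiable hd) hn,
        CkBound.zero_iff.2 ⟨hM'.deriv.continuous, hM'.deriv.periodic, hd⟩⟩
    | succ k ih =>
      intro hk
      obtain ⟨C, r, hC, hr, hr1, h⟩ := ih (by omega)
      obtain ⟨E, hE, hLE⟩ := exists_abs_iteratedDeriv_L_le hS (k + 1) hk
      -- The top derivatives satisfy b_{n+1} ≤ θ b_n + E C r^n. Any rate s strictly above θ, with r
      -- ≤ s, absorbs the source term once the constant is at least EC/(s - θ); the midpoint also
      -- keeps s < 1.
      set s := (1 + max r θ) / 2 with hs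
      have hm1 : max r θ < 1 := max_lt hr1 hS.lt_one
      have hm0 : 0 ≤ max r θ := hr.trans (le_max_left _ _)
      have hrs : r ≤ s := (le_max_left r θ).trans (by linarith)
      have hsθ : 0 < s - θ := by linarith [le_max_right r θ]
      have hs0 : 0 ≤ s := by linarith
      set C' := C + M + E * C / (s - θ) with hC'
      have hEC : 0 ≤ E * C / (s - θ) := by positivity
      have hC'0 : 0 ≤ C' := by linarith [hM.nonneg]
      refine ⟨C', s, hC'0, hs0, by linarith, fun n => ?_⟩
      have hCC : ∀ n, C * r ^ n ≤ C' * s ^ n := fun n =>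
        mul_le_mul (by linarith [hM.nonneg]) (pow_le_pow_left₀ hr hrs n) (by positivity) hC'0
      have hd : ∀ n x, |iteratedDeriv (k + 2) ((S.L u)^[n] g) x| ≤ C' * s ^ n := by
        intro n
        induction n with
        | zero =>
          intro x
          refine (hM.bound (k + 2) hk x).trans ?_
          simp only [pow_zero, mul_one]
          linarith
        | succ n ih =>
          obtain ⟨⟨M', hM'⟩, hn⟩ := hall n
          intro x
          rw [Function.iterate_succ_apply']
          refine (hLE u hu _ _ _ (hM'.of_le hk).contDiff (h n) ih x).trans ?_
          have h1 : E * C ≤ C' * (s - θ) := by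
            rw [← div_le_iff₀ hsθ]; linarith [hM.nonneg]
          have h2 : E * C * r ^ n ≤ C' * (s - θ) * s ^ n :=
            mul_le_mul h1 (pow_le_pow_left₀ hr hrs n) (by positivity)
              (mul_nonneg hC'0 hsθ.le)
          rw [pow_succ]
          linarith
      obtain ⟨⟨M', hM'⟩, -⟩ := hall n
      exact ckBound_of_iteratedDeriv (hM'.of_le hk).contDiff (h n) (hd n) (hCC n)
  obtain ⟨C, r, -, h⟩ := key 2 le_rfl
  exact ⟨C, r, h⟩

end ExpandingTransfer

end SelfConsistent

/-! ### Invariant densities: existence, positivity, uniqueness -/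

namespace SelfConsistent

/-- A nonnegative density whose positivity is propagated by an expanding map is positive. -/
theorem pos_of_expanding {F φ : ℝ → ℝ} {r : ℝ} (hr : 1 < r) (hF : Continuous F)
    (hexp : ∀ x y, r * |x - y| ≤ |F x - F y|) (hc : Continuous φ)
    (hp : Function.Periodic φ 1) (h0 : ∀ x, 0 ≤ φ x) (h1 : ∫ x in (0 : ℝ)..1, φ x = 1)
    (hpos : ∀ x, 0 < φ x → 0 < φ (F x)) (x : ℝ) : 0 < φ x := by
  obtain ⟨z, hz⟩ : ∃ z, 0 < φ z := by
    by_contra hcon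
    push Not at hcon
    have : φ = fun _ => 0 := funext fun y => le_antisymm (hcon y) (h0 y)
    rw [this] at h1
    simp at h1
  obtain ⟨δ, hδ, hball⟩ := Metric.eventually_nhds_iff.1 (hc.continuousAt.eventually_const_lt hz)
  -- An interval of positivity is mapped by F onto one at least r times as long. After finitely many
  -- steps its length exceeds 1, so it meets every class modulo 1.
  have key : ∀ n : ℕ, ∃ a b, r ^ n * (δ / 2) ≤ b - a ∧ ∀ y ∈ Icc a b, 0 < φ y := by
    intro n
    induction n with
    | zero =>
      refine ⟨z, z + δ / 2, by simp, fun y hy => hball ?_⟩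
      rw [Real.dist_eq, abs_of_nonneg (by linarith [hy.1])]
      linarith [hy.2]
    | succ n ih =>
      obtain ⟨a, b, hab, h⟩ := ih
      have hlen : 0 ≤ b - a := le_trans (by positivity) hab
      refine ⟨min (F a) (F b), max (F a) (F b), ?_, fun y hy => ?_⟩
      · rw [max_sub_min_eq_abs', abs_sub_comm]
        refine le_trans ?_ (hexp b a)
        rw [abs_of_nonneg hlen, pow_succ]
        nlinarith
      · obtain ⟨w, hw, rfl⟩ := intermediate_value_uIcc hF.continuousOn hy
        rw [uIcc_of_le (by linarith)] at hw
        exact hpos w (h w hw)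
  obtain ⟨n, hn⟩ := pow_unbounded_of_one_lt (1 / (δ / 2)) hr
  obtain ⟨a, b, hab, h⟩ := key n
  rw [div_lt_iff₀ (by positivity)] at hn
  obtain ⟨y, hy, hxy⟩ := hp.exists_mem_Ico one_pos x a
  rw [hxy]
  exact h y ⟨hy.1, by linarith [hy.2]⟩

/-- A Lipschitz periodic function is a uniform limit of `C^1` functions with the same Lipschitz
constant and the same mean. -/
theorem exists_contDiff_near {φ : ℝ → ℝ} {K : ℝ} (hp : Function.Periodic φ 1)
    (hK : ∀ x y, |φ x - φ y| ≤ K * |x - y|) (hc : Continuous φ)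
    (h0 : ∫ x in (0 : ℝ)..1, φ x = 0) {ε : ℝ} (hε : 0 < ε) :
    ∃ ψ : ℝ → ℝ, ContDiff ℝ 1 ψ ∧ Function.Periodic ψ 1 ∧ (∀ x, |deriv ψ x| ≤ K) ∧
      (∫ x in (0 : ℝ)..1, ψ x = 0) ∧ ∀ x, |φ x - ψ x| ≤ K * ε := by
  -- The approximant is the average of φ over [x, x + ε], written as a difference quotient of the
  -- primitive W. Zero mean of φ makes W periodic, which gives the approximant zero mean.
  set W : ℝ → ℝ := fun x => ∫ y in (0 : ℝ)..x, φ y with hW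
  have hWd : ∀ x, HasDerivAt W (φ x) x := fun x =>
    intervalIntegral.integral_hasDerivAt_right (hc.intervalIntegrable _ _)
      (hc.stronglyMeasurableAtFilter _ _) hc.continuousAt
  have hWp : Function.Periodic W 1 := by
    intro x
    have h1 := intervalIntegral.integral_add_adjacent_intervals (a := 0) (b := x) (c := x + 1)
      (hc.intervalIntegrable (μ := volume) _ _) (hc.intervalIntegrable _ _)
    rw [hp.intervalIntegral_add_eq x 0, zero_add, h0, add_zero] at h1
    exact h1.symm
  have hWc : Continuous W := continuous_iff_continuousAt.2 fun x => (hWd x).continuousAt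
  have hd : ∀ x, HasDerivAt (fun x => ε⁻¹ * (W (x + ε) - W x)) (ε⁻¹ * (φ (x + ε) - φ x)) x :=
    fun x => (((hWd (x + ε)).comp_add_const x ε).sub (hWd x)).const_mul _
  refine ⟨fun x => ε⁻¹ * (W (x + ε) - W x), ?_, fun x => ?_, fun x => ?_, ?_, fun x => ?_⟩
  · rw [contDiff_one_iff_deriv]
    refine ⟨fun x => (hd x).differentiableAt, ?_⟩
    rw [funext fun x => (hd x).deriv]
    fun_prop
  · simp only [add_right_comm x 1 ε, hWp _]
  · rw [(hd x).deriv, abs_mul, abs_of_pos (inv_pos.2 hε), inv_mul_le_iff₀ hε]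
    have := hK (x + ε) x
    rw [add_sub_cancel_left, abs_of_pos hε] at this
    linarith
  · have hWε : Continuous fun x => W (x + ε) := by fun_prop
    rw [intervalIntegral.integral_const_mul, intervalIntegral.integral_sub
      (hWε.intervalIntegrable _ _) (hWc.intervalIntegrable _ _)]
    rw [intervalIntegral.integral_comp_add_right, zero_add, add_comm 1 ε,
      hWp.intervalIntegral_add_eq ε 0, zero_add, sub_self, mul_zero]
  · have h1 : W (x + ε) - W x = ∫ y in x..x + ε, φ y :=
      intervalIntegral.integral_interval_sub_left (hc.intervalIntegrable _ _)
        (hc.intervalIntegrable _ _)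
    have h2 : ∫ y in x..x + ε, (φ x - φ y) = ε * φ x - (W (x + ε) - W x) := by
      rw [intervalIntegral.integral_sub (by simp) (hc.intervalIntegrable _ _), h1]
      simp
    have h3 := intervalIntegral.norm_integral_le_of_norm_le_const (a := x) (b := x + ε)
      (f := fun y => φ x - φ y) (C := K * ε) (fun y hy => by
        rw [uIoc_of_le (by linarith)] at hy
        have hK0 : 0 ≤ K := by simpa using (abs_nonneg _).trans (hK 1 0)
        refine (hK x y).trans (mul_le_mul_of_nonneg_left ?_ hK0)
        rw [abs_le]; constructor <;> linarith [hy.1, hy.2])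
    rw [h2, add_sub_cancel_left, Real.norm_eq_abs, abs_of_pos hε] at h3
    have e : φ x - ε⁻¹ * (W (x + ε) - W x) = ε⁻¹ * (ε * φ x - (W (x + ε) - W x)) := by
      field_simp
    rw [e, abs_mul, abs_of_pos (inv_pos.2 hε), inv_mul_le_iff₀ hε]
    linarith

namespace ExpandingTransfer

variable {S : ExpandingTransfer} {η θ : ℝ} {u : ℝ → ℝ}

/-- A Lipschitz function of zero mean that is fixed by the transfer operator vanishes. -/
theorem eq_zero_of_L_eq (hS : S.IsAdmissible η θ) (hu : IsSmall η u) {φ : ℝ → ℝ} {K : ℝ}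
    (hp : Function.Periodic φ 1) (hK : ∀ x y, |φ x - φ y| ≤ K * |x - y|) (hc : Continuous φ)
    (h0 : ∫ x in (0 : ℝ)..1, φ x = 0) (hL : S.L u φ = φ) (x : ℝ) : φ x = 0 := by
  -- The C¹ contraction passes to Lipschitz constants by approximation: φ = Lφ is uniformly close to
  -- Lψ, whose derivative is at most θK. Iterating makes the Lipschitz constant of φ, and with it φ,
  -- vanish.
  have step : ∀ K, (∀ x y, |φ x - φ y| ≤ K * |x - y|) →
      ∀ x y, |φ x - φ y| ≤ θ * K * |x - y| := by
    intro K hK x y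
    have hK0 : 0 ≤ K := by simpa using (abs_nonneg _).trans (hK 1 0)
    refine le_of_forall_pos_le_add fun ε hε => ?_
    have hD : 0 < 4 * S.c * K + 1 := by
      have := mul_nonneg S.c_nonneg hK0
      linarith
    -- The scale is chosen so that the errors at the two points x and y, each at most 2cK times the
    -- scale, together stay below ε.
    obtain ⟨ψ, h1, h2, h3, h4, h5⟩ := exists_contDiff_near hp hK hc h0
      (ε := ε / (4 * S.c * K + 1)) (by positivity)
    obtain ⟨C, -, hLb⟩ := S.exists_L_ckBound 1 (by norm_num)
    obtain ⟨M, hM⟩ := exists_ckBound (k := 1) (by exact_mod_cast h1) h2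
    have h6 := abs_sub_le_of_abs_deriv_le (hLb η u hu ψ M hM).differentiable
      (L_contraction hS hu h4 h1 h2 h3) x y
    have h7 := L_bound (S := S) hu h5
    rw [L_sub hu, hL] at h7
    have e : φ x - φ y = (S.L u ψ x - S.L u ψ y) + (φ x - S.L u ψ x) - (φ y - S.L u ψ y) := by
      ring
    have h8 : |φ x - φ y| ≤ |S.L u ψ x - S.L u ψ y| + |φ x - S.L u ψ x| +
        |φ y - S.L u ψ y| := by
      rw [e]
      exact (abs_sub _ _).trans (add_le_add_left (abs_add_le _ _) _)
    have h9 : 4 * S.c * K * (ε / (4 * S.c * K + 1)) ≤ ε := by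
      rw [mul_div_assoc', div_le_iff₀ hD]
      nlinarith
    have := h7 x
    have := h7 y
    linarith
  have hn : ∀ n : ℕ, ∀ x y, |φ x - φ y| ≤ θ ^ n * K * |x - y| := by
    intro n
    induction n with
    | zero => simpa using hK
    | succ n ih =>
      have := step _ ih
      rw [pow_succ', mul_assoc θ]
      exact this
  have hb : ∀ n : ℕ, |φ x| ≤ θ ^ n * K := fun n => abs_le_of_integral_eq_zero hc hp (hn n) h0 x
  have ht : Filter.Tendsto (fun n : ℕ => θ ^ n * K) Filter.atTop (nhds (0 * K)) :=
    (tendsto_pow_atTop_nhds_zero_of_lt_one hS.nonneg hS.lt_one).mul_const K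
  have := ge_of_tendsto' ht hb
  rw [zero_mul] at this
  exact abs_eq_zero.1 (le_antisymm this (abs_nonneg _))

/-- `1 - L` is onto on the `C^3` functions of zero mean. -/
theorem exists_sub_L_eq (hS : S.IsAdmissible η θ) (hu : IsSmall η u)
    {g : ℝ → ℝ} (hg : ContDiff ℝ 3 g) (hp : Function.Periodic g 1)
    (h0 : ∫ x in (0 : ℝ)..1, g x = 0) : ∃ φ : ℝ → ℝ, ContDiff ℝ 3 φ ∧
      Function.Periodic φ 1 ∧ (∫ x in (0 : ℝ)..1, φ x = 0) ∧ ∀ x, φ x - S.L u φ x = g x := by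
  obtain ⟨C, r, hr0, hr1, h⟩ := exists_iterate_L_ckBound hS hu hg hp h0
  -- The solution is the Neumann series of the iterates of g, which converges geometrically in C³.
  set G : ℕ → ℝ → ℝ := fun n => (S.L u)^[n] g with hG
  have hsum : Summable fun n => C * r ^ n := (summable_geometric_of_lt_one hr0 hr1).mul_left C
  have hGs : ∀ x, Summable fun n => G n x := fun x =>
    Summable.of_norm_bounded hsum fun n => (h n).abs_le x
  have hGi : ∀ n, ∫ x in (0 : ℝ)..1, G n x = 0 := by
    intro n
    induction n with
    | zero => exact h0
    | succ n ih =>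
      simp only [hG, Function.iterate_succ_apply']
      rw [L_integral hu (h n).continuous (h n).periodic]
      exact ih
  refine ⟨fun x => ∑' n, G n x, ?_, fun x => ?_, ?_, fun x => ?_⟩
  · have := contDiff_tsum (𝕜 := ℝ) (N := 3) (f := G) (v := fun _ n => C * r ^ n)
      (fun n => by exact_mod_cast (h n).contDiff) (fun _ _ => hsum) (fun k n x hk => by
        rw [norm_iteratedFDeriv_eq_norm_iteratedDeriv]
        exact (h n).bound k (by exact_mod_cast hk) x)
    exact_mod_cast this
  · simp only [(h _).periodic x, hG]
  · have hs := intervalIntegral.hasSum_integral_of_dominated_convergence (μ := volume)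
      (a := 0) (b := 1) (F := G) (f := fun x => ∑' n, G n x) (fun n _ => C * r ^ n)
      (fun n => (h n).continuous.aestronglyMeasurable)
      (fun n => Filter.Eventually.of_forall fun x _ => (h n).abs_le x)
      (Filter.Eventually.of_forall fun x _ => hsum) (by simp)
      (Filter.Eventually.of_forall fun x _ => (hGs x).hasSum)
    simp only [hGi] at hs
    exact hs.unique hasSum_zero
  · set φ : ℝ → ℝ := fun x => ∑' n, G n x with hφ
    have hpart : ∀ n x, S.L u (fun y => ∑ i ∈ Finset.range n, G i y) x =
        ∑ i ∈ Finset.range n, G (i + 1) x := by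
      intro n
      induction n with
      | zero =>
        intro x
        have := congrFun (L_const_mul (S := S) hu 0 g) x
        simpa using this
      | succ n ih =>
        intro x
        simp only [Finset.sum_range_succ]
        rw [L_add hu]
        simp only [ih]
        simp only [hG, Function.iterate_succ_apply']
    have htail : ∀ n x, |φ x - ∑ i ∈ Finset.range n, G i x| ≤ ∑' i, C * r ^ (i + n) := by
      intro n x
      have e : φ x - ∑ i ∈ Finset.range n, G i x = ∑' i, G (i + n) x := by
        simp only [hφ]
        rw [← (hGs x).sum_add_tsum_nat_add n]
        ring
      rw [e, ← Real.norm_eq_abs]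
      exact tsum_of_norm_bounded ((summable_nat_add_iff n).2 hsum).hasSum
        fun i => (h (i + n)).abs_le x
    -- L passes through the infinite sum because it is bounded in the sup norm and the tails of the
    -- series are uniformly small.
    have ht : Filter.Tendsto (fun n => S.c * (2 * ∑' i, C * r ^ (i + n))) Filter.atTop
        (nhds (S.c * (2 * 0))) :=
      ((tendsto_sum_nat_add fun n => C * r ^ n).const_mul 2).const_mul S.c
    have h1 : Filter.Tendsto (fun n => S.L u φ x - ∑ i ∈ Finset.range n, G (i + 1) x)
        Filter.atTop (nhds 0) := by
      refine squeeze_zero_norm (fun n => ?_) (by simpa using ht)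
      have := L_bound (S := S) hu (htail n) x
      rw [L_sub hu] at this
      simpa only [hpart, Real.norm_eq_abs] using this
    have h2 : Filter.Tendsto (fun n => S.L u φ x - ∑ i ∈ Finset.range n, G (i + 1) x)
        Filter.atTop (nhds (S.L u φ x - ∑' n, G (n + 1) x)) :=
      tendsto_const_nhds.sub ((summable_nat_add_iff 1).2 (hGs x)).hasSum.tendsto_sum_nat
    have h3 := tendsto_nhds_unique h1 h2
    have h4 : φ x = G 0 x + ∑' n, G (n + 1) x := (hGs x).tsum_eq_zero_add
    have h5 : G 0 x = g x := rfl
    linarith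

/-- `ρ` is an invariant density of class `C^3`. -/
structure IsInvariant (S : ExpandingTransfer) (u ρ : ℝ → ℝ) : Prop where
  contDiff : ContDiff ℝ 3 ρ
  periodic : Function.Periodic ρ 1
  integral : ∫ x in (0 : ℝ)..1, ρ x = 1
  eq : S.L u ρ = ρ

theorem IsInvariant.continuous {ρ : ℝ → ℝ} (h : S.IsInvariant u ρ) : Continuous ρ :=
  h.contDiff.continuous

/-- The density is 1 + φ, where φ solves φ - Lφ = L1 - 1; the right side has zero mean because L
preserves integrals. -/
theorem exists_isInvariant (hS : S.IsAdmissible η θ) (hu : IsSmall η u) :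
    ∃ ρ, S.IsInvariant u ρ := by
  obtain ⟨C, -, hL⟩ := S.exists_L_ckBound 3 le_rfl
  have h1 := hL η u hu _ _ (CkBound.const 3 1)
  have h2 := h1.sub (CkBound.const 3 1)
  obtain ⟨φ, hφ, hp, h0, heq⟩ := exists_sub_L_eq hS hu (by exact_mod_cast h2.contDiff) h2.periodic
    (by
      rw [intervalIntegral.integral_sub (h1.continuous.intervalIntegrable _ _) (by simp),
        L_integral hu continuous_const (fun _ => rfl), sub_self])
  refine ⟨fun x => 1 + φ x, contDiff_const.add hφ, fun x => by simp only [hp x], ?_, ?_⟩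
  · rw [intervalIntegral.integral_add (by simp) (hφ.continuous.intervalIntegrable _ _), h0]
    simp
  · rw [L_add hu]
    funext x
    linarith [heq x]

/-- Invariance gives Lⁿ(ρ - 1) = ρ - Lⁿ1, which tends to 0 since ρ - 1 has zero mean. Thus ρ is a
limit of the nonnegative functions Lⁿ1. -/
theorem IsInvariant.nonneg (hS : S.IsAdmissible η θ) (hu : IsSmall η u) {ρ : ℝ → ℝ}
    (h : S.IsInvariant u ρ) (x : ℝ) : 0 ≤ ρ x := by
  have h1 := h.contDiff.sub (contDiff_const (c := (1 : ℝ)))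
  have hp : Function.Periodic (fun x => ρ x - 1) 1 := fun x => by simp only [h.periodic x]
  obtain ⟨C, r, hr0, hr1, hb⟩ := exists_iterate_L_ckBound hS hu h1 hp (by
    rw [intervalIntegral.integral_sub (h.continuous.intervalIntegrable _ _) (by simp), h.integral]
    simp)
  have hit : ∀ n, (S.L u)^[n] (fun x => ρ x - 1) =
      fun x => ρ x - (S.L u)^[n] (fun _ => 1) x := by
    intro n
    induction n with
    | zero => rfl
    | succ n ih =>
      rw [Function.iterate_succ_apply', ih, L_sub hu, h.eq]
      simp only [Function.iterate_succ_apply']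
  have hpos : ∀ n x, 0 ≤ (S.L u)^[n] (fun _ => 1) x := by
    intro n
    induction n with
    | zero => exact fun _ => zero_le_one
    | succ n ih =>
      intro x
      rw [Function.iterate_succ_apply']
      exact L_nonneg hu ih x
  have hlow : ∀ n : ℕ, -(C * r ^ n) ≤ ρ x := by
    intro n
    have := (abs_le.1 ((hb n).abs_le x)).1
    rw [hit] at this
    linarith [hpos n x]
  have ht : Filter.Tendsto (fun n : ℕ => -(C * r ^ n)) Filter.atTop (nhds (-(C * 0))) :=
    ((tendsto_pow_atTop_nhds_zero_of_lt_one hr0 hr1).const_mul C).neg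
  simpa using le_of_tendsto' ht hlow

theorem IsInvariant.unique (hS : S.IsAdmissible η θ) (hu : IsSmall η u) {ρ φ : ℝ → ℝ} {K : ℝ}
    (h : S.IsInvariant u ρ) (hp : Function.Periodic φ 1)
    (hK : ∀ x y, |φ x - φ y| ≤ K * |x - y|) (hc : Continuous φ)
    (h1 : ∫ x in (0 : ℝ)..1, φ x = 1) (hL : S.L u φ = φ) : φ = ρ := by
  obtain ⟨M, hM⟩ := exists_ckBound (k := 3) (by exact_mod_cast h.contDiff) h.periodic
  have hρK := abs_sub_le_of_abs_deriv_le hM.differentiable hM.abs_deriv_le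
  funext x
  refine sub_eq_zero.1 (eq_zero_of_L_eq hS hu (φ := fun x => φ x - ρ x) (K := K + M)
    (hp.sub h.periodic) (fun x y => ?_) (hc.sub h.continuous) ?_ ?_ x)
  · have e : φ x - ρ x - (φ y - ρ y) = (φ x - φ y) - (ρ x - ρ y) := by ring
    rw [e, add_mul]
    exact (abs_sub _ _).trans (add_le_add (hK x y) (hρK x y))
  · rw [intervalIntegral.integral_sub (hc.intervalIntegrable _ _)
      (h.continuous.intervalIntegrable _ _), h1, h.integral, sub_self]
  · rw [L_sub hu, hL, h.eq]

/-- The equation (1 - L)(ρ - 1) = L1 - 1 and the a priori bound for 1 - L give a constant that does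
not depend on u. -/
theorem exists_isInvariant_ckBound (hS : S.IsAdmissible η θ) : ∃ C, 0 ≤ C ∧
    ∀ u ρ : ℝ → ℝ, IsSmall η u → S.IsInvariant u ρ → CkBound 3 ρ C := by
  obtain ⟨C, hC, hL⟩ := S.exists_L_ckBound 3 le_rfl
  obtain ⟨D, hD, hinv⟩ := exists_ckBound_of_sub_L hS 2 le_rfl
  refine ⟨1 + D * (C + 1), by positivity, fun u ρ hu h => ?_⟩
  have hp : Function.Periodic (fun x => ρ x - 1) 1 := fun x => by simp only [h.periodic x]
  have hone : CkBound 3 (fun _ => (1 : ℝ)) 1 := by simpa using CkBound.const 3 1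
  have h1 := (hL η u hu _ _ hone).sub hone
  have h2 := hinv u hu (fun x => ρ x - 1) (C + 1)
    (by exact_mod_cast h.contDiff.sub contDiff_const) hp (by
      rw [intervalIntegral.integral_sub (h.continuous.intervalIntegrable _ _) (by simp),
        h.integral]
      simp) (by
      rw [L_sub hu, h.eq]
      have e : (fun x => ρ x - 1 - (ρ x - S.L u (fun _ => 1) x)) =
          fun x => S.L u (fun _ => 1) x - 1 := by
        funext x; ring
      rw [e]
      exact h1.mono (by linarith))
  have h3 := hone.add h2
  simpa using h3

end ExpandingTransfer

end SelfConsistent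

/-! ### Mean field systems and existence of self-consistent densities -/

namespace SelfConsistent

/-- An expanding transfer operator together with a mean field coupling, on periodic lifts. -/
structure MeanFieldSystem extends ExpandingTransfer where
  /-- the mean field `ψ ↦ A_ψ` -/
  A : (ℝ → ℝ) → ℝ → ℝ
  /-- the norm of the mean field as an operator from `L^1` to `C^4` -/
  H : ℝ
  /-- the expanding map -/
  F : ℝ → ℝ
  /-- the expansion of the map -/
  ω : ℝ
  A_ckBound : ∀ (ψ : ℝ → ℝ) (B : ℝ), Continuous ψ → Function.Periodic ψ 1 →
    ∫ x in (0 : ℝ)..1, |ψ x| ≤ B → CkBound 4 (A ψ) (H * B)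
  A_add : ∀ ψ χ : ℝ → ℝ, Continuous ψ → Continuous χ →
    A (fun x => ψ x + χ x) = fun x => A ψ x + A χ x
  A_const_mul : ∀ (r : ℝ) (ψ : ℝ → ℝ), A (fun x => r * ψ x) = fun x => r * A ψ x
  one_lt_ω : 1 < ω
  continuous_F : Continuous F
  expanding : ∀ x y, ω * |x - y| ≤ |F x - F y|
  P_pos : ∀ φ : ℝ → ℝ, (∀ x, 0 ≤ φ x) → ∀ x, 0 < φ x → 0 < P φ (F x)

/-- A continuous density on the circle, as a periodic function. -/
structure IsDensity (ψ : ℝ → ℝ) : Prop where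
  continuous : Continuous ψ
  periodic : Function.Periodic ψ 1
  nonneg : ∀ x, 0 ≤ ψ x
  integral : ∫ x in (0 : ℝ)..1, ψ x = 1

theorem IsDensity.integral_abs_le {ψ : ℝ → ℝ} (h : IsDensity ψ) :
    ∫ x in (0 : ℝ)..1, |ψ x| ≤ 1 := by
  simp only [abs_of_nonneg (h.nonneg _), h.integral, le_refl]

theorem integral_abs_le_of_abs_le {φ : ℝ → ℝ} {K : ℝ} (hc : Continuous φ)
    (hK : ∀ x, |φ x| ≤ K) : ∫ x in (0 : ℝ)..1, |φ x| ≤ K := by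
  have := intervalIntegral.integral_mono_on (μ := volume) (a := 0) (b := 1) zero_le_one
    (hc.abs.intervalIntegrable _ _) (g := fun _ => K) (by simp) (fun x _ => hK x)
  simpa using this

namespace MeanFieldSystem

variable (S : MeanFieldSystem)

theorem H_nonneg : 0 ≤ S.H := by
  have := (S.A_ckBound (fun _ => 0) 1 continuous_const (fun _ => rfl) (by simp)).nonneg
  linarith

theorem A_sub {ψ χ : ℝ → ℝ} (hψ : Continuous ψ) (hχ : Continuous χ) :
    S.A (fun x => ψ x - χ x) = fun x => S.A ψ x - S.A χ x := by
  have h1 := S.A_add ψ (fun x => -1 * χ x) hψ (continuous_const.mul hχ)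
  rw [S.A_const_mul] at h1
  have e : (fun x => ψ x - χ x) = fun x => ψ x + -1 * χ x := by funext x; ring
  rw [e, h1]
  funext x
  ring

theorem A_ckBound_of_abs_le {φ : ℝ → ℝ} {K : ℝ} (hc : Continuous φ)
    (hp : Function.Periodic φ 1) (hK : ∀ x, |φ x| ≤ K) : CkBound 4 (S.A φ) (S.H * K) :=
  S.A_ckBound φ K hc hp (integral_abs_le_of_abs_le hc hK)

/-- The perturbation `t A_ψ` of the identity. -/
noncomputable def coupling (t : ℝ) (ψ : ℝ → ℝ) (x : ℝ) : ℝ := t * S.A ψ x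

/-- Because the mean field is controlled by the L¹ norm, one time range serves all densities at
once. -/
theorem isSmall_coupling {η ε t : ℝ} {ψ : ℝ → ℝ} (hη : η ≤ 1 / 2) (hε : ε * S.H ≤ η)
    (ht : |t| ≤ ε) (hc : Continuous ψ) (hp : Function.Periodic ψ 1)
    (hi : ∫ x in (0 : ℝ)..1, |ψ x| ≤ 1) : IsSmall η (S.coupling t ψ) := by
  refine ⟨((S.A_ckBound ψ 1 hc hp hi).const_mul t).mono ?_, hη⟩
  rw [mul_one]
  exact (mul_le_mul_of_nonneg_right ht S.H_nonneg).trans hε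

/-- `ρ` is a self-consistent density of class `C^3`. -/
structure IsSelfConsistent (t : ℝ) (ρ : ℝ → ℝ) : Prop where
  isDensity : IsDensity ρ
  isInvariant : S.toExpandingTransfer.IsInvariant (S.coupling t ρ) ρ

variable {S} {η θ ε : ℝ}

/-- Follows from (1 - L_w)(ρ' - ρ) = P(Q_w - Q_u)ρ. The densities are bounded in C³ and Q_w - Q_u
costs one derivative, so the difference is controlled in C². -/
theorem exists_invariant_sub_ckBound (hS : S.IsAdmissible η θ) : ∃ C, 0 ≤ C ∧
    ∀ (ζ : ℝ) (u w v ρ ρ' : ℝ → ℝ), IsSmallPair η ζ u w v →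
    S.toExpandingTransfer.IsInvariant u ρ → S.toExpandingTransfer.IsInvariant w ρ' →
    CkBound 2 (fun x => ρ' x - ρ x) (C * ζ) := by
  obtain ⟨M, hM, hρ⟩ := ExpandingTransfer.exists_isInvariant_ckBound hS
  obtain ⟨C₁, hC₁, h₁⟩ := exists_perturbTransfer_sub_ckBound 2 le_rfl
  obtain ⟨C₂, hC₂, h₂⟩ := S.exists_P_ckBound 2 (by norm_num)
  obtain ⟨C₃, hC₃, h₃⟩ := ExpandingTransfer.exists_ckBound_of_sub_L hS 1 (by norm_num)
  refine ⟨C₃ * (C₂ * (C₁ * M)), by positivity, fun ζ u w v ρ ρ' h hu hw => ?_⟩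
  have hb := h₂ _ _ (h₁ η ζ u w v h ρ M (hρ u ρ h.left hu))
  have e : (fun x => ρ' x - ρ x - S.L w (fun y => ρ' y - ρ y) x) =
      S.P fun x => perturbTransfer w ρ x - perturbTransfer u ρ x := by
    rw [ExpandingTransfer.L_sub h.right, hw.eq, S.isTransfer.sub]
    funext x
    have e1 : S.P (perturbTransfer w ρ) x = S.L w ρ x := rfl
    have e2 : S.P (perturbTransfer u ρ) x = S.L u ρ x := rfl
    rw [e1, e2, hu.eq]
    ring
  refine (h₃ w h.right (fun x => ρ' x - ρ x) (C₂ * (C₁ * (ζ * M)))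
    ((hw.contDiff.sub hu.contDiff).of_le (by norm_num)) (hw.periodic.sub hu.periodic) ?_
    ?_).mono (by linarith)
  · rw [intervalIntegral.integral_sub (hw.continuous.intervalIntegrable _ _)
      (hu.continuous.intervalIntegrable _ _), hw.integral, hu.integral, sub_self]
  · rw [e]
    exact hb

/-- Uses sA_χ - tA_ψ = (s - t)A_χ + tA_{χ-ψ}. The factor |t| in front of D is what turns the density
map into a contraction for small t. -/
theorem isSmallPair_coupling {s t D : ℝ} {ψ χ : ℝ → ℝ} (hs : IsSmall η (S.coupling s χ))
    (ht : IsSmall η (S.coupling t ψ)) (hψ : IsDensity ψ) (hχ : IsDensity χ)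
    (hD : ∀ x, |χ x - ψ x| ≤ D) :
    IsSmallPair η (|s - t| * S.H + |t| * (S.H * D)) (S.coupling t ψ) (S.coupling s χ)
      (fun x => S.coupling s χ x - S.coupling t ψ x) := by
  refine ⟨ht, hs, ?_, fun x => by ring⟩
  have h1 := (S.A_ckBound χ 1 hχ.continuous hχ.periodic hχ.integral_abs_le).const_mul (s - t)
  have h2 := (S.A_ckBound_of_abs_le (hχ.continuous.sub hψ.continuous)
    (hχ.periodic.sub hψ.periodic) hD).const_mul t
  have h3 := h1.add h2
  rw [mul_one] at h3
  have e : (fun x => S.coupling s χ x - S.coupling t ψ x) =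
      fun x => (s - t) * S.A χ x + t * S.A (fun x => χ x - ψ x) x := by
    funext x
    rw [S.A_sub hχ.continuous hψ.continuous]
    simp only [coupling]
    ring
  rw [e]
  exact h3

/-- For small `t` there is a self-consistent density. -/
theorem exists_isSelfConsistent (hS : S.IsAdmissible η θ) {C : ℝ}
    (hC : ∀ (ζ : ℝ) (u w v ρ ρ' : ℝ → ℝ), IsSmallPair η ζ u w v →
      S.toExpandingTransfer.IsInvariant u ρ → S.toExpandingTransfer.IsInvariant w ρ' →
      CkBound 2 (fun x => ρ' x - ρ x) (C * ζ))
    (hε : ε * S.H ≤ η) (hCε : C * (ε * S.H) ≤ 1 / 2) (hC0 : 0 ≤ C) {t : ℝ} (ht : |t| ≤ ε) :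
    ∃ ρ, S.IsSelfConsistent t ρ := by
  have hsm : ∀ ψ, IsDensity ψ → IsSmall η (S.coupling t ψ) := fun ψ hψ =>
    S.isSmall_coupling hS.le_half hε ht hψ.continuous hψ.periodic hψ.integral_abs_le
  have hR : ∀ ψ, IsDensity ψ → ∃ ρ, IsDensity ρ ∧
      S.toExpandingTransfer.IsInvariant (S.coupling t ψ) ρ := fun ψ hψ => by
    obtain ⟨ρ, hρ⟩ := ExpandingTransfer.exists_isInvariant hS (hsm ψ hψ)
    exact ⟨ρ, ⟨hρ.continuous, hρ.periodic, hρ.nonneg hS (hsm ψ hψ), hρ.integral⟩, hρ⟩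
  -- R sends ψ to the invariant density of the system driven by ψ; its fixed points are the
  -- self-consistent densities.
  choose! R hRd hRi using hR
  have hlip : ∀ ψ χ, IsDensity ψ → IsDensity χ → ∀ D, (∀ x, |χ x - ψ x| ≤ D) →
      ∀ x, |R χ x - R ψ x| ≤ 1 / 2 * D := by
    intro ψ χ hψ hχ D hD x
    have h1 := (hC _ _ _ _ _ _ (isSmallPair_coupling (hsm χ hχ) (hsm ψ hψ) hψ hχ hD)
      (hRi ψ hψ) (hRi χ hχ)).abs_le x
    have hD0 : 0 ≤ D := (abs_nonneg _).trans (hD 0)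
    rw [sub_self, abs_zero, zero_mul, zero_add] at h1
    refine h1.trans (le_trans ?_ (mul_le_mul_of_nonneg_right hCε hD0))
    have := mul_le_mul_of_nonneg_right ht (mul_nonneg S.H_nonneg hD0)
    nlinarith
  -- Banach's theorem is used on continuous densities with the sup norm. Regularity C³ then comes
  -- for free, since the fixed point is a value of R.
  set X : Set (BoundedContinuousFunction ℝ ℝ) := {ψ | IsDensity ψ} with hX
  have hbdd : ∀ ψ, IsDensity ψ → ∃ M, ∀ x y, dist (ψ x) (ψ y) ≤ M := fun ψ hψ => by
    obtain ⟨x₀, hx₀⟩ := exists_forall_abs_le hψ.continuous hψ.periodic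
    refine ⟨|ψ x₀| + |ψ x₀|, fun x y => ?_⟩
    rw [Real.dist_eq]
    exact (abs_sub _ _).trans (add_le_add (hx₀ x) (hx₀ y))
  have hXc : IsClosed X := by
    have hint : Continuous fun ψ : BoundedContinuousFunction ℝ ℝ => ∫ x in (0 : ℝ)..1, ψ x := by
      refine LipschitzWith.continuous (K := 1) (LipschitzWith.of_dist_le_mul fun ψ χ => ?_)
      rw [Real.dist_eq, ← intervalIntegral.integral_sub (ψ.continuous.intervalIntegrable _ _)
        (χ.continuous.intervalIntegrable _ _)]
      have := intervalIntegral.norm_integral_le_of_norm_le_const (a := 0) (b := 1)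
        (f := fun x => ψ x - χ x) (C := dist ψ χ) (fun x _ => by
          rw [← dist_eq_norm]; exact ψ.dist_coe_le_dist x)
      simpa using this
    have e : X = {ψ | ∀ x, ψ (x + 1) = ψ x} ∩ {ψ | ∀ x, 0 ≤ ψ x} ∩
        {ψ | ∫ x in (0 : ℝ)..1, ψ x = 1} := by
      ext ψ
      exact ⟨fun h => ⟨⟨h.periodic, h.nonneg⟩, h.integral⟩,
        fun h => ⟨ψ.continuous, h.1.1, h.1.2, h.2⟩⟩
    have heval : ∀ x, Continuous fun ψ : BoundedContinuousFunction ℝ ℝ => ψ x := fun x =>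
      continuous_eval_const x
    rw [e]
    refine (IsClosed.inter ?_ ?_).inter (isClosed_eq hint continuous_const)
    · simp only [ofPred_forall]
      exact isClosed_iInter fun x => isClosed_eq (heval _) (heval _)
    · simp only [ofPred_forall]
      exact isClosed_iInter fun x => isClosed_le continuous_const
        (heval _)
  have : CompleteSpace X := hXc.completeSpace_coe
  have : Nonempty X := ⟨⟨BoundedContinuousFunction.const ℝ 1, by
    exact ⟨continuous_const, fun _ => rfl, fun _ => zero_le_one, by simp⟩⟩⟩
  let G : X → X := fun ψ => ⟨⟨⟨R ψ.1, (hRd _ ψ.2).continuous⟩, hbdd _ (hRd _ ψ.2)⟩, hRd _ ψ.2⟩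
  have hG : ContractingWith (1 / 2) G := by
    refine ⟨by rw [← NNReal.coe_lt_coe]; norm_num, LipschitzWith.of_dist_le_mul fun ψ χ => ?_⟩
    rw [Subtype.dist_eq, BoundedContinuousFunction.dist_le (by positivity)]
    intro x
    rw [Real.dist_eq]
    have := hlip χ.1 ψ.1 χ.2 ψ.2 (dist ψ χ)
      (fun x => by rw [← Real.dist_eq]; exact ψ.1.dist_coe_le_dist x) x
    have e : ((1 / 2 : NNReal) : ℝ) = 1 / 2 := by norm_num
    rw [e]
    exact this
  have hfix : G (hG.fixedPoint G) = hG.fixedPoint G := hG.fixedPoint_isFixedPt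
  set ψ := hG.fixedPoint G with hψ
  have hval : R ψ.1 = ψ.1 := by
    have := congrArg (fun χ : X => (χ.1 : ℝ → ℝ)) hfix
    exact this
  refine ⟨ψ.1, ψ.2, ?_⟩
  have := hRi ψ.1 ψ.2
  rwa [hval] at this

end MeanFieldSystem

end SelfConsistent

/-! ### Linearization and second-order expansion in time -/

namespace SelfConsistent

namespace MeanFieldSystem

variable (S : MeanFieldSystem)

/-- The operator `Θ` of a perturbation `u` and a density `ρ`. -/
noncomputable def lin (u ρ g : ℝ → ℝ) : ℝ → ℝ :=
  deriv (perturbTransfer u fun x => ρ x * S.A g x)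

/-- The linearization `g ↦ L g - t P Θ g` of the self-consistent operator. -/
noncomputable def linearized (t : ℝ) (ρ g : ℝ → ℝ) (x : ℝ) : ℝ :=
  S.L (S.coupling t ρ) g x - t * S.P (S.lin (S.coupling t ρ) ρ g) x

/-- Range of times on which the constructions below work, with a constant `C`. -/
structure IsTimeRange (η θ ε C : ℝ) : Prop where
  admissible : S.IsAdmissible η θ
  expanding : 1 < S.ω * (1 - η)
  pos : 0 < ε
  small : ε * S.H ≤ η
  nonneg : 0 ≤ C
  half : C * (ε * S.H) ≤ 1 / 2
  sub_ckBound : ∀ (ζ : ℝ) (u w v ρ ρ' : ℝ → ℝ), IsSmallPair η ζ u w v →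
    S.toExpandingTransfer.IsInvariant u ρ → S.toExpandingTransfer.IsInvariant w ρ' →
    CkBound 2 (fun x => ρ' x - ρ x) (C * ζ)
  lin_ckBound : ∀ u ρ : ℝ → ℝ, IsSmall η u → S.toExpandingTransfer.IsInvariant u ρ →
    ∀ (g : ℝ → ℝ) (K : ℝ), Continuous g → Function.Periodic g 1 → (∀ x, |g x| ≤ K) →
    CkBound 1 (S.P (S.lin u ρ g)) (C * K)
  lin_small : ε * C ≤ (1 - θ) / 2

variable {S} {η θ ε C : ℝ}

/-- Only the sup norm of g is needed: g enters through the smooth function A_g, so the derivative in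
Θ falls on A_g and ρ and not on g. -/
theorem exists_lin_ckBound (hS : S.IsAdmissible η θ) : ∃ C, 0 ≤ C ∧
    ∀ u ρ : ℝ → ℝ, IsSmall η u → S.toExpandingTransfer.IsInvariant u ρ →
    ∀ (g : ℝ → ℝ) (K : ℝ), Continuous g → Function.Periodic g 1 → (∀ x, |g x| ≤ K) →
    CkBound 1 (S.P (S.lin u ρ g)) (C * K) := by
  obtain ⟨M, hM, hρ⟩ := ExpandingTransfer.exists_isInvariant_ckBound hS
  obtain ⟨C₁, hC₁, h₁⟩ := S.exists_P_ckBound 1 (by norm_num)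
  obtain ⟨C₂, hC₂, h₂⟩ := ExpandingTransfer.exists_perturbTransfer_ckBound 2 (by norm_num)
  have hH := S.H_nonneg
  refine ⟨C₁ * (C₂ * (2 ^ 2 * (M * S.H))), by positivity, fun u ρ hu hi g K hc hp hK => ?_⟩
  have h3 := ((hρ u ρ hu hi).of_le (j := 2) (by norm_num)).mul
    ((S.A_ckBound_of_abs_le hc hp hK).of_le (j := 2) (by norm_num))
  exact (h₁ _ _ (h₂ η u hu _ _ h3).deriv).mono (le_of_eq (by ring))

variable (S) in
theorem exists_isTimeRange : ∃ η θ ε C, S.IsTimeRange η θ ε C := by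
  obtain ⟨η, θ, hS, hω⟩ := S.exists_isAdmissible S.one_lt_ω
  obtain ⟨C₁, hC₁, h₁⟩ := exists_invariant_sub_ckBound hS
  obtain ⟨C₂, hC₂, h₂⟩ := exists_lin_ckBound hS
  have hH := S.H_nonneg
  have hη := hS.pos
  have hθ : 0 < 1 - θ := by linarith [hS.lt_one]
  set C := C₁ + C₂ with hC
  have hC0 : 0 ≤ C := add_nonneg hC₁ hC₂
  have ht : ∀ b : ℝ, 0 < b → ∀ a : ℝ, 0 ≤ a → ∀ ε ≤ b / (a + 1), 0 ≤ ε → ε * a ≤ b := by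
    intro b hb a ha ε hε hε0
    rw [le_div_iff₀ (by linarith)] at hε
    nlinarith
  -- Three demands on the time range: couplings stay of size η, the density map contracts by 1/2,
  -- and tPΘ uses up at most half of the gap 1 - θ. Adding 1 to the denominators avoids division by
  -- zero.
  set ε := min (η / (S.H + 1)) (min (1 / 2 / (C * S.H + 1)) ((1 - θ) / 2 / (C + 1))) with hε
  have hε0 : 0 < ε := lt_min (by positivity) (lt_min (by positivity) (by positivity))
  have hsm := ht η hη S.H hH ε (min_le_left _ _) hε0.le
  have hhalf := ht (1 / 2) (by norm_num) (C * S.H) (by positivity) ε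
    ((min_le_right _ _).trans (min_le_left _ _)) hε0.le
  have hlin := ht ((1 - θ) / 2) (by linarith) C hC0 ε
    ((min_le_right _ _).trans (min_le_right _ _)) hε0.le
  refine ⟨η, θ, ε, C, hS, hω, hε0, hsm, hC0, by linarith, fun ζ u w v ρ ρ' h hu hw => ?_,
    fun u ρ hu hi g K hc hp hK => ?_, hlin⟩
  · exact (h₁ ζ u w v ρ ρ' h hu hw).mono
      (mul_le_mul_of_nonneg_right (by linarith) h.diff.nonneg)
  · exact (h₂ u ρ hu hi g K hc hp hK).mono
      (mul_le_mul_of_nonneg_right (by linarith) ((abs_nonneg _).trans (hK 0)))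

namespace IsTimeRange

theorem isSmall (h : S.IsTimeRange η θ ε C) {t : ℝ} (ht : |t| ≤ ε) {ψ : ℝ → ℝ}
    (hψ : IsDensity ψ) : IsSmall η (S.coupling t ψ) :=
  S.isSmall_coupling h.admissible.le_half h.small ht hψ.continuous hψ.periodic
    hψ.integral_abs_le

theorem exists_isSelfConsistent (h : S.IsTimeRange η θ ε C) {t : ℝ} (ht : |t| ≤ ε) :
    ∃ ρ, S.IsSelfConsistent t ρ :=
  MeanFieldSystem.exists_isSelfConsistent h.admissible h.sub_ckBound h.small h.half h.nonneg ht

theorem isSmallPair (h : S.IsTimeRange η θ ε C) {s t D : ℝ} (hs : |s| ≤ ε) (ht : |t| ≤ ε)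
    {ρ ρ' : ℝ → ℝ} (hρ : IsDensity ρ) (hρ' : IsDensity ρ')
    (hD : ∀ x, |ρ' x - ρ x| ≤ D) :
    IsSmallPair η (|s - t| * S.H + |t| * (S.H * D)) (S.coupling t ρ) (S.coupling s ρ')
      (fun x => S.coupling s ρ' x - S.coupling t ρ x) :=
  isSmallPair_coupling (h.isSmall hs hρ') (h.isSmall ht hρ) hρ hρ' hD

/-- Self-consistent densities depend on time in a Lipschitz way. -/
theorem abs_sub_le (h : S.IsTimeRange η θ ε C) {s t : ℝ} (hs : |s| ≤ ε) (ht : |t| ≤ ε)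
    {ρ ρ' : ℝ → ℝ} (hρ : S.IsSelfConsistent t ρ) (hρ' : S.IsSelfConsistent s ρ') (x : ℝ) :
    |ρ' x - ρ x| ≤ 2 * C * S.H * |s - t| := by
  obtain ⟨x₀, hx₀⟩ := exists_forall_abs_le
    (hρ'.isDensity.continuous.sub hρ.isDensity.continuous)
    (hρ'.isDensity.periodic.sub hρ.isDensity.periodic)
  set D := |ρ' x₀ - ρ x₀| with hD
  have h1 := (h.sub_ckBound _ _ _ _ _ _ (h.isSmallPair hs ht hρ.isDensity hρ'.isDensity hx₀)
    hρ.isInvariant hρ'.isInvariant).abs_le x₀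
  refine (hx₀ x).trans ?_
  have hH := S.H_nonneg
  have hC := h.nonneg
  have hD0 : 0 ≤ D := abs_nonneg _
  -- D is the maximum of |ρ' - ρ|, attained at x₀. The feedback of the densities through the mean
  -- field is at most D/2 and is absorbed on the left.
  have h2 : C * (|t| * (S.H * D)) ≤ 1 / 2 * D := by
    have e1 : C * (|t| * (S.H * D)) ≤ C * (ε * (S.H * D)) := by gcongr
    have e2 := mul_le_mul_of_nonneg_right h.half hD0
    linarith
  simp only [← hD, Pi.sub_apply] at h1 ⊢
  linarith

theorem unique (h : S.IsTimeRange η θ ε C) {t : ℝ} (ht : |t| ≤ ε)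
    {ρ ρ' : ℝ → ℝ} (hρ : S.IsSelfConsistent t ρ) (hρ' : S.IsSelfConsistent t ρ') : ρ' = ρ := by
  funext x
  have := h.abs_sub_le ht ht hρ hρ' x
  rw [sub_self, abs_zero, mul_zero] at this
  exact sub_eq_zero.1 (abs_eq_zero.1 (le_antisymm this (abs_nonneg _)))

/-- A Lipschitz self-consistent density is of class `C^3`. -/
theorem isSelfConsistent_of_lipschitz (h : S.IsTimeRange η θ ε C) {t : ℝ} (ht : |t| ≤ ε)
    {φ : ℝ → ℝ} {K : ℝ} (hφ : IsDensity φ) (hK : ∀ x y, |φ x - φ y| ≤ K * |x - y|)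
    (hL : S.L (S.coupling t φ) φ = φ) : S.IsSelfConsistent t φ := by
  obtain ⟨ρ, hρ⟩ := ExpandingTransfer.exists_isInvariant h.admissible (h.isSmall ht hφ)
  have := hρ.unique h.admissible (h.isSmall ht hφ) hφ.periodic hK hφ.continuous hφ.integral hL
  exact ⟨hφ, this ▸ hρ⟩

theorem density_pos (h : S.IsTimeRange η θ ε C) {t : ℝ} (ht : |t| ≤ ε)
    {ρ : ℝ → ℝ} (hρ : S.IsSelfConsistent t ρ) (x : ℝ) : 0 < ρ x := by
  have hd := hρ.isDensity
  have hu := h.isSmall ht hd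
  refine pos_of_expanding h.expanding
    (S.continuous_F.comp (continuous_id.add hu.ckBound.continuous)) (fun x y => ?_)
    hd.continuous hd.periodic hd.nonneg hd.integral (fun x hx => ?_) x
  · refine le_trans ?_ (S.expanding _ _)
    rw [mul_assoc]
    refine mul_le_mul_of_nonneg_left ?_ (by linarith [S.one_lt_ω])
    have h1 := abs_sub_le_of_abs_deriv_le hu.ckBound.differentiable hu.abs_deriv_le x y
    have h2 := abs_sub_abs_le_abs_sub (x - y) (-(S.coupling t ρ x - S.coupling t ρ y))
    have e : id x + S.coupling t ρ x - (id y + S.coupling t ρ y) =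
      x - y - (-(S.coupling t ρ x - S.coupling t ρ y)) := by simp only [id]; ring
    simp only [Pi.add_apply]
    rw [e]
    rw [abs_neg] at h2
    linarith
  · have h1 : 0 < perturbTransfer (S.coupling t ρ) ρ (x + S.coupling t ρ x) := by
      rw [perturbTransfer_apply, hu.left_inv]
      exact mul_pos (hu.weight_pos x) hx
    have h2 := S.P_pos _ (hu.isTransfer.map_nonneg ρ hd.nonneg) _ h1
    have h3 := congrFun hρ.isInvariant.eq (S.F (x + S.coupling t ρ x))
    exact h2.trans_eq h3

/-- Θ produces the derivative of a periodic function, and P preserves integrals; this is why the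
response lies in C¹₀. -/
theorem integral_lin (h : S.IsTimeRange η θ ε C) {t : ℝ} (ht : |t| ≤ ε)
    {ρ : ℝ → ℝ} (hρ : S.IsSelfConsistent t ρ) {g : ℝ → ℝ} {K : ℝ}
    (hc : Continuous g) (hp : Function.Periodic g 1) (hK : ∀ x, |g x| ≤ K) :
    ∫ x in (0 : ℝ)..1, S.P (S.lin (S.coupling t ρ) ρ g) x = 0 := by
  have hu := h.isSmall ht hρ.isDensity
  have hi := hρ.isInvariant
  obtain ⟨M, -, hM⟩ := ExpandingTransfer.exists_isInvariant_ckBound h.admissible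
  obtain ⟨C₂, -, hC₂⟩ := ExpandingTransfer.exists_perturbTransfer_ckBound 2 (by norm_num)
  have h7 := hC₂ η _ hu _ _ (((hM _ ρ hu hi).of_le (j := 2) (by norm_num)).mul
    ((S.A_ckBound_of_abs_le hc hp hK).of_le (j := 2) (by norm_num)))
  exact (S.isTransfer.integral _ h7.deriv.continuous h7.deriv.periodic).trans
    (integral_deriv_eq_zero h7.contDiff_one h7.periodic)

/-- L contributes the rate θ and tPΘ at most (1 - θ)/2; their sum is (1 + θ)/2. The bound on the
derivative suffices, as the image again has zero mean. -/
theorem linearized_ckBound (h : S.IsTimeRange η θ ε C) {t : ℝ} (ht : |t| ≤ ε)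
    {ρ : ℝ → ℝ} (hρ : S.IsSelfConsistent t ρ) {g : ℝ → ℝ} {K : ℝ}
    (hg : CkBound 1 g K) (h0 : ∫ x in (0 : ℝ)..1, g x = 0) :
    CkBound 1 (S.linearized t ρ g) ((1 + θ) / 2 * K) ∧
      ∫ x in (0 : ℝ)..1, S.linearized t ρ g x = 0 := by
  have hu := h.isSmall ht hρ.isDensity
  obtain ⟨D, -, hL⟩ := S.exists_L_ckBound 1 (by norm_num)
  have h1 := hL η _ hu g K hg
  have h2 := h.lin_ckBound _ _ hu hρ.isInvariant g K hg.continuous hg.periodic hg.abs_le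
  have h3 := h1.sub (h2.const_mul t)
  have h4 := ExpandingTransfer.L_contraction h.admissible hu h0 hg.contDiff_one hg.periodic
    hg.abs_deriv_le
  have hd : ∀ x, |deriv (S.linearized t ρ g) x| ≤ (1 + θ) / 2 * K := by
    intro x
    have e := deriv_fun_sub (h1.differentiable x) ((h2.const_mul t).differentiable x)
    have e' : deriv (S.linearized t ρ g) x = _ := e
    rw [e']
    refine (abs_sub _ _).trans ?_
    have h5 := (h2.const_mul t).abs_deriv_le x
    have h6 : |t| * (C * K) ≤ (1 - θ) / 2 * K := by
      have := mul_le_mul_of_nonneg_right ht (mul_nonneg h.nonneg hg.nonneg)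
      have := mul_le_mul_of_nonneg_right h.lin_small hg.nonneg
      linarith
    linarith [h4 x]
  have hint : ∫ x in (0 : ℝ)..1, S.linearized t ρ g x = 0 := by
    unfold linearized
    rw [intervalIntegral.integral_sub (h1.continuous.intervalIntegrable _ _)
      ((h2.const_mul t).continuous.intervalIntegrable _ _), intervalIntegral.integral_const_mul,
      ExpandingTransfer.L_integral hu hg.continuous hg.periodic, h0,
      h.integral_lin ht hρ hg.continuous hg.periodic hg.abs_le]
    ring
  refine ⟨CkBound.succ_iff.2 ⟨h3.differentiable, h3.periodic, ?_, CkBound.zero_iff.2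
    ⟨h3.deriv.continuous, h3.deriv.periodic, hd⟩⟩, hint⟩
  exact abs_le_of_integral_eq_zero h3.continuous h3.periodic
    (abs_sub_le_of_abs_deriv_le h3.differentiable hd) hint

/-- The second order expansion of the self-consistent density. -/
theorem exists_ckBound_remainder (h : S.IsTimeRange η θ ε C) : ∃ D, 0 ≤ D ∧
    ∀ s t : ℝ, |s| ≤ ε → |t| ≤ ε → ∀ ρ ρ' : ℝ → ℝ, S.IsSelfConsistent t ρ →
      S.IsSelfConsistent s ρ' → CkBound 1 (fun x => (ρ' x - ρ x) -
        S.linearized t ρ (fun y => ρ' y - ρ y) x +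
        (s - t) * S.P (S.lin (S.coupling t ρ) ρ ρ) x) (D * |s - t| ^ 2) := by
  obtain ⟨M, hM, hMρ⟩ := ExpandingTransfer.exists_isInvariant_ckBound h.admissible
  obtain ⟨C₁, hC₁, h₁⟩ := S.exists_P_ckBound 1 (by norm_num)
  obtain ⟨C₂, hC₂, h₂⟩ := exists_perturbTransfer_sub_ckBound 1 (by norm_num)
  obtain ⟨C₃, hC₃, h₃⟩ := exists_perturbRemainder_ckBound_one
  obtain ⟨C₄, -, h₄⟩ := ExpandingTransfer.exists_perturbTransfer_ckBound 1 (by norm_num)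
  have hH := S.H_nonneg
  have hε := h.pos
  have hC := h.nonneg
  set E := 2 * C * S.H with hE
  set Z := S.H + ε * (S.H * E) with hZ
  have hE0 : 0 ≤ E := by positivity
  have hZ0 : 0 ≤ Z := by positivity
  refine ⟨C₁ * (C₂ * (Z * (C * Z))) + C₁ * (C₃ * (Z ^ 2 * M)) + C * E, by positivity,
    fun s t hs ht ρ ρ' hρ hρ' => ?_⟩
  have hD := h.abs_sub_le hs ht hρ hρ'
  have hpair : IsSmallPair η (Z * |s - t|) (S.coupling t ρ) (S.coupling s ρ')
      (fun x => S.coupling s ρ' x - S.coupling t ρ x) := by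
    have h5 := h.isSmallPair hs ht hρ.isDensity hρ'.isDensity hD
    refine ⟨h5.left, h5.right, h5.diff.mono ?_, h5.eq_add⟩
    have : |t| * (S.H * (E * |s - t|)) ≤ ε * (S.H * (E * |s - t|)) := by gcongr
    rw [hZ]
    linarith
  have hδ := h.sub_ckBound _ _ _ _ _ _ hpair hρ.isInvariant hρ'.isInvariant
  set u := S.coupling t ρ with hu
  set w := S.coupling s ρ' with hw
  set δ : ℝ → ℝ := fun x => ρ' x - ρ x with hδdef
  have hρ3 := hMρ u ρ hpair.left hρ.isInvariant
  have hρ3' := hMρ w ρ' hpair.right hρ'.isInvariant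
  -- Here δ is O(|s - t|) in C², and Q_w - Q_u adds a factor |s - t| while losing one derivative:
  -- quadratic in C¹. The next bound loses two derivatives of the C³ density ρ.
  have b1 := h₁ _ _ (h₂ _ _ _ _ _ hpair δ _ hδ)
  have b2 := h₁ _ _ (h₃ _ _ _ _ _ hpair ρ _ hρ3)
  have b3 := (h.lin_ckBound u ρ hpair.left hρ.isInvariant δ _ hδ.continuous hδ.periodic
    hD).const_mul (s - t)
  have hA : ∀ g, Continuous g → Function.Periodic g 1 → (∃ K, ∀ x, |g x| ≤ K) →
      ∃ K, CkBound 1 (perturbTransfer u fun x => ρ x * S.A g x) K := by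
    rintro g hc hp ⟨K, hK⟩
    exact ⟨_, h₄ η u hpair.left _ _ ((hρ3.of_le (by norm_num)).mul
      ((S.A_ckBound_of_abs_le hc hp hK).of_le (by norm_num)))⟩
  obtain ⟨K₁, hK₁⟩ := hA ρ hρ3.continuous hρ3.periodic ⟨M, hρ3.abs_le⟩
  obtain ⟨K₂, hK₂⟩ := hA δ hδ.continuous hδ.periodic ⟨_, hδ.abs_le⟩
  -- The first variation splits along w - u = (s - t)A_ρ + tA_δ + (s - t)A_δ. The first part is the
  -- response, the second belongs to the linearized operator, and the third is quadratic.
  have hv : perturbTransfer u (deriv fun y => perturbWeight u y * ((w y - u y) * ρ y)) =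
      fun x => ((s - t) * S.lin u ρ ρ x + t * S.lin u ρ δ x) + (s - t) * S.lin u ρ δ x := by
    have hvρ : CkBound 1 (fun y => (w y - u y) * ρ y) _ :=
      (hpair.diff.of_le (j := 1) (by norm_num)).mul (hρ3.of_le (by norm_num))
    rw [← hpair.left.isTransfer.deriv_eq hvρ.contDiff_one]
    have e : (fun y => (w y - u y) * ρ y) = fun y => ((s - t) * (ρ y * S.A ρ y) +
        t * (ρ y * S.A δ y)) + (s - t) * (ρ y * S.A δ y) := by
      funext y
      simp only [hu, hw, coupling, hδdef]
      rw [S.A_sub hρ3'.continuous hρ3.continuous]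
      ring
    rw [e]
    simp only [hpair.left.isTransfer.add, hpair.left.isTransfer.const_mul]
    funext x
    have d1 := (hK₁.differentiable x).hasDerivAt.const_mul (s - t)
    have d2 := (hK₂.differentiable x).hasDerivAt.const_mul t
    have d3 := (hK₂.differentiable x).hasDerivAt.const_mul (s - t)
    exact ((d1.add d2).add d3).deriv
  have hrem : perturbRemainder u w (fun y => w y - u y) ρ = fun x =>
      (perturbTransfer w ρ x - perturbTransfer u ρ x) +
      (((s - t) * S.lin u ρ ρ x + t * S.lin u ρ δ x) + (s - t) * S.lin u ρ δ x) := by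
    funext x
    exact congrArg (perturbTransfer w ρ x - perturbTransfer u ρ x + ·) (congrFun hv x)
  rw [hrem] at b2
  have e : (fun x => (ρ' x - ρ x) - S.linearized t ρ δ x + (s - t) * S.P (S.lin u ρ ρ) x) =
      fun x => S.P (fun x => perturbTransfer w δ x - perturbTransfer u δ x) x +
        S.P (fun x => (perturbTransfer w ρ x - perturbTransfer u ρ x) +
        (((s - t) * S.lin u ρ ρ x + t * S.lin u ρ δ x) + (s - t) * S.lin u ρ δ x)) x -
        (s - t) * S.P (S.lin u ρ δ) x := by
    have hP := S.isTransfer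
    simp only [hP.add, hP.sub, hP.const_mul]
    funext x
    have e1 : S.P (perturbTransfer u ρ) x = ρ x := congrFun hρ.isInvariant.eq x
    have e2 : S.P (perturbTransfer w ρ') x = ρ' x := congrFun hρ'.isInvariant.eq x
    have e3 := congrFun (ExpandingTransfer.L_sub (S := S.toExpandingTransfer) hpair.right ρ' ρ) x
    simp only [ExpandingTransfer.L] at e3
    have e4 : S.linearized t ρ δ x =
      S.P (perturbTransfer u δ) x - t * S.P (S.lin u ρ δ) x := rfl
    have e5 : S.P (perturbTransfer w δ) x = ρ' x - S.P (perturbTransfer w ρ) x := by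
      rw [← e2]; exact e3
    rw [e4, e1, e5]
    ring
  rw [e]
  refine ((b1.add b2).sub b3).mono (le_of_eq ?_)
  rw [hE]
  ring

end IsTimeRange

end MeanFieldSystem

end SelfConsistent

namespace SelfConsistent

/-! ### Functions with a quadratic first order remainder -/

section QuadraticRemainder

variable {E : Type*} [NormedAddCommGroup E] [NormedSpace ℝ E] {f g : ℝ → E} {ε D : ℝ}

theorem hasDerivAt_of_sq_remainder
    (h : ∀ s t, |s| < ε → |t| < ε → ‖f s - f t - (s - t) • g t‖ ≤ D * |s - t| ^ 2)
    {t : ℝ} (ht : |t| < ε) : HasDerivAt f (g t) t := by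
  rw [hasDerivAt_iff_isLittleO]
  have h1 : (fun s => f s - f t - (s - t) • g t) =O[nhds t] fun s => (s - t) ^ 2 := by
    refine Asymptotics.IsBigO.of_bound D ?_
    have hev : ∀ᶠ s in nhds t, |s| < ε := continuous_abs.continuousAt.eventually_lt_const ht
    filter_upwards [hev] with s hs
    have := h s t hs ht
    rwa [norm_pow, Real.norm_eq_abs]
  refine h1.trans_isLittleO ?_
  have h2 : (fun s : ℝ => (s - t) ^ 2) = (fun x => x ^ 2) ∘ fun s => s - t := rfl
  have h3 : (fun s : ℝ => s - t) = (fun x => x) ∘ fun s => s - t := rfl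
  rw [h2, h3]
  refine Asymptotics.IsLittleO.comp_tendsto (l := nhds 0)
    (Asymptotics.isLittleO_pow_id (by norm_num)) ?_
  have : ContinuousAt (fun s : ℝ => s - t) t := by fun_prop
  rw [ContinuousAt, sub_self] at this
  exact this

/-- Adding the hypothesis for (s, t) to that for (t, s) cancels f and leaves |s - t|·‖g s - g t‖ ≤
2D|s - t|². Hence the derivative g is Lipschitz. -/
theorem contDiffOn_of_sq_remainder
    (h : ∀ s t, |s| < ε → |t| < ε → ‖f s - f t - (s - t) • g t‖ ≤ D * |s - t| ^ 2) :
    ContDiffOn ℝ 1 f (Ioo (-ε) ε) := by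
  have hd : ∀ t ∈ Ioo (-ε) ε, HasDerivAt f (g t) t := fun t ht =>
    hasDerivAt_of_sq_remainder h (abs_lt.2 ht)
  have hlip : LipschitzOnWith (Real.toNNReal (2 * D)) g (Ioo (-ε) ε) := by
    refine LipschitzOnWith.of_dist_le_mul fun s hs t ht => ?_
    rcases eq_or_ne s t with rfl | hst
    · simp
    have h1 := h s t (abs_lt.2 hs) (abs_lt.2 ht)
    have h2 := h t s (abs_lt.2 ht) (abs_lt.2 hs)
    have h3 : ‖(s - t) • (g s - g t)‖ ≤ 2 * D * |s - t| ^ 2 := by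
      have e : (s - t) • (g s - g t) =
          (f s - f t - (s - t) • g t) + (f t - f s - (t - s) • g s) := by module
      rw [e]
      refine (norm_add_le _ _).trans ?_
      rw [abs_sub_comm t s] at h2
      linarith
    have h4 : 0 < |s - t| := abs_pos.2 (sub_ne_zero.2 hst)
    rw [norm_smul, Real.norm_eq_abs, sq] at h3
    rw [dist_eq_norm, Real.dist_eq]
    have h5 : ‖g s - g t‖ ≤ 2 * D * |s - t| := by
      refine le_of_mul_le_mul_left ?_ h4
      linarith
    exact h5.trans (mul_le_mul_of_nonneg_right (Real.le_coe_toNNReal _) (abs_nonneg _))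
  have : ContDiffOn ℝ (0 + 1) f (Ioo (-ε) ε) := by
    rw [contDiffOn_succ_iff_deriv_of_isOpen isOpen_Ioo]
    refine ⟨fun t ht => (hd t ht).differentiableAt.differentiableWithinAt, by simp, ?_⟩
    rw [contDiffOn_zero]
    exact hlip.continuousOn.congr fun t ht => (hd t ht).deriv
  simpa using this

/-- The derivative need only be given on the interval under consideration. -/
theorem contDiffOn_and_hasDerivAt_of_sq_remainder {g : ∀ t : ℝ, |t| ≤ ε → E}
    (h : ∀ s t, |s| ≤ ε → ∀ ht : |t| ≤ ε, ‖f s - f t - (s - t) • g t ht‖ ≤ D * |s - t| ^ 2) :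
    ContDiffOn ℝ 1 f (Ioo (-ε) ε) ∧ ∀ t (ht : |t| ≤ ε), |t| < ε → HasDerivAt f (g t ht) t := by
  let g' : ℝ → E := fun t => if ht : |t| ≤ ε then g t ht else 0
  have hg : ∀ t (ht : |t| ≤ ε), g' t = g t ht := fun t ht => dif_pos ht
  have hrem : ∀ s t, |s| < ε → |t| < ε → ‖f s - f t - (s - t) • g' t‖ ≤ D * |s - t| ^ 2 :=
    fun s t hs ht => by
      rw [hg t ht.le]
      exact h s t hs.le ht.le
  exact ⟨contDiffOn_of_sq_remainder hrem, fun t ht ht' =>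
    hg t ht ▸ hasDerivAt_of_sq_remainder hrem ht'⟩

end QuadraticRemainder

/-- The inverse of `1 - B` for a contraction `B`. The algebraic and topological structures are
decoupled from the norm, so that the result applies to iterated subspaces. -/
theorem exists_continuousLinearEquiv_sub {E : Type*} {G : AddCommGroup E} [Module ℝ E]
    [A : TopologicalSpace E] [N : NormedAddCommGroup E] [CompleteSpace E]
    (hG : N.toAddCommGroup = G) (hA : N.toMetricSpace.toUniformSpace.toTopologicalSpace = A) (B : E →ₗ[ℝ] E) {q : ℝ} (hq0 : 0 ≤ q) (hq : q < 1)
    (hB : ∀ x, ‖B x‖ ≤ q * ‖x‖) : ∃ T : E ≃L[ℝ] E, ∀ x, T x = x - B x := by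
  subst hG hA
  have hlip : LipschitzWith q.toNNReal B := LipschitzWith.of_dist_le_mul fun x y => by
    rw [dist_eq_norm, dist_eq_norm, ← map_sub, Real.coe_toNNReal q hq0]
    exact hB _
  let J : E →ₗ[ℝ] E := LinearMap.id - B
  have hsurj : Function.Surjective J := fun y => by
    -- A solution of x - Bx = y is a fixed point of x ↦ y + Bx.
    have hc : ContractingWith q.toNNReal fun x : E => y + B x :=
      ⟨by rwa [← NNReal.coe_lt_coe, Real.coe_toNNReal q hq0],
        LipschitzWith.of_dist_le_mul fun x x' => by
          rw [dist_add_left]; exact hlip.dist_le_mul x x'⟩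
    exact ⟨ContractingWith.fixedPoint _ hc, sub_eq_of_eq_add hc.fixedPoint_isFixedPt.symm⟩
  have hle : ∀ x, ‖x‖ ≤ (1 - q)⁻¹ * ‖x - B x‖ := fun x => by
    rw [le_inv_mul_iff₀ (by linarith)]
    have := norm_sub_norm_le x (B x)
    linarith [hB x]
  have hinj : Function.Injective J := fun x y hxy => by
    have h0 : x - y - B (x - y) = 0 := by
      rw [map_sub, sub_sub_sub_comm]
      exact sub_eq_zero.2 hxy
    have := hle (x - y)
    rw [h0, norm_zero, mul_zero] at this
    exact sub_eq_zero.1 (norm_le_zero_iff.1 this)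
  let T := LinearEquiv.ofBijective J ⟨hinj, hsurj⟩
  have hT : ∀ x, T x = x - B x := fun _ => rfl
  have hT' : Continuous T.symm := by
    refine LipschitzWith.continuous (K := (1 - q)⁻¹.toNNReal) <|
      LipschitzWith.of_dist_le_mul fun y y' => ?_
    have := hle (T.symm y - T.symm y')
    rwa [← hT, map_sub, T.apply_symm_apply, T.apply_symm_apply, ← dist_eq_norm,
      ← dist_eq_norm, ← Real.coe_toNNReal (1 - q)⁻¹ (inv_nonneg.2 (by linarith))] at this
  exact ⟨{ T with
    continuous_toFun := continuous_id.sub hlip.continuous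
    continuous_invFun := hT' }, hT⟩

/-! ### The spaces `C¹` and `C¹₀` -/

theorem continuous_of_lift {X : Type*} [TopologicalSpace X] {φ : S1 → X}
    (h : Continuous fun x : ℝ => φ (x : S1)) : Continuous φ :=
  (QuotientAddGroup.isQuotientMap_mk (N := AddSubgroup.zmultiples (1 : ℝ))).continuous_iff.2 h

theorem periodic_lift {X : Type*} (φ : S1 → X) : Function.Periodic (fun x : ℝ => φ (x : S1)) 1 :=
  fun x => by simp only [AddCircle.coe_add_period]

theorem integral_eq_integral_lift (φ : S1 → ℝ) :
    ∫ x, φ x = ∫ x in (0 : ℝ)..1, φ (x : S1) := by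
  rw [UnitAddCircle.intervalIntegral_preimage 0 φ |>.symm, zero_add]

namespace C1

/-- The periodic lift of an element of `C¹(S¹, ℝ)`. -/
def lift (g : C1) (x : ℝ) : ℝ := C1.fn g (x : S1)

theorem hasDerivAt_lift (g : C1) (x : ℝ) : HasDerivAt (lift g) (g.1.2 (x : S1)) x := g.2 x

theorem ckBound_lift (g : C1) : CkBound 1 (lift g) ‖g‖ := by
  have h1 : ∀ x, |lift g x| ≤ ‖g‖ := fun x =>
    (g.1.1.norm_coe_le_norm (x : S1)).trans (norm_fst_le g.1)
  have hd : deriv (lift g) = fun x : ℝ => g.1.2 (x : S1) :=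
    funext fun x => (hasDerivAt_lift g x).deriv
  refine CkBound.succ_iff.2 ⟨fun x => (hasDerivAt_lift g x).differentiableAt,
    periodic_lift _, h1, ?_⟩
  rw [hd]
  exact CkBound.zero_iff.2 ⟨g.1.2.continuous.comp (AddCircle.continuous_mk' 1), periodic_lift _,
    fun x => (g.1.2.norm_coe_le_norm (x : S1)).trans (norm_snd_le g.1)⟩

theorem norm_le {g : C1} {K : ℝ} (h : CkBound 1 (lift g) K) : ‖g‖ ≤ K := by
  have hK := h.nonneg
  refine (max_le ((ContinuousMap.norm_le _ hK).2 fun x => ?_)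
    ((ContinuousMap.norm_le _ hK).2 fun x => ?_) : ‖g.1‖ ≤ K)
  · induction x using QuotientAddGroup.induction_on with
    | H y => exact h.abs_le y
  · induction x using QuotientAddGroup.induction_on with
    | H y =>
      have := h.abs_deriv_le y
      rw [(hasDerivAt_lift g y).deriv] at this
      exact this

/-- The second component of an element is the derivative of the first, so the lift determines the
pair. -/
theorem ext_lift {g g' : C1} (h : ∀ x, lift g x = lift g' x) : g = g' := by
  rw [← sub_eq_zero, ← norm_le_zero_iff]
  refine norm_le ?_
  have e : lift (g - g') = fun _ => 0 := funext fun x => sub_eq_zero.2 (h x)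
  rw [e]
  simpa using CkBound.const 1 0

/-- The element of `C¹(S¹, ℝ)` with a given lift. -/
noncomputable def mk (φ : ℝ → ℝ) (h : ContDiff ℝ 1 φ) (hp : Function.Periodic φ 1) : C1 :=
  ⟨(⟨hp.lift, continuous_of_lift (by simpa using h.continuous)⟩,
    ⟨(periodic_deriv hp).lift, continuous_of_lift (by simpa using h.continuous_deriv le_rfl)⟩),
    fun x => by simpa using (h.differentiable one_ne_zero x).hasDerivAt⟩

theorem integral_fn (g : C1) : ∫ x, C1.fn g x = ∫ x in (0 : ℝ)..1, lift g x :=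
  integral_eq_integral_lift _

theorem mem_zeroMean {g : C1} : g ∈ c1ZeroMean ↔ ∫ x in (0 : ℝ)..1, lift g x = 0 := by
  rw [← integral_fn]
  rfl

end C1

/-- A uniform limit of derivatives is the derivative of the limit. This makes C¹ complete, as the
contraction argument on C¹₀ requires. -/
theorem isClosed_c1Submodule : IsClosed (c1Submodule : Set (C(S1, ℝ) × C(S1, ℝ))) := by
  refine IsSeqClosed.isClosed fun p q hp hq x => ?_
  have h1 := ContinuousMap.tendsto_iff_tendstoUniformly.1 ((continuous_snd.tendsto q).comp hq)
  have h2 := ContinuousMap.tendsto_iff_tendstoUniformly.1 ((continuous_fst.tendsto q).comp hq)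
  refine hasDerivAt_of_tendstoUniformly (l := Filter.atTop)
    (f := fun n (s : ℝ) => (p n).1 (s : S1)) (f' := fun n (s : ℝ) => (p n).2 (s : S1))
    (g' := fun s : ℝ => q.2 (s : S1)) (h1.comp fun s : ℝ => (s : S1))
    (Filter.Eventually.of_forall fun n s => hp n s) (fun s => h2.tendsto_at (s : S1)) x

instance : CompleteSpace C1 := isClosed_c1Submodule.completeSpace_coe

theorem isClosed_c1ZeroMean : IsClosed (c1ZeroMean : Set C1) := by
  have hint : Continuous fun g : C1 => ∫ x in (0 : ℝ)..1, C1.lift g x := by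
    refine LipschitzWith.continuous (K := 1) (LipschitzWith.of_dist_le_mul fun g g' => ?_)
    rw [Real.dist_eq, ← intervalIntegral.integral_sub
      ((C1.ckBound_lift g).continuous.intervalIntegrable _ _)
      ((C1.ckBound_lift g').continuous.intervalIntegrable _ _)]
    have := intervalIntegral.norm_integral_le_of_norm_le_const (a := 0) (b := 1)
      (f := fun x => C1.lift g x - C1.lift g' x) (C := dist g g') (fun x _ => by
        rw [dist_eq_norm]; exact (C1.ckBound_lift (g - g')).abs_le x)
    simpa using this
  have e : (c1ZeroMean : Set C1) = {g | ∫ x in (0 : ℝ)..1, C1.lift g x = 0} := by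
    ext g
    exact C1.mem_zeroMean
  rw [e]
  exact isClosed_eq hint continuous_const

instance : CompleteSpace c1ZeroMean := isClosed_c1ZeroMean.completeSpace_coe

theorem exists_resolvent_of_contraction (B : c1ZeroMean →ₗ[ℝ] c1ZeroMean) {q : ℝ} (hq0 : 0 ≤ q)
    (hq : q < 1) (hB : ∀ g, ‖B g‖ ≤ q * ‖g‖) :
    ∃ T : c1ZeroMean ≃L[ℝ] c1ZeroMean, ∀ g, T g = g - B g :=
  have hG : (NormedAddCommGroup.toAddCommGroup : AddCommGroup c1ZeroMean) =
      c1ZeroMean.addCommGroup := rfl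
  have hA : (inferInstance :
      NormedAddCommGroup c1ZeroMean).toMetricSpace.toUniformSpace.toTopologicalSpace =
      (instTopologicalSpaceSubtype : TopologicalSpace c1ZeroMean) := rfl
  exists_continuousLinearEquiv_sub (E := c1ZeroMean) hG hA B hq0 hq hB

/-! ### The linearized operator on C¹₀ and its resolvent -/

namespace MeanFieldSystem.IsTimeRange

variable {S : MeanFieldSystem} {η θ ε C t : ℝ} {ρ : ℝ → ℝ}

theorem linearized_add (h : S.IsTimeRange η θ ε C) (ht : |t| ≤ ε) (hρ : S.IsSelfConsistent t ρ)
    {g g' : ℝ → ℝ} {K K' : ℝ} (hg : CkBound 1 g K) (hg' : CkBound 1 g' K') :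
    S.linearized t ρ (fun x => g x + g' x) =
      fun x => S.linearized t ρ g x + S.linearized t ρ g' x := by
  have hu := h.isSmall ht hρ.isDensity
  have hd : ∀ {g : ℝ → ℝ} {K : ℝ}, CkBound 1 g K →
      Differentiable ℝ (perturbTransfer (S.coupling t ρ) fun x => ρ x * S.A g x) := fun hg =>
    hu.isTransfer.differentiable ((hρ.isInvariant.contDiff.of_le (by norm_num)).mul
      (S.A_ckBound_of_abs_le hg.continuous hg.periodic hg.abs_le).contDiff_one)
  have e : S.lin (S.coupling t ρ) ρ (fun x => g x + g' x) =
      fun x => S.lin (S.coupling t ρ) ρ g x + S.lin (S.coupling t ρ) ρ g' x := by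
    funext x
    unfold lin
    rw [S.A_add _ _ hg.continuous hg'.continuous, ← deriv_fun_add (hd hg x) (hd hg' x)]
    simp only [mul_add]
    rw [hu.isTransfer.add]
  funext x
  unfold linearized
  rw [e, S.isTransfer.add, ExpandingTransfer.L_add hu]
  ring

theorem linearized_const_mul (h : S.IsTimeRange η θ ε C) (ht : |t| ≤ ε)
    (hρ : S.IsSelfConsistent t ρ) (r : ℝ) (g : ℝ → ℝ) :
    S.linearized t ρ (fun x => r * g x) = fun x => r * S.linearized t ρ g x := by
  have hu := h.isSmall ht hρ.isDensity
  have e : S.lin (S.coupling t ρ) ρ (fun x => r * g x) =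
      fun x => r * S.lin (S.coupling t ρ) ρ g x := by
    funext x
    unfold lin
    rw [S.A_const_mul]
    have e2 : (fun x => ρ x * (r * S.A g x)) = fun x => r * (ρ x * S.A g x) := by
      funext x; ring
    rw [e2, hu.isTransfer.const_mul, deriv_const_mul_field]
  funext x
  unfold linearized
  rw [e, S.isTransfer.const_mul, ExpandingTransfer.L_const_mul hu]
  ring

/-- The linearized operator on `C¹₀`. -/
noncomputable def linearizedMap (h : S.IsTimeRange η θ ε C) (ht : |t| ≤ ε)
    (hρ : S.IsSelfConsistent t ρ) : c1ZeroMean →ₗ[ℝ] c1ZeroMean where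
  toFun g :=
    have hb := h.linearized_ckBound ht hρ (C1.ckBound_lift g.1) (C1.mem_zeroMean.1 g.2)
    ⟨C1.mk (S.linearized t ρ (C1.lift g.1)) hb.1.contDiff_one hb.1.periodic,
      C1.mem_zeroMean.2 hb.2⟩
  map_add' g g' := Subtype.ext (C1.ext_lift fun x =>
    congrFun (h.linearized_add ht hρ (C1.ckBound_lift g.1) (C1.ckBound_lift g'.1)) x)
  map_smul' r g := Subtype.ext (C1.ext_lift fun x =>
    congrFun (h.linearized_const_mul ht hρ r (C1.lift g.1)) x)

theorem norm_linearizedMap_le (h : S.IsTimeRange η θ ε C) (ht : |t| ≤ ε)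
    (hρ : S.IsSelfConsistent t ρ) (g : c1ZeroMean) :
    ‖h.linearizedMap ht hρ g‖ ≤ (1 + θ) / 2 * ‖g‖ :=
  C1.norm_le (h.linearized_ckBound ht hρ (C1.ckBound_lift g.1) (C1.mem_zeroMean.1 g.2)).1

theorem rate_lt_one (h : S.IsTimeRange η θ ε C) : (1 + θ) / 2 < 1 := by
  linarith [h.admissible.lt_one]

theorem exists_resolvent (h : S.IsTimeRange η θ ε C) (ht : |t| ≤ ε)
    (hρ : S.IsSelfConsistent t ρ) :
    ∃ T : c1ZeroMean ≃L[ℝ] c1ZeroMean, ∀ g, T g = g - h.linearizedMap ht hρ g :=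

  exists_resolvent_of_contraction _ (by linarith [h.admissible.nonneg]) h.rate_lt_one
    (h.norm_linearizedMap_le ht hρ)

/-- The operator `1 - P_t + t P Θ_t` on `C¹₀`. -/
noncomputable def resolvent (h : S.IsTimeRange η θ ε C) (ht : |t| ≤ ε)
    (hρ : S.IsSelfConsistent t ρ) : c1ZeroMean ≃L[ℝ] c1ZeroMean :=
  (h.exists_resolvent ht hρ).choose

theorem resolvent_apply (h : S.IsTimeRange η θ ε C) (ht : |t| ≤ ε)
    (hρ : S.IsSelfConsistent t ρ) (g : c1ZeroMean) :
    h.resolvent ht hρ g = g - h.linearizedMap ht hρ g :=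
  (h.exists_resolvent ht hρ).choose_spec g

theorem norm_le_norm_resolvent (h : S.IsTimeRange η θ ε C) (ht : |t| ≤ ε)
    (hρ : S.IsSelfConsistent t ρ) (g : c1ZeroMean) :
    ‖g‖ ≤ (1 - (1 + θ) / 2)⁻¹ * ‖h.resolvent ht hρ g‖ := by
  have h1 := h.norm_linearizedMap_le ht hρ g
  rw [le_inv_mul_iff₀ (by linarith [h.rate_lt_one]), resolvent_apply]
  have := norm_sub_norm_le g (h.linearizedMap ht hρ g)
  linarith

/-- The function `P Θ_t(ρ(t))` in `C¹₀`. -/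
noncomputable def response (h : S.IsTimeRange η θ ε C) (ht : |t| ≤ ε)
    (hρ : S.IsSelfConsistent t ρ) : c1ZeroMean :=
  have hK := Classical.choose_spec (exists_ckBound (k := 0)
    (contDiff_zero.2 hρ.isDensity.continuous) hρ.isDensity.periodic)
  have hb := h.lin_ckBound _ ρ (h.isSmall ht hρ.isDensity) hρ.isInvariant ρ _ hK.continuous
    hK.periodic hK.abs_le
  ⟨C1.mk _ hb.contDiff_one hb.periodic,
    C1.mem_zeroMean.2 (h.integral_lin ht hρ hK.continuous hK.periodic hK.abs_le)⟩

/-- Differentiability of a family of self-consistent densities. -/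
theorem exists_sq_remainder (h : S.IsTimeRange η θ ε C) (ρ : ℝ → C1)
    (hρ : ∀ t, |t| ≤ ε → S.IsSelfConsistent t (C1.lift (ρ t))) : ∃ D, ∀ s t, |s| ≤ ε →
      ∀ ht : |t| ≤ ε, ‖ρ s - ρ t - (s - t) • (-((h.resolvent ht (hρ t ht)).symm
        (h.response ht (hρ t ht)) : C1))‖ ≤ D * |s - t| ^ 2 := by
  obtain ⟨D, hD, hrem⟩ := h.exists_ckBound_remainder
  refine ⟨(1 - (1 + θ) / 2)⁻¹ * D, fun s t hs ht => ?_⟩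
  have hδ : ρ s - ρ t ∈ c1ZeroMean := by
    rw [C1.mem_zeroMean]
    have e : C1.lift (ρ s - ρ t) = fun x => C1.lift (ρ s) x - C1.lift (ρ t) x := rfl
    rw [e, intervalIntegral.integral_sub
      ((C1.ckBound_lift _).continuous.intervalIntegrable _ _)
      ((C1.ckBound_lift _).continuous.intervalIntegrable _ _), (hρ s hs).isDensity.integral,
      (hρ t ht).isDensity.integral, sub_self]
  set T := h.resolvent ht (hρ t ht) with hT
  set r := h.response ht (hρ t ht) with hr
  set δ : c1ZeroMean := ⟨ρ s - ρ t, hδ⟩ with hδdef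
  -- The image of this vector under T is exactly the second-order remainder, so the bound on the
  -- inverse, which is uniform in t, transfers the quadratic estimate to it.
  have h1 := h.norm_le_norm_resolvent ht (hρ t ht) (δ + (s - t) • T.symm r)
  have h2 : ‖T (δ + (s - t) • T.symm r)‖ ≤ D * |s - t| ^ 2 := by
    refine C1.norm_le ?_
    have e : T (δ + (s - t) • T.symm r) = δ - h.linearizedMap ht (hρ t ht) δ + (s - t) • r := by
      rw [map_add, map_smul, T.apply_symm_apply, hT, resolvent_apply]
    rw [e]
    exact hrem s t hs ht _ _ (hρ t ht) (hρ s hs)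
  have h3 : ρ s - ρ t - (s - t) • (-(T.symm r : C1)) =
      ((δ + (s - t) • T.symm r : c1ZeroMean) : C1) := by
    simp [hδdef]
  rw [h3]
  refine h1.trans ?_
  rw [mul_assoc]
  exact mul_le_mul_of_nonneg_left h2 (inv_nonneg.2 (by linarith [h.rate_lt_one]))

end MeanFieldSystem.IsTimeRange

end SelfConsistent

/-! ### The differentiable family of densities -/

namespace SelfConsistent

namespace MeanFieldSystem.IsTimeRange

variable {S : MeanFieldSystem} {η θ ε C : ℝ}

/-- The linear response of the family of self-consistent densities. -/
theorem exists_family (h : S.IsTimeRange η θ ε C) : ∃ (ρ : ℝ → C1)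
    (hρ : ∀ t, |t| ≤ ε → S.IsSelfConsistent t (C1.lift (ρ t))),
    ContDiffOn ℝ 1 ρ (Ioo (-ε) ε) ∧ ∀ t (ht : |t| ≤ ε), |t| < ε →
      HasDerivAt ρ (-((h.resolvent ht (hρ t ht)).symm (h.response ht (hρ t ht)) : C1)) t := by
  have hex : ∀ t, ∃ g : C1, |t| ≤ ε → S.IsSelfConsistent t (C1.lift g) := fun t => by
    by_cases ht : |t| ≤ ε
    · obtain ⟨φ, hφ⟩ := h.exists_isSelfConsistent ht
      exact ⟨C1.mk φ (hφ.isInvariant.contDiff.of_le (by norm_num)) hφ.isDensity.periodic,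
        fun _ => hφ⟩
    -- Outside the time range the family takes the arbitrary value 0.
    · exact ⟨0, fun h => absurd h ht⟩
  choose ρ hρ using hex
  obtain ⟨D, hD⟩ := h.exists_sq_remainder ρ hρ
  exact ⟨ρ, hρ, contDiffOn_and_hasDerivAt_of_sq_remainder hD⟩

end MeanFieldSystem.IsTimeRange

/-! ### Integral operators with a smooth kernel -/

/-- The integral operator with kernel `k` on periodic lifts. -/
noncomputable def kernelMean (k : ℝ → ℝ → ℝ) (ψ : ℝ → ℝ) (x : ℝ) : ℝ :=
  ∫ y in (0 : ℝ)..1, k x y * ψ y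

theorem exists_forall_abs_le_uncurry {k : ℝ → ℝ → ℝ}
    (hc : Continuous fun p : ℝ × ℝ => k p.1 p.2) (h₁ : ∀ x y, k (x + 1) y = k x y)
    (h₂ : ∀ x y, k x (y + 1) = k x y) : ∃ M, 0 ≤ M ∧ ∀ x y, |k x y| ≤ M := by
  obtain ⟨p, -, hp⟩ := (isCompact_Icc.prod isCompact_Icc).exists_isMaxOn
    (s := Icc (0 : ℝ) 1 ×ˢ Icc (0 : ℝ) 1) ⟨(0, 0), by simp⟩ hc.abs.continuousOn
  refine ⟨|k p.1 p.2|, abs_nonneg _, fun x y => ?_⟩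
  have hx : Function.Periodic (fun x => k x y) 1 := fun x => h₁ x y
  obtain ⟨x', hx', e⟩ := hx.exists_mem_Ico₀ one_pos x
  have hy : Function.Periodic (fun y => k x' y) 1 := fun y => h₂ x' y
  obtain ⟨y', hy', e'⟩ := hy.exists_mem_Ico₀ one_pos y
  rw [show k x y = k x' y from e, show k x' y = k x' y' from e']
  exact hp (show (x', y') ∈ _ from ⟨Ico_subset_Icc_self hx', Ico_subset_Icc_self hy'⟩)

theorem hasDerivAt_kernelMean {k : ℝ → ℝ → ℝ} (hk : ContDiff ℝ 1 fun p : ℝ × ℝ => k p.1 p.2)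
    {ψ : ℝ → ℝ} (hψ : Continuous ψ) {M : ℝ} (hM : ∀ x y, |deriv (fun x => k x y) x| ≤ M)
    (hk' : Continuous fun p : ℝ × ℝ => deriv (fun x => k x p.2) p.1) (x : ℝ) :
    HasDerivAt (kernelMean k ψ) (kernelMean (fun x y => deriv (fun x => k x y) x) ψ x) x := by
  have hc : ∀ x, Continuous fun y => k x y * ψ y := fun x =>
    (hk.continuous.comp (by fun_prop : Continuous fun y : ℝ => (x, y))).mul hψ
  have hc' : ∀ x, Continuous fun y => deriv (fun x => k x y) x * ψ y := fun x =>
    (hk'.comp (by fun_prop : Continuous fun y : ℝ => (x, y))).mul hψ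
  refine (intervalIntegral.hasDerivAt_integral_of_dominated_loc_of_deriv_le (μ := volume)
    (s := univ) (bound := fun y => M * |ψ y|)
    (F' := fun x y => deriv (fun x => k x y) x * ψ y) Filter.univ_mem
    (Filter.Eventually.of_forall fun x => (hc x).aestronglyMeasurable)
    ((hc x).intervalIntegrable _ _) (hc' x).aestronglyMeasurable
    (Filter.Eventually.of_forall fun y _ x _ => ?_)
    ((continuous_const.mul hψ.abs).intervalIntegrable _ _)
    (Filter.Eventually.of_forall fun y _ x _ => ?_)).2
  · rw [Real.norm_eq_abs, abs_mul]
    exact mul_le_mul_of_nonneg_right (hM x y) (abs_nonneg _)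
  · have hd : DifferentiableAt ℝ (fun x => k x y) x :=
      ((hk.comp (by fun_prop : ContDiff ℝ 1 fun x : ℝ => (x, y))).differentiable one_ne_zero) x
    exact hd.hasDerivAt.mul_const _

/-- Derivatives in x fall on the kernel alone, so only the L¹ norm of ψ enters and no
differentiability of ψ is used. -/
theorem exists_kernelMean_ckBound (n : ℕ) {k : ℝ → ℝ → ℝ}
    (hk : ContDiff ℝ n fun p : ℝ × ℝ => k p.1 p.2) (h₁ : ∀ x y, k (x + 1) y = k x y)
    (h₂ : ∀ x y, k x (y + 1) = k x y) : ∃ H, 0 ≤ H ∧ ∀ (ψ : ℝ → ℝ) (B : ℝ), Continuous ψ →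
      ∫ x in (0 : ℝ)..1, |ψ x| ≤ B → CkBound n (kernelMean k ψ) (H * B) := by
  induction n generalizing k with
  | zero =>
    have hc : Continuous fun p : ℝ × ℝ => k p.1 p.2 := hk.continuous
    obtain ⟨M, hM, hb⟩ := exists_forall_abs_le_uncurry hc h₁ h₂
    refine ⟨M, hM, fun ψ B hψ hB => CkBound.zero_iff.2 ⟨?_, fun x => ?_, fun x => ?_⟩⟩
    · refine intervalIntegral.continuous_parametric_intervalIntegral_of_continuous' ?_ 0 1
      exact hc.mul (hψ.comp continuous_snd)
    · simp only [kernelMean, h₁]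
    · have := intervalIntegral.norm_integral_le_of_norm_le (μ := volume) (a := 0) (b := 1)
        zero_le_one (f := fun y => k x y * ψ y) (g := fun y => M * |ψ y|)
        (Filter.Eventually.of_forall fun y _ => by
          rw [Real.norm_eq_abs, abs_mul]
          exact mul_le_mul_of_nonneg_right (hb x y) (abs_nonneg _))
        ((continuous_const.mul hψ.abs).intervalIntegrable _ _)
      rw [intervalIntegral.integral_const_mul] at this
      exact this.trans (mul_le_mul_of_nonneg_left hB hM)
  | succ n ih =>
    have hk1 : ContDiff ℝ 1 fun p : ℝ × ℝ => k p.1 p.2 :=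
      hk.of_le (by exact_mod_cast Nat.succ_le_succ (Nat.zero_le n))
    have e : (fun p : ℝ × ℝ => deriv (fun x => k x p.2) p.1) =
        fun p => fderiv ℝ (fun p : ℝ × ℝ => k p.1 p.2) p (1, 0) := by
      funext p
      have h1 := (hk1.differentiable one_ne_zero p).hasFDerivAt
      have h2 : HasDerivAt (fun x : ℝ => (x, p.2)) (1, 0) p.1 :=
        (hasDerivAt_id p.1).prodMk (hasDerivAt_const p.1 p.2)
      exact (h1.comp_hasDerivAt p.1 h2).deriv
    have hk' : ContDiff ℝ n fun p : ℝ × ℝ => deriv (fun x => k x p.2) p.1 := by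
      rw [e]
      exact (hk.fderiv_right (by exact_mod_cast le_rfl)).clm_apply contDiff_const
    have h₁' : ∀ x y, deriv (fun x => k x y) (x + 1) = deriv (fun x => k x y) x := fun x y =>
      periodic_deriv (φ := fun x => k x y) (fun x => h₁ x y) x
    have h₂' : ∀ x y, deriv (fun x => k x (y + 1)) x = deriv (fun x => k x y) x := fun x y => by
      simp only [h₂]
    obtain ⟨H', hH', hb'⟩ := ih (k := fun x y => deriv (fun x => k x y) x) hk' h₁' h₂'
    obtain ⟨M, hM, hb⟩ := exists_forall_abs_le_uncurry (k := fun x y => deriv (fun x => k x y) x)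
      hk'.continuous h₁' h₂'
    obtain ⟨H, hH, hb0⟩ := ih (hk.of_le (by exact_mod_cast Nat.le_succ n)) h₁ h₂
    refine ⟨H + H', add_nonneg hH hH', fun ψ B hψ hB => ?_⟩
    have hB0 : 0 ≤ B := le_trans (intervalIntegral.integral_nonneg zero_le_one
      fun _ _ => abs_nonneg _) hB
    have hd := hasDerivAt_kernelMean hk1 hψ hb hk'.continuous
    have hψ0 := hb0 ψ B hψ hB
    refine CkBound.succ_iff.2 ⟨fun x => (hd x).differentiableAt, hψ0.periodic, fun x => ?_, ?_⟩
    · exact (hψ0.abs_le x).trans (mul_le_mul_of_nonneg_right (by linarith) hB0)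
    · rw [funext fun x => (hd x).deriv]
      exact (hb' ψ B hψ hB).mono (mul_le_mul_of_nonneg_right (by linarith) hB0)

theorem kernelMean_add {k : ℝ → ℝ → ℝ} (hk : Continuous fun p : ℝ × ℝ => k p.1 p.2)
    {ψ χ : ℝ → ℝ} (hψ : Continuous ψ) (hχ : Continuous χ) :
    kernelMean k (fun x => ψ x + χ x) = fun x => kernelMean k ψ x + kernelMean k χ x := by
  funext x
  have hc : Continuous fun y => k x y := hk.comp (by fun_prop : Continuous fun y : ℝ => (x, y))
  have h1 : Continuous fun y => k x y * ψ y := hc.mul hψ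
  have h2 : Continuous fun y => k x y * χ y := hc.mul hχ
  unfold kernelMean
  rw [← intervalIntegral.integral_add (h1.intervalIntegrable _ _) (h2.intervalIntegrable _ _)]
  simp only [mul_add]

theorem kernelMean_const_mul (k : ℝ → ℝ → ℝ) (r : ℝ) (ψ : ℝ → ℝ) :
    kernelMean k (fun x => r * ψ x) = fun x => r * kernelMean k ψ x := by
  funext x
  unfold kernelMean
  rw [← intervalIntegral.integral_const_mul]
  simp only [mul_left_comm]

end SelfConsistent

namespace SelfConsistent

/-! ### Transfer operators of expanding maps of the circle -/

/-- `F` is the lift of an expanding map of the circle with `n` preimages and orientation `s`. -/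
structure IsExpandingLift (F : ℝ → ℝ) (ω s : ℝ) (n : ℕ) : Prop where
  contDiff : ContDiff ℝ 5 F
  sign : s = 1 ∨ s = -1
  one_lt : 1 < ω
  lt_deriv : ∀ x, ω < s * deriv F x
  add_one : ∀ x, F (x + 1) = F x + s * n

/-- The transfer operator of the circle map with lift `F`, on periodic lifts. -/
noncomputable def branchSum (F : ℝ → ℝ) (n : ℕ) (φ : ℝ → ℝ) (x : ℝ) : ℝ :=
  ∑ m ∈ Finset.range n, φ (Function.invFun F (x + m)) / |deriv F (Function.invFun F (x + m))|

namespace IsExpandingLift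

variable {F : ℝ → ℝ} {ω s : ℝ} {n : ℕ}

theorem sign_mul_self (h : IsExpandingLift F ω s n) : s * s = 1 := by
  rcases h.sign with rfl | rfl <;> norm_num

theorem abs_sign (h : IsExpandingLift F ω s n) : |s| = 1 := by
  rcases h.sign with rfl | rfl <;> simp

theorem pos (h : IsExpandingLift F ω s n) : 0 < ω := zero_lt_one.trans h.one_lt

theorem abs_deriv (h : IsExpandingLift F ω s n) (x : ℝ) : |deriv F x| = s * deriv F x := by
  have h1 : |s * deriv F x| = s * deriv F x := abs_of_pos (h.pos.trans (h.lt_deriv x))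
  rwa [abs_mul, h.abs_sign, one_mul] at h1

theorem lt_abs_deriv (h : IsExpandingLift F ω s n) (x : ℝ) : ω < |deriv F x| :=
  h.abs_deriv x ▸ h.lt_deriv x

theorem deriv_ne_zero (h : IsExpandingLift F ω s n) (x : ℝ) : deriv F x ≠ 0 :=
  abs_pos.1 (h.pos.trans (h.lt_abs_deriv x))

theorem differentiable (h : IsExpandingLift F ω s n) : Differentiable ℝ F :=
  h.contDiff.differentiable (by norm_num)

theorem contDiff_deriv (h : IsExpandingLift F ω s n) : ContDiff ℝ 4 (deriv F) := by
  have h1 : ContDiff ℝ (4 + 1) F := h.contDiff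
  exact (contDiff_succ_iff_deriv.1 h1).2.2

theorem mul_sub_le (h : IsExpandingLift F ω s n) {x y : ℝ} (hxy : x ≤ y) :
    ω * (y - x) ≤ s * F y - s * F x := by
  have hd : Differentiable ℝ fun x => s * F x := h.differentiable.const_mul s
  refine Convex.mul_sub_le_image_sub_of_le_deriv convex_univ hd.continuous.continuousOn
    hd.differentiableOn (fun x _ => ?_) x (mem_univ _) y (mem_univ _) hxy
  rw [deriv_const_mul _ (h.differentiable x)]
  exact (h.lt_deriv x).le

theorem mul_abs_sub_le (h : IsExpandingLift F ω s n) (x y : ℝ) :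
    ω * |x - y| ≤ |F x - F y| := by
  wlog hxy : x ≤ y generalizing x y
  · rw [abs_sub_comm, abs_sub_comm (F x)]
    exact this y x (le_of_not_ge hxy)
  have h1 := h.mul_sub_le hxy
  rw [abs_sub_comm, abs_of_nonneg (sub_nonneg.2 hxy), abs_sub_comm]
  refine h1.trans ((le_abs_self _).trans ?_)
  rw [← mul_sub, abs_mul, h.abs_sign, one_mul]

theorem injective (h : IsExpandingLift F ω s n) : Function.Injective F := fun x y hxy => by
  have := h.mul_abs_sub_le x y
  rw [hxy, sub_self, abs_zero] at this
  have h1 : |x - y| ≤ 0 := le_of_mul_le_mul_left (by simpa using this) h.pos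
  exact sub_eq_zero.1 (abs_nonpos_iff.1 h1)

theorem surjective (h : IsExpandingLift F ω s n) : Function.Surjective F := by
  have hc : Continuous fun x => s * F x := continuous_const.mul h.contDiff.continuous
  have hs : Function.Surjective fun x => s * F x := by
    refine hc.surjective ?_ ?_
    · refine Filter.tendsto_atTop_mono' _ (f₁ := fun x => s * F 0 + ω * x) ?_
        (Filter.tendsto_atTop_add_const_left _ _ (Filter.tendsto_id.const_mul_atTop h.pos))
      filter_upwards [Filter.eventually_ge_atTop 0] with x hx
      linarith [h.mul_sub_le hx]
    · refine Filter.tendsto_atBot_mono' _ (f₁ := fun x => s * F 0 + ω * x) ?_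
        (Filter.tendsto_atBot_add_const_left _ _ (Filter.tendsto_id.const_mul_atBot h.pos))
      filter_upwards [Filter.eventually_le_atBot 0] with x hx
      linarith [h.mul_sub_le hx]
  intro y
  obtain ⟨x, hx⟩ := hs (s * y)
  refine ⟨x, ?_⟩
  have := congrArg (s * ·) hx
  simpa only [← mul_assoc, h.sign_mul_self, one_mul] using this

theorem right_inv (h : IsExpandingLift F ω s n) (x : ℝ) : F (Function.invFun F x) = x :=
  Function.rightInverse_invFun h.surjective x

theorem left_inv (h : IsExpandingLift F ω s n) (x : ℝ) : Function.invFun F (F x) = x :=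
  Function.leftInverse_invFun h.injective x

theorem continuous_inv (h : IsExpandingLift F ω s n) : Continuous (Function.invFun F) := by
  refine LipschitzWith.continuous (K := ω⁻¹.toNNReal) <|
    LipschitzWith.of_dist_le_mul fun y y' => ?_
  have := h.mul_abs_sub_le (Function.invFun F y) (Function.invFun F y')
  rw [h.right_inv, h.right_inv] at this
  rwa [Real.dist_eq, Real.dist_eq, Real.coe_toNNReal _ (inv_nonneg.2 h.pos.le),
    le_inv_mul_iff₀ h.pos]

theorem hasDerivAt_inv (h : IsExpandingLift F ω s n) (x : ℝ) :
    HasDerivAt (Function.invFun F) (1 / deriv F (Function.invFun F x)) x := by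
  rw [one_div]
  exact HasDerivAt.of_local_left_inverse h.continuous_inv.continuousAt
    (h.differentiable _).hasDerivAt (h.deriv_ne_zero _)
    (Filter.Eventually.of_forall h.right_inv)

theorem inv_add (h : IsExpandingLift F ω s n) (x : ℝ) :
    Function.invFun F (x + s * n) = Function.invFun F x + 1 :=
  h.injective (by rw [h.right_inv, h.add_one, h.right_inv])

theorem periodic_deriv_lift (h : IsExpandingLift F ω s n) :
    Function.Periodic (deriv F) 1 := fun x => by
  rw [← deriv_comp_add_const F 1 x]
  simp only [h.add_one, deriv_add_const]

theorem contDiff_weight (h : IsExpandingLift F ω s n) :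
    ContDiff ℝ 4 fun x => 1 / deriv F x :=
  contDiff_const.div h.contDiff_deriv h.deriv_ne_zero

theorem branchSum_eq (h : IsExpandingLift F ω s n) (φ : ℝ → ℝ) : branchSum F n φ = fun x =>
    ∑ m ∈ Finset.range n, s * (1 / deriv F (Function.invFun F (x + m)) *
      φ (Function.invFun F (x + m))) := by
  funext x
  refine Finset.sum_congr rfl fun m _ => ?_
  have hd := h.deriv_ne_zero (Function.invFun F (x + m))
  have hs : s ≠ 0 := fun h0 => by simpa [h0] using h.sign_mul_self
  rw [h.abs_deriv, div_eq_iff (mul_ne_zero hs hd)]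
  field_simp
  linear_combination -φ (Function.invFun F (x + m)) * h.sign_mul_self

/-- The inverse lift gains 1 when its argument moves by sn, so a 1-periodic function composed with
it has period n. -/
theorem periodic_branch (h : IsExpandingLift F ω s n) {X : Type*} {w : ℝ → X}
    (hw : Function.Periodic w 1) :
    Function.Periodic (fun x => w (Function.invFun F x)) n := by
  have hp : Function.Periodic (fun x => w (Function.invFun F x)) (s * n) := fun x => by
    simp only [h.inv_add, hw _]
  rcases h.sign with rfl | rfl
  · simpa using hp
  · simpa using hp.neg

/-- Substitution: the inverse lift carries [0, n] onto one period, reversing it when s = -1, and the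
factor s corrects the orientation. -/
theorem integral_branch (h : IsExpandingLift F ω s n) {φ : ℝ → ℝ} (hc : Continuous φ)
    (hp : Function.Periodic φ 1) :
    ∫ x in (0 : ℝ)..n, s * (1 / deriv F (Function.invFun F x) * φ (Function.invFun F x)) =
      ∫ x in (0 : ℝ)..1, φ x := by
  have hcv := intervalIntegral.integral_comp_mul_deriv (a := 0) (b := n)
    (f := Function.invFun F) (f' := fun x => 1 / deriv F (Function.invFun F x)) (g := φ)
    (fun x _ => h.hasDerivAt_inv x)
    ((h.contDiff_weight.continuous.comp h.continuous_inv).continuousOn) hc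
  rw [intervalIntegral.integral_const_mul]
  have e : (fun x => 1 / deriv F (Function.invFun F x) * φ (Function.invFun F x)) =
      fun x => (φ ∘ Function.invFun F) x * (1 / deriv F (Function.invFun F x)) := by
    funext x
    simp only [Function.comp_apply, mul_comm]
  rw [e, hcv]
  have hper : ∀ a : ℝ, ∫ x in a..a + 1, φ x = ∫ x in (0 : ℝ)..1, φ x := fun a => by
    simpa using hp.intervalIntegral_add_eq a 0
  rcases h.sign with hs | hs
  · have := h.inv_add 0
    rw [hs, one_mul, zero_add] at this
    rw [hs, one_mul, this, hper]
  · have := h.inv_add n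
    rw [hs, neg_one_mul, add_neg_cancel] at this
    rw [hs, neg_one_mul, ← intervalIntegral.integral_symm, this, hper]

theorem isTransfer (h : IsExpandingLift F ω s n) :
    IsTransfer (branchSum F n) (fun x => 1 / deriv F x) (n / ω) where
  add φ ψ := by
    funext x
    simp only [branchSum, add_div, Finset.sum_add_distrib]
  const_mul r φ := by
    funext x
    simp only [branchSum, mul_div_assoc, Finset.mul_sum]
  map_nonneg φ hφ x := Finset.sum_nonneg fun m _ => div_nonneg (hφ _) (abs_nonneg _)
  bound φ M hM x := by
    have hM0 : 0 ≤ M := (abs_nonneg _).trans (hM 0)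
    refine (Finset.abs_sum_le_sum_abs _ _).trans ?_
    have : ∀ m ∈ Finset.range n, abs (φ (Function.invFun F (x + m)) /
        |deriv F (Function.invFun F (x + m))|) ≤ M / ω := fun m _ => by
      rw [abs_div, abs_abs]
      exact div_le_div₀ hM0 (hM _) h.pos (h.lt_abs_deriv _).le
    refine (Finset.sum_le_card_nsmul _ _ _ this).trans_eq ?_
    rw [Finset.card_range, nsmul_eq_mul]
    ring
  periodic φ hφ x := by
    set w : ℝ → ℝ := fun x => φ (Function.invFun F x) / |deriv F (Function.invFun F x)| with hw
    have hp : Function.Periodic w n :=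
      h.periodic_branch (w := fun x => φ x / |deriv F x|) fun x => by
        simp only [hφ x, h.periodic_deriv_lift x]
    -- Shifting x by 1 replaces the term m = 0 by the term m = n, and these agree by n-periodicity
    -- of w.
    have h1 := Finset.sum_range_succ (fun m : ℕ => w (x + m)) n
    rw [Finset.sum_range_succ'] at h1
    have h2 : ∑ m ∈ Finset.range n, w (x + 1 + m) = ∑ m ∈ Finset.range n, w (x + (m + 1 : ℕ)) :=
      Finset.sum_congr rfl fun m _ => by push_cast; ring_nf
    have h3 := hp x
    change ∑ m ∈ Finset.range n, w (x + 1 + m) = ∑ m ∈ Finset.range n, w (x + m)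
    rw [h2]
    simp only [Nat.cast_zero, add_zero] at h1
    linarith
  continuous φ hφ := by
    have hi := h.continuous_inv
    have hd := h.contDiff_deriv.continuous
    refine continuous_finsetSum _ fun m _ => Continuous.div ?_ ?_ fun x =>
      (abs_pos.2 (h.deriv_ne_zero _)).ne'
    · exact hφ.comp (hi.comp (by fun_prop))
    · exact (hd.comp (hi.comp (by fun_prop))).abs
  hasDerivAt φ hφ x := by
    rw [h.branchSum_eq, h.branchSum_eq]
    refine HasDerivAt.fun_sum fun m _ => HasDerivAt.const_mul s ?_
    have hd : Differentiable ℝ fun y => 1 / deriv F y * φ y :=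
      (h.contDiff_weight.differentiable (by norm_num)).mul (hφ.differentiable one_ne_zero)
    have h1 : HasDerivAt (fun x : ℝ => Function.invFun F (x + m))
        (1 / deriv F (Function.invFun F (x + m))) x :=
      (h.hasDerivAt_inv (x + m)).comp_add_const x m
    have h2 := (hd (Function.invFun F (x + m))).hasDerivAt.comp x h1
    rwa [mul_comm] at h2
  integral φ hc hp := by
    rw [h.branchSum_eq, ← h.integral_branch hc hp]
    set w : ℝ → ℝ := fun x =>
      s * (1 / deriv F (Function.invFun F x) * φ (Function.invFun F x)) with hw
    have hwc : Continuous w := continuous_const.mul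
      ((h.contDiff_weight.continuous.comp h.continuous_inv).mul (hc.comp h.continuous_inv))
    change ∫ x in (0 : ℝ)..1, ∑ m ∈ Finset.range n, w (x + m) = _
    have hwm : ∀ m : ℕ, Continuous fun x : ℝ => w (x + m) := fun m => hwc.comp (by fun_prop)
    rw [intervalIntegral.integral_finsetSum fun m _ => (hwm m).intervalIntegrable _ _]
    -- The n translates of [0, 1] tile [0, n], which reduces the claim to `integral_branch`.
    have h1 := intervalIntegral.sum_integral_adjacent_intervals (μ := volume) (f := w)
      (a := fun m : ℕ => (m : ℝ)) (n := n) fun m _ => hwc.intervalIntegrable _ _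
    rw [Nat.cast_zero] at h1
    rw [← h1]
    refine Finset.sum_congr rfl fun m _ => ?_
    rw [intervalIntegral.integral_comp_add_right]
    push_cast
    ring_nf

theorem branchSum_pos (h : IsExpandingLift F ω s n) (hn : 0 < n) {φ : ℝ → ℝ}
    (hφ : ∀ x, 0 ≤ φ x) {x : ℝ} (hx : 0 < φ x) : 0 < branchSum F n φ (F x) := by
  refine Finset.sum_pos' (fun m _ => div_nonneg (hφ _) (abs_nonneg _))
    ⟨0, Finset.mem_range.2 hn, ?_⟩
  rw [Nat.cast_zero, add_zero, h.left_inv]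
  exact div_pos hx (abs_pos.2 (h.deriv_ne_zero x))

theorem abs_deriv_weight_le (h : IsExpandingLift F ω s n) {D : ℝ}
    (hD : ∀ x, |deriv (deriv F) x| ≤ D) (x : ℝ) :
    |deriv (fun x => 1 / deriv F x) x| ≤ D / ω ^ 2 := by
  have hd : DifferentiableAt ℝ (deriv F) x := h.contDiff_deriv.differentiable (by norm_num) x
  simp only [one_div]
  rw [deriv_fun_inv'' hd (h.deriv_ne_zero x), abs_div, abs_neg, abs_pow]
  exact div_le_div₀ ((abs_nonneg _).trans (hD x)) (hD x) (pow_pos h.pos 2)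
    (pow_le_pow_left₀ h.pos.le (h.lt_abs_deriv x).le 2)

end IsExpandingLift

end SelfConsistent

namespace SelfConsistent

/-! ### Expanding maps of the circle -/

theorem coe_eq_coe_iff {x y : ℝ} : (x : S1) = (y : S1) ↔ ∃ k : ℤ, x = y + k := by
  rw [← sub_eq_zero, ← AddCircle.coe_sub, AddCircle.coe_eq_zero_iff]
  simp only [zsmul_eq_mul, mul_one]
  exact exists_congr fun k => ⟨fun h => by linarith, fun h => by linarith⟩

theorem coe_add_intCast (x : ℝ) (k : ℤ) : ((x + k : ℝ) : S1) = (x : S1) :=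
  coe_eq_coe_iff.2 ⟨k, rfl⟩

/-- The increment of the lift over a period is continuous and integer valued, hence constant. -/
theorem exists_degree {f : S1 → S1} {F : ℝ → ℝ} (hF : Continuous F)
    (hfF : ∀ x : ℝ, f (x : S1) = (F x : S1)) : ∃ d : ℤ, ∀ x, F (x + 1) = F x + d := by
  have h1 : ∀ x, ∃ m : ℤ, F (x + 1) = F x + m := fun x =>
    coe_eq_coe_iff.1 (by rw [← hfF, ← hfF, AddCircle.coe_add_period])
  choose m hm using h1
  have hc : Continuous m := by
    rw [Int.isClosedEmbedding_coe_real.isInducing.continuous_iff]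
    have e : (Int.cast ∘ m : ℝ → ℝ) = fun x => F (x + 1) - F x := by
      funext x
      simp only [Function.comp_apply, hm x, add_sub_cancel_left]
    rw [e]
    fun_prop
  exact ⟨m 0, fun x => by rw [hm x, PreconnectedSpace.constant inferInstance hc (x := x) (y := 0)]⟩

theorem exists_isExpandingLift {f : S1 → S1} {ω : ℝ} (hf : MapContDiff 5 f) (hω : 1 < ω)
    (hexp : ∀ x, ω < |mapDeriv f x|) : ∃ F s n, IsExpandingLift F ω s n ∧
      ∀ x : ℝ, f (x : S1) = (F x : S1) := by
  obtain ⟨F, hF, hfF⟩ := hf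
  have hd : Differentiable ℝ F := hF.differentiable (by norm_num)
  have hc : Continuous (deriv F) := hF.continuous_deriv (by norm_num)
  have habs : ∀ x, ω < |deriv F x| := fun x => by
    rw [← mapDeriv_coe hfF (hd x)]
    exact hexp x
  -- The continuous function F' never vanishes, so by connectedness it has one sign on all of ℝ.
  have hsign : ∃ s : ℝ, (s = 1 ∨ s = -1) ∧ ∀ x, ω < s * deriv F x := by
    rcases isPreconnected_univ.eq_or_eq_neg_of_sq_eq (f := fun x => |deriv F x|) (g := deriv F)
      hc.abs.continuousOn hc.continuousOn (fun x _ => sq_abs _)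
      (fun {x} _ => abs_pos.1 ((zero_lt_one.trans hω).trans (habs x))) with h | h
    · refine ⟨1, Or.inl rfl, fun x => ?_⟩
      rw [one_mul, ← h (mem_univ x)]
      exact habs x
    · refine ⟨-1, Or.inr rfl, fun x => ?_⟩
      rw [neg_one_mul]
      exact (habs x).trans_eq (h (mem_univ x))
  obtain ⟨s, hs, hlt⟩ := hsign
  obtain ⟨d, hd1⟩ := exists_degree hF.continuous hfF
  have hss : s * s = 1 := by rcases hs with rfl | rfl <;> norm_num
  -- By the mean value theorem the degree is a value of F', so it has the sign s; then n = |d|.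
  have hsd : 0 < s * d := by
    obtain ⟨c, -, hc⟩ := exists_deriv_eq_slope F (zero_lt_one' ℝ) hF.continuous.continuousOn
      hd.differentiableOn
    have h1 := hd1 0
    rw [zero_add] at h1
    rw [h1, sub_zero, div_one, add_sub_cancel_left] at hc
    rw [← hc]
    linarith [hlt c]
  have hn : ∃ n : ℕ, s * n = d := by
    refine ⟨d.natAbs, ?_⟩
    rw [Nat.cast_natAbs, Int.cast_abs]
    rcases hs with rfl | rfl
    · rw [one_mul, abs_of_pos (by linarith)]
    · rw [neg_one_mul, abs_of_neg (by linarith), neg_neg]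
  obtain ⟨n, hn⟩ := hn
  exact ⟨F, s, n, ⟨hF, hs, hω, hlt, fun x => by rw [hd1, hn]⟩, hfF⟩

namespace IsExpandingLift

variable {F : ℝ → ℝ} {ω s : ℝ} {n : ℕ} {f : S1 → S1}

theorem card_pos (h : IsExpandingLift F ω s n) : 0 < n := Nat.pos_of_ne_zero fun h0 => by
  have h1 := h.mul_sub_le (zero_le_one' ℝ)
  have h2 := h.add_one 0
  rw [zero_add, h0, Nat.cast_zero, mul_zero, add_zero] at h2
  rw [h2] at h1
  linarith [h.pos]

theorem coe_inv_add_mul (h : IsExpandingLift F ω s n) (x : ℝ) (k : ℤ) :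
    ((Function.invFun F (x + k * n) : ℝ) : S1) = ((Function.invFun F x : ℝ) : S1) :=
  (h.periodic_branch (w := fun x : ℝ => (x : S1))
    fun x => AddCircle.coe_add_period 1 x).int_mul k x

theorem apply_add_int (h : IsExpandingLift F ω s n) (x : ℝ) (k : ℤ) :
    F (x + k) = F x + s * (k * n) := by
  have hp : Function.Periodic (fun x => F x - x * (s * n)) 1 := fun x => by
    simp only [h.add_one]
    ring
  have := hp.int_mul k x
  simp only [mul_one] at this
  linear_combination this

/-- The preimages of x are the classes of F⁻¹(x + j) for integers j, and two of them coincide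
exactly when n divides the difference of the j. -/
theorem bijective_branch (h : IsExpandingLift F ω s n)
    (hfF : ∀ x : ℝ, f (x : S1) = (F x : S1)) (x : ℝ) :
    Function.Bijective fun m : Fin n => (⟨((Function.invFun F (x + (m : ℕ)) : ℝ) : S1), by
      rw [mem_preimage, hfF, h.right_inv]
      exact coe_add_intCast x (m : ℕ)⟩ : f ⁻¹' {(x : S1)}) := by
  constructor
  · intro m m' hm
    obtain ⟨k, hk⟩ := coe_eq_coe_iff.1 (congrArg Subtype.val hm)
    have h1 := congrArg F hk
    rw [h.right_inv, h.apply_add_int, h.right_inv] at h1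
    have h2 : (n : ℤ) ∣ (m : ℤ) - (m' : ℤ) := by
      rcases h.sign with rfl | rfl
      · exact ⟨k, by
          have : ((m : ℕ) : ℝ) - (m' : ℕ) = n * k := by linear_combination h1
          exact_mod_cast this⟩
      · exact ⟨-k, by
          have : ((m : ℕ) : ℝ) - (m' : ℕ) = n * -k := by linear_combination h1
          exact_mod_cast this⟩
    have h3 := Int.eq_zero_of_abs_lt_dvd h2 (by
      rw [abs_lt]
      constructor <;> omega)
    exact Fin.ext (by omega)
  · rintro ⟨y, hy⟩
    induction y using QuotientAddGroup.induction_on with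
    | H y =>
      have hy' : ((F y : ℝ) : S1) = (x : S1) := (hfF y).symm.trans hy
      obtain ⟨j, hj⟩ := coe_eq_coe_iff.1 hy'
      have hn' : (0 : ℤ) < n := by exact_mod_cast h.card_pos
      obtain ⟨m, hm⟩ := Int.eq_ofNat_of_zero_le (Int.emod_nonneg j hn'.ne')
      have hmn : m < n := by
        have := Int.emod_lt_of_pos j hn'
        omega
      refine ⟨⟨m, hmn⟩, Subtype.ext ?_⟩
      have e : x + m + (j / n : ℤ) * n = F y := by
        have h1 : ((j % n : ℤ) : ℝ) + (j / n : ℤ) * n = j := by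
          exact_mod_cast (mul_comm (j / n) (n : ℤ)) ▸ Int.emod_add_mul_ediv j n
        rw [hm] at h1
        rw [hj, ← h1]
        push_cast
        ring
      have := h.coe_inv_add_mul (x + m) (j / n)
      rw [e, h.left_inv] at this
      exact this.symm

theorem coveringNumber_eq (h : IsExpandingLift F ω s n)
    (hfF : ∀ x : ℝ, f (x : S1) = (F x : S1)) : coveringNumber f = n := by
  have := Nat.card_congr (Equiv.ofBijective _ (h.bijective_branch hfF 0))
  rw [Nat.card_fin, Nat.card_coe_set_eq] at this
  exact this.symm

theorem transfer_coe (h : IsExpandingLift F ω s n)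
    (hfF : ∀ x : ℝ, f (x : S1) = (F x : S1)) (φ : S1 → ℝ) (x : ℝ) :
    transfer f φ (x : S1) = branchSum F n (fun y => φ (y : S1)) x := by
  unfold transfer branchSum
  rw [← finsum_comp _ (h.bijective_branch hfF x), finsum_eq_sum_of_fintype,
    ← Fin.sum_univ_eq_sum_range (fun m : ℕ => φ ((Function.invFun F (x + m) : ℝ) : S1) /
      |deriv F (Function.invFun F (x + m))|)]
  refine Finset.sum_congr rfl fun m _ => ?_
  rw [mapDeriv_coe hfF (h.differentiable _)]

end IsExpandingLift

end SelfConsistent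

namespace SelfConsistent

/-! ### The mean field system of a coupled map -/

theorem dist_coe_le (x y : ℝ) : dist (x : S1) (y : S1) ≤ |x - y| := by
  rw [dist_eq_norm, ← AddCircle.coe_sub, UnitAddCircle.norm_eq]
  simpa using round_le (x - y) 0

/-- Representatives realizing the distance arise by subtracting the nearest integer. They turn a
derivative bound for the lift into a Lipschitz bound on the circle. -/
theorem exists_coe_abs_sub_eq_dist (p q : S1) :
    ∃ x y : ℝ, (x : S1) = p ∧ (y : S1) = q ∧ |x - y| = dist p q := by
  induction p using QuotientAddGroup.induction_on with
  | H x =>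
    induction q using QuotientAddGroup.induction_on with
    | H y =>
      refine ⟨x - round (x - y), y, ?_, rfl, ?_⟩
      · exact coe_eq_coe_iff.2 ⟨-round (x - y), by push_cast; ring⟩
      · change _ = dist (x : S1) (y : S1)
        rw [dist_eq_norm, ← AddCircle.coe_sub, UnitAddCircle.norm_eq]
        ring_nf

/-- `S` is the mean field system on lifts of the map `f` and the coupling `h`. -/
structure MeanFieldSystem.Models (S : MeanFieldSystem) (f : S1 → S1) (h : S1 → S1 → ℝ) :
    Prop where
  transfer_coe : ∀ (φ : S1 → ℝ) (x : ℝ), transfer f φ (x : S1) = S.P (fun y => φ (y : S1)) x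
  meanField_coe : ∀ (ψ : S1 → ℝ) (x : ℝ), meanField h ψ (x : S1) = S.A (fun y => ψ (y : S1)) x
  contDiff_A : ∀ ψ : ℝ → ℝ, Continuous ψ → ContDiff ℝ 5 (S.A ψ)

theorem exists_models {f : S1 → S1} {h : S1 → S1 → ℝ} {ω : ℝ} (hf : MapContDiff 5 f)
    (hh : TorusContDiff 5 h) (hω : 1 < ω) (hexp : ∀ x, ω < |mapDeriv f x|)
    (hdist : (coveringNumber f : ℝ) *
      ((⨆ x, |funDeriv (mapDeriv f) x|) / ω ^ 3 + 1 / ω ^ 2) < 1) :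
    ∃ S : MeanFieldSystem, S.Models f h := by
  obtain ⟨F, s, n, hF, hfF⟩ := exists_isExpandingLift hf hω hexp
  rw [hF.coveringNumber_eq hfF] at hdist
  set D := ⨆ x, |funDeriv (mapDeriv f) x| with hD
  have hder : ∀ x : ℝ, funDeriv (mapDeriv f) (x : S1) = deriv (deriv F) x := fun x => by
    rw [funDeriv_coe]
    congr 1
    funext y
    exact mapDeriv_coe hfF (hF.differentiable y)
  have hDle : ∀ x, |deriv (deriv F) x| ≤ D := by
    have hc : Continuous (deriv (deriv F)) := hF.contDiff_deriv.continuous_deriv (by norm_num)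
    obtain ⟨x₀, hx₀⟩ := exists_forall_abs_le hc (periodic_deriv hF.periodic_deriv_lift)
    -- A real `⨆` of an unbounded family is 0 by default, so boundedness has to be established
    -- before D can serve as an upper bound.
    have hb : BddAbove (range fun x : S1 => |funDeriv (mapDeriv f) x|) := by
      refine ⟨|deriv (deriv F) x₀|, ?_⟩
      rintro _ ⟨x, rfl⟩
      induction x using QuotientAddGroup.induction_on with
      | H x => exact (congrArg _ (hder x)).trans_le (hx₀ x)
    intro x
    rw [← hder]
    exact le_ciSup hb (x : S1)
  set k : ℝ → ℝ → ℝ := fun x y => h (x : S1) (y : S1) with hk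
  have h₁ : ∀ x y, k (x + 1) y = k x y := fun x y => by
    simp only [hk, AddCircle.coe_add_period]
  have h₂ : ∀ x y, k x (y + 1) = k x y := fun x y => by
    simp only [hk, AddCircle.coe_add_period]
  have hkc : ContDiff ℝ (5 : ℕ) fun p : ℝ × ℝ => k p.1 p.2 := hh
  obtain ⟨H, hH, hA⟩ := exists_kernelMean_ckBound 5 hkc h₁ h₂
  have hω0 : 0 < ω := hF.pos
  let S : MeanFieldSystem :=
    { P := branchSum F n
      a := fun x => 1 / deriv F x
      c := n / ω
      α := 1 / ω
      β := D / ω ^ 2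
      isTransfer := hF.isTransfer
      contDiff_a := hF.contDiff_weight.of_le (by norm_num)
      periodic_a := fun x => by simp only [hF.periodic_deriv_lift x]
      abs_a_le := fun x => by
        rw [abs_div, abs_one]
        exact one_div_le_one_div_of_le hω0 (hF.lt_abs_deriv x).le
      abs_deriv_a_le := hF.abs_deriv_weight_le hDle
      α_le_one := (div_le_one hω0).2 hω.le
      -- With these choices c(α + β) = (n/ω)(1/ω + D/ω²), which is the quantity in the hypothesis.
      contracting := by
        refine lt_of_eq_of_lt ?_ hdist
        field_simp
        ring
      A := kernelMean k
      H := H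
      F := F
      ω := ω
      A_ckBound := fun ψ B hψ _ hB => (hA ψ B hψ hB).of_le (by norm_num)
      A_add := fun ψ χ hψ hχ => kernelMean_add hkc.continuous hψ hχ
      A_const_mul := kernelMean_const_mul k
      one_lt_ω := hω
      continuous_F := hF.contDiff.continuous
      expanding := hF.mul_abs_sub_le
      P_pos := fun φ hφ x hx => hF.branchSum_pos hF.card_pos hφ hx }
  exact ⟨S, hF.transfer_coe hfF, fun ψ x => integral_eq_integral_lift _,
    fun ψ hψ => (hA ψ _ hψ le_rfl).contDiff⟩

namespace MeanFieldSystem.Models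

variable {S : MeanFieldSystem} {f : S1 → S1} {h : S1 → S1 → ℝ} {t η : ℝ} {ψ : S1 → ℝ}

theorem couplingMap_coe (hS : S.Models f h) (t : ℝ) (ψ : S1 → ℝ) (x : ℝ) :
    couplingMap h t ψ (x : S1) = ((x + S.coupling t (fun y => ψ (y : S1)) x : ℝ) : S1) := by
  rw [couplingMap, hS.meanField_coe, ← AddCircle.coe_add]
  rfl

theorem funDeriv_meanField_coe (hS : S.Models f h) (ψ : S1 → ℝ) (x : ℝ) :
    funDeriv (meanField h ψ) (x : S1) = deriv (S.A fun y => ψ (y : S1)) x := by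
  rw [funDeriv_coe]
  congr 1
  funext y
  exact hS.meanField_coe ψ y

theorem couplingDeriv_coe (hS : S.Models f h) (t : ℝ) (ψ : S1 → ℝ) (x : ℝ) :
    couplingDeriv h t ψ (x : S1) = 1 + deriv (S.coupling t fun y => ψ (y : S1)) x := by
  rw [couplingDeriv, hS.funDeriv_meanField_coe]
  unfold coupling
  rw [deriv_const_mul_field]

theorem injective_couplingMap (hS : S.Models f h)
    (hu : IsSmall η (S.coupling t fun y => ψ (y : S1))) :
    Function.Injective (couplingMap h t ψ) := by
  intro p q hpq
  induction p using QuotientAddGroup.induction_on with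
  | H x =>
    induction q using QuotientAddGroup.induction_on with
    | H y =>
      have h1 := (hS.couplingMap_coe t ψ x).symm.trans (hpq.trans (hS.couplingMap_coe t ψ y))
      obtain ⟨k, hk⟩ := coe_eq_coe_iff.1 h1
      have hp := hu.ckBound.periodic.int_mul k y
      rw [mul_one] at hp
      refine coe_eq_coe_iff.2 ⟨k, hu.strictMono.injective ?_⟩
      simp only [hp]
      linarith

/-- `Function.invFun` is a genuine left inverse because the coupling map is injective; evaluating it
at the image of the lifted inverse identifies the two. -/
theorem couplingInv_coe (hS : S.Models f h)
    (hu : IsSmall η (S.coupling t fun y => ψ (y : S1))) (x : ℝ) :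
    couplingInv h t ψ (x : S1) =
      ((perturbInv (S.coupling t fun y => ψ (y : S1)) x : ℝ) : S1) := by
  have h1 := hS.couplingMap_coe t ψ (perturbInv (S.coupling t fun y => ψ (y : S1)) x)
  rw [hu.right_inv] at h1
  rw [← h1]
  exact Function.leftInverse_invFun (hS.injective_couplingMap hu) _

theorem couplingTransfer_coe (hS : S.Models f h)
    (hu : IsSmall η (S.coupling t fun y => ψ (y : S1))) (φ : S1 → ℝ) (x : ℝ) :
    couplingTransfer h t ψ φ (x : S1) =
      perturbTransfer (S.coupling t fun y => ψ (y : S1)) (fun y => φ (y : S1)) x := by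
  rw [couplingTransfer, hS.couplingInv_coe hu, hS.couplingDeriv_coe]
  rfl

theorem coupledTransfer_coe (hS : S.Models f h)
    (hu : IsSmall η (S.coupling t fun y => ψ (y : S1))) (φ : S1 → ℝ) (x : ℝ) :
    coupledTransfer f h t ψ φ (x : S1) =
      S.L (S.coupling t fun y => ψ (y : S1)) (fun y => φ (y : S1)) x := by
  rw [coupledTransfer, hS.transfer_coe, funext (hS.couplingTransfer_coe hu φ)]
  rfl

theorem transfer_theta_coe (hS : S.Models f h)
    (hu : IsSmall η (S.coupling t fun y => ψ (y : S1))) (g : S1 → ℝ) (x : ℝ) :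
    transfer f (theta h t ψ g) (x : S1) = S.P (S.lin (S.coupling t fun y => ψ (y : S1))
      (fun y => ψ (y : S1)) fun y => g (y : S1)) x := by
  rw [hS.transfer_coe]
  congr 1
  funext y
  rw [theta, funDeriv_coe]
  unfold lin
  congr 1
  funext y
  rw [hS.couplingInv_coe hu, hS.couplingDeriv_coe, hS.meanField_coe, div_mul_eq_mul_div]
  rfl

theorem isDiffeo (hS : S.Models f h) (hu : IsSmall η (S.coupling t fun y => ψ (y : S1)))
    (hψ : Continuous ψ) : IsDiffeo 5 (couplingMap h t ψ) := by
  have hc : ContDiff ℝ 5 (S.coupling t fun y => ψ (y : S1)) :=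
    contDiff_const.mul (hS.contDiff_A _ (hψ.comp (AddCircle.continuous_mk' 1)))
  refine ⟨couplingInv h t ψ, Function.leftInverse_invFun (hS.injective_couplingMap hu),
    fun p => ?_, ⟨_, contDiff_id.add hc, hS.couplingMap_coe t ψ⟩,
    ⟨_, hu.contDiff_inv hc, hS.couplingInv_coe hu⟩⟩
  induction p using QuotientAddGroup.induction_on with
  | H x =>
    refine (congrArg _ (hS.couplingInv_coe hu x)).trans ((hS.couplingMap_coe t ψ _).trans ?_)
    rw [hu.right_inv]

theorem couplingDeriv_pos (hS : S.Models f h)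
    (hu : IsSmall η (S.coupling t fun y => ψ (y : S1))) (x : S1) : 0 < couplingDeriv h t ψ x := by
  induction x using QuotientAddGroup.induction_on with
  | H x => exact (hu.pos x).trans_eq (hS.couplingDeriv_coe t ψ x).symm

end MeanFieldSystem.Models

theorem isDensity_lift {ψ : S1 → ℝ} (hc : Continuous ψ) (hp : ∀ x, 0 ≤ ψ x)
    (hi : ∫ x, ψ x = 1) : IsDensity fun x : ℝ => ψ (x : S1) :=
  ⟨hc.comp (AddCircle.continuous_mk' 1), periodic_lift ψ, fun x => hp x,
    (integral_eq_integral_lift ψ).symm.trans hi⟩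

/-! ### Fixed densities on the circle and on the line -/

namespace MeanFieldSystem.IsTimeRange

variable {S : MeanFieldSystem} {f : S1 → S1} {h : S1 → S1 → ℝ} {η θ ε C t : ℝ}

theorem isSelfConsistent_of_isFixedDensity (hT : S.IsTimeRange η θ ε C) (hS : S.Models f h)
    (ht : |t| ≤ ε) {φ : S1 → ℝ} (hφ : IsFixedDensity f h t φ) :
    S.IsSelfConsistent t fun x => φ (x : S1) := by
  obtain ⟨⟨K, hK⟩, hpos, hi, hfix⟩ := hφ
  have hd := isDensity_lift hK.continuous (fun x => (hpos x).le) hi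
  refine hT.isSelfConsistent_of_lipschitz ht hd (K := K) (fun x y => ?_) ?_
  · exact (hK.dist_le_mul (x : S1) (y : S1)).trans
      (mul_le_mul_of_nonneg_left (dist_coe_le x y) K.2)
  · funext x
    rw [← hS.coupledTransfer_coe (hT.isSmall ht hd)]
    exact congrFun hfix x

theorem isFixedDensity (hT : S.IsTimeRange η θ ε C) (hS : S.Models f h) (ht : |t| ≤ ε)
    {g : C1} (hg : S.IsSelfConsistent t (C1.lift g)) : IsFixedDensity f h t (C1.fn g) := by
  refine ⟨⟨‖g‖.toNNReal, LipschitzWith.of_dist_le_mul fun p q => ?_⟩, fun p => ?_,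
    (C1.integral_fn g).trans hg.isDensity.integral, ?_⟩
  · obtain ⟨x, y, rfl, rfl, e⟩ := exists_coe_abs_sub_eq_dist p q
    rw [← e, Real.coe_toNNReal _ (norm_nonneg g)]
    have hb := C1.ckBound_lift g
    exact abs_sub_le_of_abs_deriv_le hb.differentiable hb.abs_deriv_le x y
  · induction p using QuotientAddGroup.induction_on with
    | H x => exact hT.density_pos ht hg x
  · funext p
    induction p using QuotientAddGroup.induction_on with
    | H x =>
      exact (hS.coupledTransfer_coe (hT.isSmall ht hg.isDensity) _ x).trans
        (congrFun hg.isInvariant.eq x)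

end MeanFieldSystem.IsTimeRange

/-! ### The uncoupled system -/

section Zero

variable (f : S1 → S1) (h : S1 → S1 → ℝ) (ψ : S1 → ℝ)

theorem couplingMap_zero : couplingMap h 0 ψ = id := by
  funext x
  simp [couplingMap]

theorem couplingInv_zero (x : S1) : couplingInv h 0 ψ x = x := by
  rw [couplingInv, couplingMap_zero]
  exact Function.leftInverse_invFun Function.injective_id x

theorem couplingDeriv_zero (x : S1) : couplingDeriv h 0 ψ x = 1 := by
  simp [couplingDeriv]

theorem coupledTransfer_zero (φ : S1 → ℝ) : coupledTransfer f h 0 ψ φ = transfer f φ := by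
  unfold coupledTransfer
  congr 1
  funext x
  simp only [couplingTransfer, couplingInv_zero, couplingDeriv_zero, div_one]

theorem theta_zero (g : S1 → ℝ) :
    theta h 0 ψ g = funDeriv fun y => ψ y * meanField h g y := by
  simp only [theta, couplingInv_zero, couplingDeriv_zero, div_one]

end Zero

end SelfConsistent

/-! ### The main theorem -/

open SelfConsistent in
theorem theorem2 (f : S1 → S1) (h : S1 → S1 → ℝ) (ω : ℝ)
    (hf : MapContDiff 5 f) (hh : TorusContDiff 5 h)
    (hω : 1 < ω) (hexp : ∀ x, ω < |mapDeriv f x|)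
    (hdist : (coveringNumber f : ℝ) *
      ((⨆ x, |funDeriv (mapDeriv f) x|) / ω ^ 3 + 1 / ω ^ 2) < 1) :
    ∃ ε₀ : ℝ, 0 < ε₀ ∧
      -- for `|t| ≤ ε₀` the coupling maps are diffeomorphisms
      (∀ t : ℝ, |t| ≤ ε₀ → ∀ ψ : S1 → ℝ, Continuous ψ → (∀ x, 0 ≤ ψ x) → ∫ x, ψ x = 1 →
        IsDiffeo 5 (couplingMap h t ψ) ∧ ∀ x, 0 < couplingDeriv h t ψ x) ∧
      ∃ ρ : ℝ → C1,
        -- `ρ(t)` is the unique fixed density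
        (∀ t : ℝ, |t| ≤ ε₀ → IsFixedDensity f h t (C1.fn (ρ t)) ∧
          ∀ φ : S1 → ℝ, IsFixedDensity f h t φ → φ = C1.fn (ρ t)) ∧
        -- (i)
        (∀ t : ℝ, |t| ≤ ε₀ → FunContDiff 3 (C1.fn (ρ t))) ∧
        -- (ii)
        ∃ ε₂ : ℝ, 0 < ε₂ ∧ ε₂ ≤ ε₀ ∧ ContDiffOn ℝ 1 ρ (Set.Icc (-ε₂) ε₂) ∧
        -- (iii)
        ∃ ε₃ : ℝ, 0 < ε₃ ∧ ε₃ ≤ ε₂ ∧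
          (∀ t : ℝ, |t| < ε₃ →
            ∃ (T : c1ZeroMean ≃L[ℝ] c1ZeroMean) (r : c1ZeroMean),
              (∀ g : c1ZeroMean, ∀ x : S1, C1.fn (T g) x =
                C1.fn g x - coupledTransfer f h t (C1.fn (ρ t)) (C1.fn g) x
                  + t * transfer f (theta h t (C1.fn (ρ t)) (C1.fn g)) x) ∧
              (∀ x : S1, C1.fn r x =
                transfer f (theta h t (C1.fn (ρ t)) (C1.fn (ρ t))) x) ∧
              HasDerivAt ρ (-(T.symm r : C1)) t) ∧
          -- the case `t = 0`
          ∃ (T : c1ZeroMean ≃L[ℝ] c1ZeroMean) (r : c1ZeroMean),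
            (∀ g : c1ZeroMean, ∀ x : S1, C1.fn (T g) x =
              C1.fn g x - transfer f (C1.fn g) x) ∧
            (∀ x : S1, C1.fn r x = transfer f
              (funDeriv (fun y => C1.fn (ρ 0) y * meanField h (C1.fn (ρ 0)) y)) x) ∧
            HasDerivAt ρ (-(T.symm r : C1)) 0 := by
  obtain ⟨S, hS⟩ := exists_models hf hh hω hexp hdist
  obtain ⟨η, θ, ε, C, hT⟩ := S.exists_isTimeRange
  obtain ⟨ρ, hρ, hsmooth, hderiv⟩ := hT.exists_family
  have hε := hT.pos
  -- The family is C¹ on the open interval (-ε, ε) only; halving gives a closed interval inside it,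
  -- and the same half serves as ε₂ and ε₃.
  have hresponse : ∀ t : ℝ, |t| < ε / 2 →
      ∃ (T : c1ZeroMean ≃L[ℝ] c1ZeroMean) (r : c1ZeroMean),
        (∀ g : c1ZeroMean, ∀ x : S1, C1.fn (T g) x =
          C1.fn g x - coupledTransfer f h t (C1.fn (ρ t)) (C1.fn g) x
            + t * transfer f (theta h t (C1.fn (ρ t)) (C1.fn g)) x) ∧
        (∀ x : S1, C1.fn r x = transfer f (theta h t (C1.fn (ρ t)) (C1.fn (ρ t))) x) ∧
        HasDerivAt ρ (-(T.symm r : C1)) t := fun t ht => by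
    have ht1 : |t| < ε := by linarith
    have ht2 := ht1.le
    have hu := hT.isSmall ht2 (hρ t ht2).isDensity
    refine ⟨hT.resolvent ht2 (hρ t ht2), hT.response ht2 (hρ t ht2), fun g x => ?_, fun x => ?_,
      hderiv t ht2 ht1⟩
    · induction x using QuotientAddGroup.induction_on with
      | H x =>
        rw [hT.resolvent_apply]
        refine Eq.trans ?_ (congrArg₂ (fun a b => C1.lift g x - a + t * b)
          (hS.coupledTransfer_coe hu (C1.fn g) x) (hS.transfer_theta_coe hu (C1.fn g) x)).symm
        exact sub_sub_eq_add_sub _ _ _ |>.trans (add_sub_right_comm _ _ _)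
    · induction x using QuotientAddGroup.induction_on with
      | H x => exact (hS.transfer_theta_coe hu (C1.fn (ρ t)) x).symm
  refine ⟨ε, hε, fun t ht ψ hc hp hi => ?_, ρ, fun t ht => ⟨hT.isFixedDensity hS ht (hρ t ht),
    fun φ hφ => ?_⟩, fun t ht => (hρ t ht).isInvariant.contDiff, ε / 2, by linarith, by linarith,
    hsmooth.mono fun t ht => ⟨by linarith [ht.1], by linarith [ht.2]⟩, ε / 2, by linarith, le_rfl,
    hresponse, ?_⟩
  · have hu := hT.isSmall ht (isDensity_lift hc hp hi)
    exact ⟨hS.isDiffeo hu hc, hS.couplingDeriv_pos hu⟩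
  -- Uniqueness among Lipschitz densities has two stages: a Lipschitz fixed density is the C³
  -- invariant density of its own coupling, and self-consistent C³ densities at equal times
  -- coincide.
  · have := hT.unique ht (hρ t ht) (hT.isSelfConsistent_of_isFixedDensity hS ht hφ)
    funext p
    induction p using QuotientAddGroup.induction_on with
    | H x => exact congrFun this x
  · obtain ⟨T, r, h1, h2, h3⟩ := hresponse 0 (by rw [abs_zero]; linarith)
    refine ⟨T, r, fun g x => ?_, fun x => ?_, h3⟩
    · rw [h1, coupledTransfer_zero, zero_mul, add_zero]
    · rw [h2, theta_zero]
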